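/- **Setting.** There are $K$ arms, rounds $t=1,\dots,T$ with $T\ge 1$, a finite context space $\mathcal X$, and a known feature map $\phi:[K]\times\mathcal X\to\mathcal Z\subset\mathbb R^d$, $d\ge 1$. In round $t$ nature chooses $\theta_t\in\Theta\subset\mathbb R^d$ from the past information $\mathcal F_{t-1}$ (which contains $(X_s,A_s,\ell_s(A_s,X_s))_{s<t}$); a fresh context $X_t\sim\mathcal G$, independent of $\mathcal F_{t-1}$, is drawn; the learner draws $A_t\in[K]$ from $\pi_t(\cdot\mid X_t)$ with fresh randomness and observes $\ell_t(A_t,X_t)$, where $\ell_t(a,x)=\langle\phi(a,x),\theta_t\rangle+\varepsilon_t(a)$ and $\mathbb E[\varepsilon_t(a)\mid X_t,\mathcal F_{t-1}]=0$. Assume: 1. (finite support) $L\ge|\mathcal X|$ and $\mathbb P(X_t=x)\ge 1/L$ for all $x\in\mathcal X$; 2. (exploration policy) with $\Sigma(p)=\mathbb E_{X\sim\mathcal G,\,a\sim p_X}[\phi(a,X)\phi(a,X)^\top]$, there are $\lambda>0$ and distributions $e^*_x$ on $[K]$, $x\in\mathcal X$, such that $\Sigma(e^*)$ is invertible and $z^\top\Sigma(e^*)^{-1}z\le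 1/\lambda$ for all $z\in\mathcal Z$; 3. (bounded losses) $|\langle z,\theta\rangle|\le1$ for $z\in\mathcal Z$, $\theta\in\Theta$, and almost surely $|\ell_t(a,x)|\le 1$ for all $a,x,t$. **Algorithm.** The $1/2$-LC-Tsallis-INF plays $\pi_t(x)=(1-\gamma_t)q_t(x)+\gamma_t e^*_x$, where $q_t(x)$ minimizes $$\sum_{s<t}\langle\widehat\ell_s(x),q\rangle+\frac1{\eta_{t-1}}\psi(q),\qquad \psi(q)=2\Big(1-\sum_a\sqrt{q(a)}\Big),$$ over the probability simplex, with $1/\eta_0=0$ (so $q_1$ is any map from $\mathcal X$ to the simplex fixed before round $1$), $$\eta_t=\min\Big\{\frac{K^{1/4}}{\sqrt{dt}},\ \frac1{16}\sqrt{\lambda/L}\Big\},\qquad \gamma_t=\frac{128L\eta_t^2}{\lambda},$$ and $\widehat\ell_t(a,x)=\langle\widehat\theta_t,\phi(a,x)\rangle$, $\widehat\theta_t=\Sigma(\pi_t)^{-1}\phi(A_t,X_t)\,\ell_t(A_t,X_t)$. **Regret and regime.** Let $$R_T=\max_{\rho:\mathcal X\to[K]}\mathbb E\Big[\sum_{t=1}^T\big(\ell_t(A_t,X_t)-\ell_t(\rho(X_t),X_t)\big)\Big],$$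 and let $\rho^*_T$ be a minimizer of $\rho\mapsto\mathbb E\big[\sum_{t=1}^T\langle\phi(\rho(X_t),X_t),\theta_t\rangle\big]$. For $\Delta_*,C>0$ assume the $(\Delta_*,C,T)$-self-bounding constraint $$R_T\ \ge\ \Delta_*\,\mathbb E\Big[\sum_{t=1}^T\sum_{a\ne\rho_T^*(X_t)}\pi_t(a\mid X_t)\Big]-C .$$ (This holds in particular if $R_T\ge\mathbb E\big[\sum_{t}\sum_{a\ne\rho_T^*(X_t)}\Delta_t(a\mid X_t)\pi_t(a\mid X_t)\big]-C$ and $\Delta_t(a\mid x)=\langle\phi(a,x)-\phi(\rho_T^*(x),x),\theta_t\rangle\ge\Delta_*$ for all $t$, $x$ and $a\ne\rho_T^*(x)$.) **Theorem.** There is a universal constant $c>0$ such that in every such situation, with $\kappa=\sqrt{KL/\lambda}+\frac{\sqrt K L}{\lambda d}\log T$ and $\log_+(x)=\max\{1,\log x\}$, $$R_T\le c\Big(\frac{Ld\sqrt K}{\Delta_*}\log T+\kappa+C\Big).$$ Moreover, if $T\ge L^2d\sqrt K/\Delta_*^2$ and $$\frac{dL\sqrt K}{\Delta_*}\Big(\log\frac{T\Delta_*^2}{L^2d\sqrt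 K}+1\Big)\le C\le\frac{\Delta_*T}{L},$$ then $$R_T\le c\Big(\sqrt{\frac{CL\sqrt K\,d}{\Delta_*}\,\log_+\Big(\frac{\Delta_*T}{CL}\Big)}+\kappa\Big).$$ -/

import Mathlib

open MeasureTheory ProbabilityTheory Matrix

noncomputable section

namespace LCTsallis

/-- The fixed data of a linear contextual bandit with `K` arms and `d`-dimensional features over the
context space `𝒳`: context distribution `G`, known feature map `φ`, feature space `Z`, parameter
space `Θ`, the constants `L` and `lam` (written `λ` in the mathematics), and the exploration
policy `e` (written `e^*`). -/
structure Setting (𝒳 : Type*) [MeasurableSpace 𝒳] (K d : ℕ) where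
  G : Measure 𝒳
  φ : Fin K → 𝒳 → Fin d → ℝ
  Z : Set (Fin d → ℝ)
  Θ : Set (Fin d → ℝ)
  L : ℝ
  lam : ℝ
  e : 𝒳 → Fin K → ℝ

section Static

variable {𝒳 : Type*} [MeasurableSpace 𝒳] [Fintype 𝒳] {K d : ℕ}

/-- `Σ(p) = E_{X ∼ G, a ∼ p_X} [φ(a, X) φ(a, X)ᵀ]`; the context space is finite. -/
def Setting.covariance (S : Setting 𝒳 K d) (p : 𝒳 → Fin K → ℝ) : Matrix (Fin d) (Fin d) ℝ :=
  ∑ x, S.G.real {x} • ∑ a, p x a • vecMulVec (S.φ a x) (S.φ a x)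

/-- Standing assumptions on contexts, features, parameters and the exploration policy. -/
structure Setting.Assumptions (S : Setting 𝒳 K d) : Prop where
  /-- `G` is a probability distribution -/
  prob : IsProbabilityMeasure S.G
  /-- features lie in the feature space -/
  φ_mem : ∀ a x, S.φ a x ∈ S.Z
  /-- finite support: `L ≥ |𝒳|` and every context has probability at least `1 / L` -/
  card_le : (Fintype.card 𝒳 : ℝ) ≤ S.L
  mass_ge : ∀ x, 1 / S.L ≤ S.G.real {x}
  /-- exploration policy: `zᵀ Σ(e)⁻¹ z ≤ 1 / λ` on the feature space, with `Σ(e)` invertible -/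
  lam_pos : 0 < S.lam
  e_mem : ∀ x, S.e x ∈ stdSimplex ℝ (Fin K)
  e_isUnit : IsUnit (S.covariance S.e)
  e_bound : ∀ z ∈ S.Z, z ⬝ᵥ ((S.covariance S.e)⁻¹ *ᵥ z) ≤ 1 / S.lam
  /-- bounded mean losses -/
  bounded : ∀ z ∈ S.Z, ∀ θ ∈ S.Θ, |z ⬝ᵥ θ| ≤ 1

/-- `η_t = min {K^{1/4} / √(d t), (1/16) √(λ / L)}`, the learning rate for finite contexts. -/
def Setting.eta (S : Setting 𝒳 K d) (t : ℕ) : ℝ :=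
  min ((K : ℝ) ^ (1 / 4 : ℝ) / √((d : ℝ) * t)) (1 / 16 * √(S.lam / S.L))

/-- `1 / η_t`, with the convention `1 / η_0 = 0`. -/
def Setting.invEta (S : Setting 𝒳 K d) (t : ℕ) : ℝ :=
  if t = 0 then 0 else 1 / S.eta t

/-- `γ_t = 128 L η_t² / λ`, the exploration rate. -/
def Setting.gamma (S : Setting 𝒳 K d) (t : ℕ) : ℝ :=
  128 * S.L * S.eta t ^ 2 / S.lam

/-- `κ = √(K L / λ) + (√K L / (λ d)) log T`. -/
def Setting.kappa (S : Setting 𝒳 K d) (T : ℕ) : ℝ :=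
  √(K * S.L / S.lam) + √K * S.L / (S.lam * d) * Real.log T

end Static

/-- The regularizer of the algorithm: `ψ(p) = (1/α) (1 - ∑_a p(a)^α)`. -/
def tsallis {K : ℕ} (α : ℝ) (p : Fin K → ℝ) : ℝ :=
  1 / α * (1 - ∑ a, p a ^ α)

/-- `log₊ x = max {1, log x}`. -/
def logPlus (x : ℝ) : ℝ := max 1 (Real.log x)

/-- The random quantities of an interaction; rounds are `t = 1, …, T`. `X t` is the context, `A t` the
chosen arm, `θ t` the loss parameter, `ε t` the noise vector, and `q t ω x` the distribution
on arms that the learner computes for context `x` before exploration is mixed in. -/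
structure Play (Ω 𝒳 : Type*) (K d : ℕ) where
  X : ℕ → Ω → 𝒳
  A : ℕ → Ω → Fin K
  θ : ℕ → Ω → Fin d → ℝ
  ε : ℕ → Ω → Fin K → ℝ
  q : ℕ → Ω → 𝒳 → Fin K → ℝ

section Dynamic

variable {Ω 𝒳 : Type*} [mΩ : MeasurableSpace Ω] [MeasurableSpace 𝒳] [Fintype 𝒳] {K d : ℕ}

/-- Linear loss `ℓ_t(a, x) = ⟨φ(a, x), θ_t⟩ + ε_t(a)`. -/
def Play.loss (P : Play Ω 𝒳 K d) (S : Setting 𝒳 K d) (t : ℕ) (ω : Ω) (a : Fin K) (x : 𝒳) : ℝ :=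
  S.φ a x ⬝ᵥ P.θ t ω + P.ε t ω a

/-- The policy played: `π_t(a | x) = (1 - γ_t) q_t(a | x) + γ_t e(a | x)`. -/
def Play.policy (P : Play Ω 𝒳 K d) (S : Setting 𝒳 K d) (t : ℕ) (ω : Ω) (x : 𝒳) (a : Fin K) : ℝ :=
  (1 - S.gamma t) * P.q t ω x a + S.gamma t * S.e x a

/-- `θ̂_t = Σ_t⁻¹ φ(A_t, X_t) ℓ_t(A_t, X_t)` with `Σ_t = Σ(π_t)`. -/
def Play.thetaHat (P : Play Ω 𝒳 K d) (S : Setting 𝒳 K d) (t : ℕ) (ω : Ω) : Fin d → ℝ :=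
  P.loss S t ω (P.A t ω) (P.X t ω) •
    ((S.covariance (P.policy S t ω))⁻¹ *ᵥ S.φ (P.A t ω) (P.X t ω))

/-- `ℓ̂_t(a, x) = ⟨θ̂_t, φ(a, x)⟩`. -/
def Play.lossHat (P : Play Ω 𝒳 K d) (S : Setting 𝒳 K d) (t : ℕ) (ω : Ω) (x : 𝒳) (a : Fin K) : ℝ :=
  P.thetaHat S t ω ⬝ᵥ S.φ a x

/-- The objective minimized by `q_t(x)`:
`∑_{s < t} ⟨ℓ̂_s(x), p⟩ + (1 / η_{t-1}) ψ(p)` with the `1/2`-Tsallis regularizer. -/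
def Play.objective (P : Play Ω 𝒳 K d) (S : Setting 𝒳 K d) (t : ℕ) (ω : Ω) (x : 𝒳)
    (p : Fin K → ℝ) : ℝ :=
  ∑ s ∈ Finset.Icc 1 (t - 1), P.lossHat S s ω x ⬝ᵥ p + S.invEta (t - 1) * tsallis (1 / 2) p

/-- The learner runs the `1/2`-LC-Tsallis-INF: in each round `q_t(x)` is a minimizer of the objective
over the probability simplex (it is unique for `t ≥ 2`; for `t = 1` the objective vanishes and any
distribution fixed before the first round is allowed). -/
structure Play.IsTsallisINF (P : Play Ω 𝒳 K d) (S : Setting 𝒳 K d) (ℱ : Filtration ℕ mΩ) (T : ℕ) :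
    Prop where
  /-- the policy of round `t` is determined by the information available before the round -/
  q_measurable : ∀ t, 1 ≤ t → t ≤ T → ∀ x a, Measurable[ℱ (t - 1)] (fun ω => P.q t ω x a)
  q_mem : ∀ t, 1 ≤ t → t ≤ T → ∀ ω x, P.q t ω x ∈ stdSimplex ℝ (Fin K)
  q_min : ∀ t, 1 ≤ t → t ≤ T → ∀ ω x,
    IsMinOn (P.objective S t ω x) (stdSimplex ℝ (Fin K)) (P.q t ω x)

/-- The interaction protocol. `ℱ t` is the information at the end of round `t`; it contains the
observed history `(X_s, A_s, ℓ_s(A_s, X_s))`, `s ≤ t`, and possibly randomness of nature. -/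
structure Play.IsInteraction (P : Play Ω 𝒳 K d) (S : Setting 𝒳 K d) (μ : Measure Ω)
    (ℱ : Filtration ℕ mΩ) (T : ℕ) : Prop where
  /-- the observed history is part of the information -/
  X_measurable : ∀ t, 1 ≤ t → t ≤ T → Measurable[ℱ t] (P.X t)
  A_measurable : ∀ t, 1 ≤ t → t ≤ T → Measurable[ℱ t] (P.A t)
  loss_measurable : ∀ t, 1 ≤ t → t ≤ T →
    Measurable[ℱ t] (fun ω => P.loss S t ω (P.A t ω) (P.X t ω))
  ε_measurable : ∀ t, 1 ≤ t → t ≤ T → Measurable (P.ε t)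
  /-- nature chooses `θ_t ∈ Θ` from the past only -/
  θ_measurable : ∀ t, 1 ≤ t → t ≤ T → Measurable[ℱ (t - 1)] (P.θ t)
  θ_mem : ∀ t, 1 ≤ t → t ≤ T → ∀ ω, P.θ t ω ∈ S.Θ
  /-- the context of round `t` is a fresh draw from `G` -/
  X_law : ∀ t, 1 ≤ t → t ≤ T → μ.map (P.X t) = S.G
  X_indep : ∀ t, 1 ≤ t → t ≤ T → Indep (MeasurableSpace.comap (P.X t) inferInstance) (ℱ (t - 1)) μ
  /-- the noise is conditionally centered given the past and the context -/
  ε_centered : ∀ t, 1 ≤ t → t ≤ T → ∀ a,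
    μ[fun ω => P.ε t ω a | ℱ (t - 1) ⊔ MeasurableSpace.comap (P.X t) inferInstance] =ᵐ[μ] 0
  /-- losses are bounded by one -/
  loss_bounded : ∀ t, 1 ≤ t → t ≤ T → ∀ᵐ ω ∂μ, ∀ a x, |P.loss S t ω a x| ≤ 1
  /-- given the past, the context and the losses, arm `a` is drawn with probability `π_t(a | X_t)` -/
  A_law : ∀ t, 1 ≤ t → t ≤ T → ∀ a,
    μ[fun ω => if P.A t ω = a then (1 : ℝ) else 0 |
      (ℱ (t - 1) ⊔ MeasurableSpace.comap (P.X t) inferInstance) ⊔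
        MeasurableSpace.comap (P.ε t) inferInstance]
      =ᵐ[μ] fun ω => P.policy S t ω (P.X t ω) a

/-- `R_T = max_ρ E[∑_{t ≤ T} (ℓ_t(A_t, X_t) - ℓ_t(ρ(X_t), X_t))]`, over the finitely many maps
`ρ : 𝒳 → [K]`. -/
def Play.regret (P : Play Ω 𝒳 K d) (S : Setting 𝒳 K d) (μ : Measure Ω) (T : ℕ) : ℝ :=
  ⨆ ρ : 𝒳 → Fin K, ∫ ω, ∑ t ∈ Finset.Icc 1 T,
    (P.loss S t ω (P.A t ω) (P.X t ω) - P.loss S t ω (ρ (P.X t ω)) (P.X t ω)) ∂μ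

/-- `ρ` is an optimal policy `ρ^*_T`: it minimizes `E[∑_{t ≤ T} ⟨φ(ρ(X_t), X_t), θ_t⟩]`. -/
def Play.IsOptimalPolicy (P : Play Ω 𝒳 K d) (S : Setting 𝒳 K d) (μ : Measure Ω) (T : ℕ)
    (ρ : 𝒳 → Fin K) : Prop :=
  ∀ ρ' : 𝒳 → Fin K,
    ∫ ω, ∑ t ∈ Finset.Icc 1 T, S.φ (ρ (P.X t ω)) (P.X t ω) ⬝ᵥ P.θ t ω ∂μ ≤
      ∫ ω, ∑ t ∈ Finset.Icc 1 T, S.φ (ρ' (P.X t ω)) (P.X t ω) ⬝ᵥ P.θ t ω ∂μ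

/-- The `(Δ_*, C, T)`-self-bounding constraint, relative to an optimal policy `ρ`:
`R_T ≥ Δ_* E[∑_{t ≤ T} ∑_{a ≠ ρ(X_t)} π_t(a | X_t)] - C`. By `selfBounding_of_gaps` below, this
holds in particular when `R_T ≥ E[∑_t ∑_{a ≠ ρ(X_t)} Δ_t(a | X_t) π_t(a | X_t)] - C` and all gaps
`Δ_t(a | x) = ⟨φ(a, x) - φ(ρ(x), x), θ_t⟩`, `a ≠ ρ(x)`, are at least `Δ_*`. -/
def Play.SelfBounding (P : Play Ω 𝒳 K d) (S : Setting 𝒳 K d) (μ : Measure Ω) (T : ℕ)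
    (ρ : 𝒳 → Fin K) (Δ C : ℝ) : Prop :=
  Δ * ∫ ω, ∑ t ∈ Finset.Icc 1 T,
      ∑ a ∈ Finset.univ.filter (fun a => a ≠ ρ (P.X t ω)), P.policy S t ω (P.X t ω) a ∂μ - C
    ≤ P.regret S μ T

/-- The gap `Δ_t(a | x) = ⟨φ(a, x), θ_t⟩ - ⟨φ(ρ(x), x), θ_t⟩`. -/
def Play.gap (P : Play Ω 𝒳 K d) (S : Setting 𝒳 K d) (ρ : 𝒳 → Fin K) (t : ℕ) (ω : Ω)
    (a : Fin K) (x : 𝒳) : ℝ :=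
  S.φ a x ⬝ᵥ P.θ t ω - S.φ (ρ x) x ⬝ᵥ P.θ t ω

theorem Setting.gamma_mem (S : Setting 𝒳 K d) (hS : S.Assumptions) (t : ℕ) :
    0 ≤ S.gamma t ∧ S.gamma t ≤ 1 / 2 := by
  have hne : Nonempty 𝒳 := by
    have := hS.prob
    by_contra h
    rw [not_nonempty_iff] at h
    exact IsProbabilityMeasure.ne_zero S.G (Measure.eq_zero_of_isEmpty S.G)
  have hL : 0 < S.L := lt_of_lt_of_le (by exact_mod_cast Fintype.card_pos) hS.card_le
  have hl := hS.lam_pos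
  have h0 : 0 ≤ S.eta t := le_min (by positivity) (by positivity)
  have h1 : S.eta t ≤ 1 / 16 * √(S.lam / S.L) := min_le_right _ _
  have h2 : S.eta t ^ 2 ≤ 1 / 256 * (S.lam / S.L) := by
    calc S.eta t ^ 2 ≤ (1 / 16 * √(S.lam / S.L)) ^ 2 := by gcongr
      _ = 1 / 256 * (S.lam / S.L) := by
        rw [mul_pow, Real.sq_sqrt (by positivity)]; norm_num
  refine ⟨by unfold Setting.gamma; positivity, ?_⟩
  unfold Setting.gamma
  calc 128 * S.L * S.eta t ^ 2 / S.lam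
      ≤ 128 * S.L * (1 / 256 * (S.lam / S.L)) / S.lam := by gcongr
    _ = 1 / 2 := by field_simp; norm_num

variable [MeasurableSingletonClass 𝒳]

/-- A function of the state and the context, evaluated at the random context, is measurable. -/
theorem measurable_at_context {X : Ω → 𝒳} (hX : Measurable X) {f : Ω → 𝒳 → ℝ}
    (hf : ∀ x, Measurable fun ω => f ω x) : Measurable fun ω => f ω (X ω) := by
  have h : Measurable (fun z : Ω × 𝒳 => f z.1 z.2) :=
    measurable_from_prod_countable_left fun x => hf x
  exact h.comp (measurable_id.prodMk hX)

/-- The constraint stated with the gaps of `θ_t`, all of them at least `Δ_*`, is a special case of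
`Play.SelfBounding`. -/
theorem Play.selfBounding_of_gaps (P : Play Ω 𝒳 K d) (S : Setting 𝒳 K d) (hS : S.Assumptions)
    (μ : Measure Ω) [IsProbabilityMeasure μ] (ℱ : Filtration ℕ mΩ) (T : ℕ)
    (hP : P.IsInteraction S μ ℱ T) (hA : P.IsTsallisINF S ℱ T) (ρ : 𝒳 → Fin K) (Δ C : ℝ)
    (hΔ : 0 < Δ)
    (hgap : ∀ t, 1 ≤ t → t ≤ T → ∀ ω x a, a ≠ ρ x → Δ ≤ P.gap S ρ t ω a x)
    (hR : ∫ ω, ∑ t ∈ Finset.Icc 1 T,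
        ∑ a ∈ Finset.univ.filter (fun a => a ≠ ρ (P.X t ω)),
          P.gap S ρ t ω a (P.X t ω) * P.policy S t ω (P.X t ω) a ∂μ - C ≤ P.regret S μ T) :
    P.SelfBounding S μ T ρ Δ C := by
  have hpol : ∀ t, 1 ≤ t → t ≤ T → ∀ ω x a,
      0 ≤ P.policy S t ω x a ∧ P.policy S t ω x a ≤ 1 := by
    intro t h1 h2 ω x a
    obtain ⟨g0, g1⟩ := S.gamma_mem hS t
    have hq := hA.q_mem t h1 h2 ω x
    have he := hS.e_mem x
    have q0 := hq.1 a
    have e0 := he.1 a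
    have q1 : P.q t ω x a ≤ 1 := by
      rw [← hq.2]; exact Finset.single_le_sum (fun i _ => hq.1 i) (Finset.mem_univ a)
    have e1 : S.e x a ≤ 1 := by
      rw [← he.2]; exact Finset.single_le_sum (fun i _ => he.1 i) (Finset.mem_univ a)
    unfold Play.policy
    constructor
    · have : 0 ≤ 1 - S.gamma t := by linarith
      positivity
    · nlinarith
  have hint : Integrable (fun ω => ∑ t ∈ Finset.Icc 1 T,
      ∑ a ∈ Finset.univ.filter (fun a => a ≠ ρ (P.X t ω)),
        P.gap S ρ t ω a (P.X t ω) * P.policy S t ω (P.X t ω) a) μ := by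
    refine integrable_finsetSum _ fun t ht => ?_
    obtain ⟨h1, h2⟩ := Finset.mem_Icc.1 ht
    simp_rw [Finset.sum_filter]
    refine integrable_finsetSum _ fun a _ => ?_
    refine Integrable.of_bound (C := 2) (Measurable.aestronglyMeasurable ?_)
      (Filter.Eventually.of_forall fun ω => ?_)
    · have hθ : Measurable (P.θ t) := (hP.θ_measurable t h1 h2).mono (ℱ.le _) le_rfl
      have hθi : ∀ i, Measurable fun ω => P.θ t ω i := fun i => (measurable_pi_apply i).comp hθ
      have hq : ∀ x a, Measurable fun ω => P.q t ω x a := fun x a =>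
        (hA.q_measurable t h1 h2 x a).mono (ℱ.le _) le_rfl
      refine measurable_at_context (X := P.X t)
        (f := fun ω x => if a ≠ ρ x then P.gap S ρ t ω a x * P.policy S t ω x a else 0)
        ((hP.X_measurable t h1 h2).mono (ℱ.le _) le_rfl) fun x => ?_
      by_cases hx : a = ρ x
      · simp [hx]
      · simp only [ne_eq, hx, not_false_eq_true, if_true]
        unfold Play.gap Play.policy dotProduct
        fun_prop
    · obtain ⟨p0, p1⟩ := hpol t h1 h2 ω (P.X t ω) a
      split_ifs with h
      · have b1 := hS.bounded _ (hS.φ_mem a (P.X t ω)) _ (hP.θ_mem t h1 h2 ω)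
        have b2 := hS.bounded _ (hS.φ_mem (ρ (P.X t ω)) (P.X t ω)) _ (hP.θ_mem t h1 h2 ω)
        rw [Real.norm_eq_abs, abs_mul, abs_of_nonneg p0]
        have b3 : |P.gap S ρ t ω a (P.X t ω)| ≤ 2 := by
          unfold Play.gap
          rw [abs_le] at *
          constructor <;> linarith
        nlinarith [abs_nonneg (P.gap S ρ t ω a (P.X t ω))]
      · simp
  refine le_trans (sub_le_sub_right ?_ C) hR
  rw [← integral_const_mul]
  refine integral_mono_of_nonneg (Filter.Eventually.of_forall fun ω => ?_) hint
    (Filter.Eventually.of_forall fun ω => ?_)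
  · refine mul_nonneg hΔ.le (Finset.sum_nonneg fun t ht => Finset.sum_nonneg fun a _ => ?_)
    obtain ⟨h1, h2⟩ := Finset.mem_Icc.1 ht
    exact (hpol t h1 h2 ω _ a).1
  · simp only [Finset.mul_sum]
    refine Finset.sum_le_sum fun t ht => Finset.sum_le_sum fun a ha => ?_
    obtain ⟨h1, h2⟩ := Finset.mem_Icc.1 ht
    exact mul_le_mul_of_nonneg_right (hgap t h1 h2 ω _ a (Finset.mem_filter.1 ha).2)
      (hpol t h1 h2 ω _ a).1

end Dynamic

end LCTsallis

end

noncomputable section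

namespace LCTsallis

set_option linter.unusedSectionVars false

/-! Write β_t = 1/η_t and D = d√K. For each fixed context x the sequence q_t(x) is
follow-the-regularized-leader, compared with the vertex b = ρ(x) of the simplex. The 1/2-Tsallis
regularizer puts the factor √(1 - q_t(b)) into both parts of the regret: into the penalty, because
-ψ(p) ≤ 2√K·√(1 - p_b) (`neg_tsallis_half_le`), and into the stability term, because a linear loss
on the simplex may be shifted by its value at b (`stability`). `ftrl_regret` adds the two up.

The stability term contains ∑ q ℓ̂². The estimator is conditionally unbiased with second moment at
most φᵀΣ(π_t)⁻¹φ, and the average of this form under π_t is tr(Σ⁻¹Σ) = d. That average runs jointly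
over contexts and arms, so the factor √(1 - q_t(ρ(x)|x)) has to be replaced by one that does not
depend on x. Since every context has mass at least 1/L, it is at most √(L·miss_t), where `Play.miss`
is the average over contexts. The same mass bound, through leverage scores, gives π_t(a|x)·φᵀΣ⁻¹φ ≤
L. Together with z'ᵀΣ⁻¹z' ≤ 1/(γ_t λ) = β_t²/(128L) this yields √q·|ℓ̂| ≤ β_{t-1}/4, the smallness
that stability requires.

With β_t growing like √(dt)/K^{1/4}, the stability factor d/β_{t-1} and the penalty factor
√K(β_{t-1} - β_{t-2}) are both O(√(D/t)). The outcome is `Play.IsInteraction.regret_le`: R ≤ 640κ +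
20∑_t √(D/t)·E min(1, √(L·miss_t)), where κ pays for exploration, the first round and the initial
weight β_1.

The self-bounding constraint gives Δ∑ E miss_t ≤ 2(R + C), and by Young's inequality
√(D/t)·√(L·miss_t) ≤ (bL·miss_t + D/(tb))/2 for every b > 0. Taking b of order Δ/L absorbs half of R
and leaves (LD/Δ) log T. For large C, the rounds up to τ = CL/Δ are bounded with the minimum
replaced by 1, at cost √(Dτ). The later rounds contribute only log(T/τ), and b is tuned to balance
it against C. -/

/-! ### The 1/2-Tsallis regularizer and follow-the-regularized-leader -/

theorem tsallis_half {K : ℕ} (p : Fin K → ℝ) : tsallis (1 / 2) p = 2 * (1 - ∑ a, √(p a)) := by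
  simp only [tsallis, Real.sqrt_eq_rpow]
  norm_num

theorem le_one_of_mem_stdSimplex {K : ℕ} {p : Fin K → ℝ} (hp : p ∈ stdSimplex ℝ (Fin K))
    (a : Fin K) : p a ≤ 1 := by
  rw [← hp.2]
  exact Finset.single_le_sum (fun i _ => hp.1 i) (Finset.mem_univ a)

/-- Cauchy–Schwarz over the arms other than b, whose total mass is 1 - p b. -/
theorem sum_sqrt_le {K : ℕ} {p : Fin K → ℝ} (hp : p ∈ stdSimplex ℝ (Fin K)) (b : Fin K) :
    ∑ a, √(p a) ≤ 1 + √K * √(1 - p b) := by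
  classical
  rw [← Finset.add_sum_erase _ _ (Finset.mem_univ b)]
  have h1 : √(p b) ≤ 1 := Real.sqrt_le_one.2 (le_one_of_mem_stdSimplex hp b)
  have h2 : ∑ a ∈ Finset.univ.erase b, √(p a) ≤ √K * √(1 - p b) := by
    have hs : ∑ a ∈ Finset.univ.erase b, p a = 1 - p b := by
      have := Finset.add_sum_erase Finset.univ p (Finset.mem_univ b)
      rw [hp.2] at this
      linarith
    rw [← Real.sqrt_mul (Nat.cast_nonneg K)]
    refine Real.le_sqrt_of_sq_le ?_
    refine (sq_sum_le_card_mul_sum_sq (s := Finset.univ.erase b) (f := fun a => √(p a))).trans ?_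
    simp_rw [Real.sq_sqrt (hp.1 _)]
    rw [hs]
    have : ((Finset.univ.erase b).card : ℝ) ≤ K := by
      exact_mod_cast (Finset.card_le_univ _).trans (by simp)
    have h3 := le_one_of_mem_stdSimplex hp b
    gcongr
  linarith

theorem neg_tsallis_half_le {K : ℕ} {p : Fin K → ℝ} (hp : p ∈ stdSimplex ℝ (Fin K)) (b : Fin K) :
    -tsallis (1 / 2) p ≤ 2 * √K * √(1 - p b) := by
  rw [tsallis_half]
  linarith [sum_sqrt_le hp b]

theorem tsallis_half_single {K : ℕ} (b : Fin K) :
    tsallis (1 / 2) (Pi.single b 1 : Fin K → ℝ) = 0 := by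
  rw [tsallis_half, Finset.sum_eq_single b]
  · simp
  · intro a _ ha
    simp [Pi.single_eq_of_ne ha]
  · simp

/-- A minimizer of a linear function plus a multiple of the Tsallis regularizer is interior. -/
theorem pos_of_isMinOn {K : ℕ} {c : Fin K → ℝ} {β : ℝ} (hβ : 0 < β) {p : Fin K → ℝ}
    (hp : p ∈ stdSimplex ℝ (Fin K))
    (hmin : IsMinOn (fun q => c ⬝ᵥ q + β * tsallis (1 / 2) q) (stdSimplex ℝ (Fin K)) p)
    (a : Fin K) : 0 < p a := by
  by_contra hneg
  have h0 : p a = 0 := le_antisymm (not_lt.1 hneg) (hp.1 a)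
  -- Moving mass r² from p to the empty arm a changes the linear part and the old roots by O(r²),
  -- collected in D. The new root contributes r, so for small r the move would lower the objective.
  set D : ℝ := c a - c ⬝ᵥ p + 2 * β * ∑ b, √(p b) with hD
  have key : ∀ r : ℝ, 0 < r → r ≤ 1 → 2 * β * r ≤ r ^ 2 * D := by
    intro r hr hr1
    have hr2 : 0 ≤ 1 - r ^ 2 := by nlinarith
    have hq : (1 - r ^ 2) • p + (r ^ 2) • (Pi.single a 1 : Fin K → ℝ) ∈ stdSimplex ℝ (Fin K) :=
      convex_stdSimplex ℝ (Fin K) hp (single_mem_stdSimplex ℝ a) hr2 (by positivity) (by ring)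
    have h := isMinOn_iff.1 hmin _ hq
    simp only [tsallis_half, dotProduct_add, dotProduct_smul, dotProduct_single, smul_eq_mul,
      mul_one] at h
    have hs : (1 - r ^ 2) * ∑ b, √(p b) + r ≤
        ∑ b, √(((1 - r ^ 2) • p + (r ^ 2) • (Pi.single a 1 : Fin K → ℝ)) b) := by
      have : ∑ b, ((1 - r ^ 2) * √(p b) + (Pi.single a r : Fin K → ℝ) b) =
          (1 - r ^ 2) * ∑ b, √(p b) + r := by
        rw [Finset.sum_add_distrib, ← Finset.mul_sum]
        simp
      rw [← this]
      refine Finset.sum_le_sum fun b _ => ?_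
      by_cases hb : b = a
      · subst hb
        simp [h0, Real.sqrt_sq hr.le]
      · simp only [Pi.add_apply, Pi.smul_apply, smul_eq_mul, Pi.single_eq_of_ne hb, add_zero,
          mul_zero]
        rw [Real.sqrt_mul hr2]
        gcongr
        refine Real.le_sqrt_of_sq_le ?_
        nlinarith
    nlinarith
  have hDp : 0 < |D| + β := by positivity
  -- For this r one has r·D ≤ β, contradicting 2β ≤ r·D.
  have h1 := key (β / (|D| + β)) (by positivity) (by
    rw [div_le_one hDp]; linarith [abs_nonneg D])
  set r := β / (|D| + β) with hr
  have hr0 : 0 < r := by positivity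
  have h2 : r * (|D| + β) = β := by rw [hr]; field_simp
  have h3 : 2 * β ≤ r * D := by nlinarith
  nlinarith [le_abs_self D]

/-- A global second-order lower bound, valid up to x + y = 0. After scaling to x = 1 and setting u =
√(1 + z), the difference of the two sides is u(u + 2)(u - 1)²/2. -/
theorem sqrt_add_ge {x y : ℝ} (hx : 0 < x) (hxy : 0 ≤ x + y) :
    √x + y / (2 * √x) - y ^ 2 / (2 * (√x) ^ 3) ≤ √(x + y) := by
  obtain ⟨s, hs, rfl⟩ : ∃ s : ℝ, 0 < s ∧ s ^ 2 = x := ⟨√x, by positivity, Real.sq_sqrt hx.le⟩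
  rw [Real.sqrt_sq hs.le]
  obtain ⟨z, rfl⟩ : ∃ z, y = s ^ 2 * z := ⟨y / s ^ 2, by field_simp⟩
  have hz : 0 ≤ 1 + z := by
    have : 0 ≤ s ^ 2 * (1 + z) := by linarith
    exact nonneg_of_mul_nonneg_right this (by positivity)
  have e1 : s + s ^ 2 * z / (2 * s) - (s ^ 2 * z) ^ 2 / (2 * s ^ 3) =
      s * (1 + z / 2 - z ^ 2 / 2) := by field_simp
  have e2 : √(s ^ 2 + s ^ 2 * z) = s * √(1 + z) := by
    rw [← mul_one_add, Real.sqrt_mul (by positivity), Real.sqrt_sq hs.le]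
  rw [e1, e2]
  refine mul_le_mul_of_nonneg_left ?_ hs.le
  set u := √(1 + z) with hu
  have hu0 : 0 ≤ u := Real.sqrt_nonneg _
  have hu2 : u ^ 2 = 1 + z := Real.sq_sqrt hz
  have : z = u ^ 2 - 1 := by linarith
  rw [this]
  nlinarith [mul_nonneg hu0 (sq_nonneg (u - 1)), sq_nonneg (u - 1), mul_nonneg (mul_nonneg hu0 hu0) (sq_nonneg (u-1))]

/-- Letting s tend to 0 kills the quadratic term. This replaces differentiation in the first-order
condition. -/
theorem nonneg_of_quadratic {x C : ℝ} (h : ∀ s : ℝ, 0 < s → s ≤ 1 → 0 ≤ s * x + s ^ 2 * C) :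
    0 ≤ x := by
  by_contra hx
  push Not at hx
  have hD : 0 < |C| + |x| := add_pos_of_nonneg_of_pos (abs_nonneg C) (abs_pos.2 hx.ne)
  set s := |x| / (2 * (|C| + |x|)) with hs
  have hs0 : 0 < s := by have := abs_pos.2 hx.ne; positivity
  have hs2 : s * (2 * (|C| + |x|)) = |x| := by rw [hs]; field_simp
  have hs1 : s ≤ 1 := by
    rw [hs, div_le_one (by positivity)]
    linarith [abs_nonneg C, abs_nonneg x]
  have h1 := h s hs0 hs1
  have h2 : 0 ≤ x + s * C := by
    have : 0 ≤ s * (x + s * C) := by linarith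
    exact nonneg_of_mul_nonneg_right this hs0
  rw [abs_of_neg hx] at hs2
  nlinarith [le_abs_self C]

/-- First-order optimality in Bregman form. -/
theorem bregman_le_of_isMinOn {K : ℕ} {c : Fin K → ℝ} {β : ℝ} (hβ : 0 < β) {p q : Fin K → ℝ}
    (hp : p ∈ stdSimplex ℝ (Fin K)) (hq : q ∈ stdSimplex ℝ (Fin K))
    (hmin : IsMinOn (fun q => c ⬝ᵥ q + β * tsallis (1 / 2) q) (stdSimplex ℝ (Fin K)) p) :
    c ⬝ᵥ p + β * tsallis (1 / 2) p + β * ∑ a, (√(q a) - √(p a)) ^ 2 / √(p a) ≤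
      c ⬝ᵥ q + β * tsallis (1 / 2) q := by
  have hpos := pos_of_isMinOn hβ hp hmin
  -- The gradient of the objective at p is c a - β/√(p a), which makes sense because p is interior.
  -- Expanding along the segment from p to q with `sqrt_add_ge` leaves a linear and a quadratic term
  -- in the step length s.
  have hfo : 0 ≤ ∑ a, (c a - β / √(p a)) * (q a - p a) := by
    refine nonneg_of_quadratic (C := β * ∑ a, (q a - p a) ^ 2 / (√(p a)) ^ 3) fun s hs hs1 => ?_
    have hmem : (1 - s) • p + s • q ∈ stdSimplex ℝ (Fin K) :=
      convex_stdSimplex ℝ (Fin K) hp hq (by linarith) hs.le (by ring)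
    have h := isMinOn_iff.1 hmin _ hmem
    simp only [tsallis_half] at h
    have h2 : ∑ a, (√(p a) + s * (q a - p a) / (2 * √(p a)) -
        (s * (q a - p a)) ^ 2 / (2 * (√(p a)) ^ 3)) ≤ ∑ a, √(((1 - s) • p + s • q) a) := by
      refine Finset.sum_le_sum fun a _ => ?_
      have e : ((1 - s) • p + s • q) a = p a + s * (q a - p a) := by
        simp; ring
      have := hmem.1 a
      rw [e] at this ⊢
      exact sqrt_add_ge (hpos a) this
    have h3 : c ⬝ᵥ ((1 - s) • p + s • q) = c ⬝ᵥ p + s * ∑ a, c a * (q a - p a) := by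
      simp only [dotProduct, Finset.mul_sum, ← Finset.sum_add_distrib]
      refine Finset.sum_congr rfl fun a _ => ?_
      simp; ring
    have h4 : ∑ a, (√(p a) + s * (q a - p a) / (2 * √(p a)) -
        (s * (q a - p a)) ^ 2 / (2 * (√(p a)) ^ 3)) =
        ∑ a, √(p a) + s / 2 * ∑ a, (q a - p a) / √(p a) -
          s ^ 2 / 2 * ∑ a, (q a - p a) ^ 2 / (√(p a)) ^ 3 := by
      simp only [Finset.mul_sum, ← Finset.sum_add_distrib, ← Finset.sum_sub_distrib]
      refine Finset.sum_congr rfl fun a _ => ?_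
      have := Real.sqrt_pos.2 (hpos a)
      field_simp
    have h5 : ∑ a, (c a - β / √(p a)) * (q a - p a) =
        ∑ a, c a * (q a - p a) - β * ∑ a, (q a - p a) / √(p a) := by
      simp only [Finset.mul_sum, ← Finset.sum_sub_distrib]
      refine Finset.sum_congr rfl fun a _ => ?_
      ring
    rw [h4] at h2
    rw [h3] at h
    rw [h5]
    nlinarith
  -- The sum of (√q - √p)²/√p is exactly the Bregman divergence of ψ, so the excess of q over p
  -- minus the divergence is the directional derivative.
  have e : c ⬝ᵥ q + β * tsallis (1 / 2) q - (c ⬝ᵥ p + β * tsallis (1 / 2) p) -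
      β * ∑ a, (√(q a) - √(p a)) ^ 2 / √(p a) = ∑ a, (c a - β / √(p a)) * (q a - p a) := by
    simp only [tsallis_half, dotProduct]
    have : ∀ a, (√(q a) - √(p a)) ^ 2 / √(p a) =
        (q a - p a) / √(p a) - 2 * √(q a) + 2 * √(p a) := by
      intro a
      have h1 := Real.sqrt_pos.2 (hpos a)
      have h2 := Real.sq_sqrt (hq.1 a)
      have h3 := Real.sq_sqrt (hp.1 a)
      field_simp
      nlinarith
    simp only [this, Finset.sum_add_distrib, Finset.sum_sub_distrib, sub_mul, mul_sub, div_mul_eq_mul_div, ← Finset.mul_sum, sub_div, mul_div_assoc]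
    ring
  linarith

/-- With s = √p and r = √q, half of the Bregman term completes a square with the linear term. The
other half absorbs the cubic remainder, which is where s·|l| ≤ β/2 is needed. -/
theorem stability_coord {β l s r : ℝ} (hβ : 0 < β) (hs : 0 < s) (hl : s * |l| ≤ β / 2) :
    l * (s ^ 2 - r ^ 2) - β * ((r - s) ^ 2 / s) ≤ 2 / β * (s ^ 3 * l ^ 2) := by
  have h1 : -(s * l) ≤ β / 2 := by
    have := neg_abs_le l
    nlinarith
  have h2 : 0 ≤ (r - s) ^ 2 * (s * l + β / 2) / s := by
    have : 0 ≤ s * l + β / 2 := by linarith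
    positivity
  have h3 : 0 ≤ β / (2 * s) * ((r - s) + 2 * s ^ 2 * l / β) ^ 2 := by positivity
  have : 2 / β * (s ^ 3 * l ^ 2) - (l * (s ^ 2 - r ^ 2) - β * ((r - s) ^ 2 / s)) =
      (r - s) ^ 2 * (s * l + β / 2) / s + β / (2 * s) * ((r - s) + 2 * s ^ 2 * l / β) ^ 2 := by
    field_simp
    ring
  linarith

/-- Stability of the Tsallis regularizer around a comparator arm. -/
theorem stability {K : ℕ} {β : ℝ} (hβ : 0 < β) {p q l : Fin K → ℝ}
    (hp : p ∈ stdSimplex ℝ (Fin K)) (hq : q ∈ stdSimplex ℝ (Fin K)) (hpos : ∀ a, 0 < p a)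
    (hl : ∀ a, √(p a) * |l a| ≤ β / 4) (b : Fin K) :
    l ⬝ᵥ p - l ⬝ᵥ q - β * ∑ a, (√(q a) - √(p a)) ^ 2 / √(p a) ≤
      4 / β * √(1 - p b) * ∑ a, p a * l a ^ 2 := by
  -- Since p and q have the same total mass, subtracting a constant s from the loss leaves the left
  -- side unchanged.
  have hshift : ∀ s : ℝ, (∀ a, √(p a) * |l a - s| ≤ β / 2) →
      l ⬝ᵥ p - l ⬝ᵥ q - β * ∑ a, (√(q a) - √(p a)) ^ 2 / √(p a) ≤
        ∑ a, 2 / β * (√(p a) * p a * (l a - s) ^ 2) := by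
    intro s hs
    have e : l ⬝ᵥ p - l ⬝ᵥ q - β * ∑ a, (√(q a) - √(p a)) ^ 2 / √(p a) =
        ∑ a, ((l a - s) * (√(p a) ^ 2 - √(q a) ^ 2) - β * ((√(q a) - √(p a)) ^ 2 / √(p a))) := by
      simp only [Real.sq_sqrt (hp.1 _), Real.sq_sqrt (hq.1 _), dotProduct, sub_mul, mul_sub,
        Finset.sum_sub_distrib, ← Finset.mul_sum, hp.2, hq.2]
      ring
    rw [e]
    refine Finset.sum_le_sum fun a _ => ?_
    refine (stability_coord hβ (Real.sqrt_pos.2 (hpos a)) (hs a)).trans_eq ?_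
    have := Real.sq_sqrt (hp.1 a)
    rw [pow_succ, this]
    ring
  have hb1 := le_one_of_mem_stdSimplex hp b
  -- When p b is below 1/2 the factor √(1 - p b) is at least 1/2 and no shift is needed.
  by_cases hb : p b < 1 / 2
  · have h0 := hshift 0 (fun a => by rw [sub_zero]; linarith [hl a])
    refine h0.trans ?_
    rw [Finset.mul_sum]
    refine Finset.sum_le_sum fun a _ => ?_
    have h1 : √(p a) ≤ 1 := Real.sqrt_le_one.2 (le_one_of_mem_stdSimplex hp a)
    have h2 : 1 / 2 ≤ √(1 - p b) := Real.le_sqrt_of_sq_le (by linarith)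
    have hnn : 0 ≤ p a * l a ^ 2 := mul_nonneg (hp.1 a) (sq_nonneg _)
    calc 2 / β * (√(p a) * p a * (l a - 0) ^ 2) = 2 / β * (√(p a) * (p a * l a ^ 2)) := by ring
      _ ≤ 2 / β * (1 * (p a * l a ^ 2)) := by gcongr
      _ = 4 / β * (1 / 2) * (p a * l a ^ 2) := by ring
      _ ≤ _ := by gcongr
  · push Not at hb
    classical
    have hsum : ∑ a ∈ Finset.univ.erase b, p a = 1 - p b := by
      have := Finset.add_sum_erase Finset.univ p (Finset.mem_univ b)
      rw [hp.2] at this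
      linarith
    have hle : ∀ a, a ≠ b → p a ≤ 1 - p b := fun a ha => by
      rw [← hsum]
      exact Finset.single_le_sum (fun i _ => hp.1 i) (Finset.mem_erase.2 ⟨ha, Finset.mem_univ a⟩)
    -- Shifting by l b removes the term of arm b. Every other p a is at most 1 - p b ≤ p b, so the
    -- two bounds β/4, for a and for b, add up to the required β/2.
    have h0 := hshift (l b) (fun a => by
      by_cases ha : a = b
      · subst ha; simp; positivity
      · have h1 : √(p a) ≤ √(p b) := Real.sqrt_le_sqrt (by linarith [hle a ha])
        calc √(p a) * |l a - l b| ≤ √(p a) * (|l a| + |l b|) := by gcongr; exact abs_sub _ _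
          _ = √(p a) * |l a| + √(p a) * |l b| := by ring
          _ ≤ √(p a) * |l a| + √(p b) * |l b| := by gcongr
          _ ≤ β / 2 := by linarith [hl a, hl b])
    refine h0.trans ?_
    rw [← Finset.add_sum_erase _ _ (Finset.mem_univ b)]
    have h2 : ∑ a ∈ Finset.univ.erase b, 2 / β * (√(p a) * p a * (l a - l b) ^ 2) ≤
        ∑ a ∈ Finset.univ.erase b, 4 / β * √(1 - p b) * (p a * l a ^ 2 + p a * l b ^ 2) := by
      refine Finset.sum_le_sum fun a ha => ?_
      have ha' := Finset.ne_of_mem_erase ha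
      have h3 : √(p a) ≤ √(1 - p b) := Real.sqrt_le_sqrt (hle a ha')
      have h4 : (l a - l b) ^ 2 ≤ 2 * (l a ^ 2 + l b ^ 2) := by nlinarith [sq_nonneg (l a + l b)]
      have := hp.1 a
      calc 2 / β * (√(p a) * p a * (l a - l b) ^ 2)
          ≤ 2 / β * (√(1 - p b) * p a * (2 * (l a ^ 2 + l b ^ 2))) := by gcongr
        _ = _ := by ring
    have h5 : ∑ a ∈ Finset.univ.erase b, 4 / β * √(1 - p b) * (p a * l a ^ 2 + p a * l b ^ 2) =
        4 / β * √(1 - p b) * (∑ a ∈ Finset.univ.erase b, p a * l a ^ 2 + (1 - p b) * l b ^ 2) := by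
      rw [← Finset.mul_sum, Finset.sum_add_distrib, ← Finset.sum_mul, hsum]
    have h6 : ∑ a, p a * l a ^ 2 = p b * l b ^ 2 + ∑ a ∈ Finset.univ.erase b, p a * l a ^ 2 :=
      (Finset.add_sum_erase _ _ (Finset.mem_univ b)).symm
    rw [h6, sub_self]
    -- The shift creates l b ² with weight 1 - p b. The unused term of arm b pays for it because p b
    -- ≥ 1/2.
    have h7 : (1 - p b) * l b ^ 2 ≤ p b * l b ^ 2 := by
      gcongr; linarith
    have h8 : 0 ≤ 4 / β * √(1 - p b) := by positivity
    have h9 := mul_le_mul_of_nonneg_left h7 h8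
    nlinarith

/-- Regret of follow-the-regularized-leader with the `1/2`-Tsallis regularizer against an arm `b`,
where the first play is arbitrary. -/
theorem ftrl_regret {K T : ℕ} (hT : 2 ≤ T) {β : ℕ → ℝ} (hβ : ∀ t, 1 ≤ t → 0 < β t)
    {l q : ℕ → Fin K → ℝ} (hq : ∀ t, 1 ≤ t → t ≤ T → q t ∈ stdSimplex ℝ (Fin K))
    (hmin : ∀ t, 1 ≤ t → t ≤ T → IsMinOn (fun p => ∑ s ∈ Finset.Icc 1 (t - 1), l s ⬝ᵥ p +
      β (t - 1) * tsallis (1 / 2) p) (stdSimplex ℝ (Fin K)) (q t))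
    (hl : ∀ t, 2 ≤ t → t ≤ T → ∀ a, √(q t a) * |l t a| ≤ β (t - 1) / 4) (b : Fin K) :
    ∑ t ∈ Finset.Icc 1 T, (l t ⬝ᵥ q t - l t b) ≤
      l 1 ⬝ᵥ q 1 - l 1 ⬝ᵥ q 2 + β 1 * -tsallis (1 / 2) (q 2) +
      ∑ t ∈ Finset.Icc 2 T, 4 / β (t - 1) * √(1 - q t b) * ∑ a, q t a * l t a ^ 2 +
      ∑ t ∈ Finset.Icc 3 T, (β (t - 1) - β (t - 2)) * -tsallis (1 / 2) (q t) := by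
  set stab : ℕ → ℝ := fun t => 4 / β (t - 1) * √(1 - q t b) * ∑ a, q t a * l t a ^ 2 with hstab
  set Φ : ℕ → ℝ := fun t => ∑ s ∈ Finset.Icc 1 (t - 1), l s ⬝ᵥ q t +
      β (t - 1) * tsallis (1 / 2) (q t) with hΦ
  -- Optimality of q t leaves a Bregman surplus at p; by `stability` it pays for replacing l t ⬝ᵥ p
  -- by l t ⬝ᵥ q t, up to `stab t`.
  have step : ∀ t, 2 ≤ t → t ≤ T → ∀ p ∈ stdSimplex ℝ (Fin K),
      Φ t + l t ⬝ᵥ q t - stab t ≤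
        ∑ s ∈ Finset.Icc 1 t, l s ⬝ᵥ p + β (t - 1) * tsallis (1 / 2) p := by
    intro t h2 hT p hp
    have hβt := hβ (t - 1) (by omega)
    have e : ∀ p : Fin K → ℝ, ∑ s ∈ Finset.Icc 1 (t - 1), l s ⬝ᵥ p =
        (∑ s ∈ Finset.Icc 1 (t - 1), l s) ⬝ᵥ p := fun p => (sum_dotProduct _ _ _).symm
    have hm := hmin t (by omega) hT
    simp only [e] at hm
    have hqt := hq t (by omega) hT
    have h1 := bregman_le_of_isMinOn hβt hqt hp hm
    have h3 := stability hβt hqt hp (pos_of_isMinOn hβt hqt hm) (hl t h2 hT) b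
    obtain ⟨n, rfl⟩ : ∃ n, t = n + 1 := ⟨t - 1, by omega⟩
    rw [Finset.sum_Icc_succ_top (by omega)]
    simp only [Nat.add_sub_cancel, hΦ, hstab] at h1 h3 e ⊢
    rw [e, e]
    linarith
  -- Telescoping starts at round 2: the weight β 0 need not be positive (it is 0 for the algorithm),
  -- so nothing is known about q 1. Changing the weight from β (n - 1) to β n produces the penalty
  -- terms.
  have ind : ∀ n, 2 ≤ n → n ≤ T → Φ 2 + ∑ t ∈ Finset.Ico 2 n, (l t ⬝ᵥ q t - stab t) ≤
      Φ n + ∑ t ∈ Finset.Icc 3 n, (β (t - 1) - β (t - 2)) * -tsallis (1 / 2) (q t) := by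
    intro n hn
    induction n, hn using Nat.le_induction with
    | base => simp
    | succ n hn ih =>
      intro hnT
      have h1 := ih (by omega)
      have h2 := step n hn (by omega) (q (n + 1)) (hq _ (by omega) hnT)
      rw [Finset.sum_Ico_succ_top hn, Finset.sum_Icc_succ_top (by omega)]
      have e2 : n + 1 - 2 = n - 1 := by omega
      have e : Φ (n + 1) = ∑ s ∈ Finset.Icc 1 n, l s ⬝ᵥ q (n + 1) +
          β n * tsallis (1 / 2) (q (n + 1)) := rfl
      rw [e2, Nat.add_sub_cancel, e]
      linarith
  have h1 := ind T hT le_rfl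
  -- The regularizer vanishes at a vertex, so the comparator carries no penalty.
  have h2 := step T hT le_rfl _ (single_mem_stdSimplex ℝ b)
  rw [tsallis_half_single] at h2
  simp only [dotProduct_single, mul_one, mul_zero, add_zero] at h2
  have e1 : Φ 2 = l 1 ⬝ᵥ q 2 + β 1 * tsallis (1 / 2) (q 2) := by simp [hΦ]
  have e2 : ∑ t ∈ Finset.Icc 1 T, (l t ⬝ᵥ q t - l t b) =
      l 1 ⬝ᵥ q 1 + ∑ t ∈ Finset.Ico 2 T, l t ⬝ᵥ q t + l T ⬝ᵥ q T - ∑ t ∈ Finset.Icc 1 T, l t b := by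
    rw [Finset.sum_sub_distrib, ← Finset.Ico_add_one_right_eq_Icc 1 T, Finset.sum_Ico_succ_top (by omega),
      Finset.sum_eq_sum_Ico_succ_bot (by omega)]
  have e3 : ∑ t ∈ Finset.Icc 2 T, stab t = ∑ t ∈ Finset.Ico 2 T, stab t + stab T := by
    rw [← Finset.Ico_add_one_right_eq_Icc 2 T, Finset.sum_Ico_succ_top (by omega)]
  rw [Finset.sum_sub_distrib] at h1
  rw [e2, e3]
  linarith

/-! ### Covariance matrices and their inverse forms -/

section Covariance

variable {𝒳 : Type*} [MeasurableSpace 𝒳] [Fintype 𝒳] {K d : ℕ}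

theorem Setting.covariance_form (S : Setting 𝒳 K d) (p : 𝒳 → Fin K → ℝ) (u v : Fin d → ℝ) :
    u ⬝ᵥ (S.covariance p *ᵥ v) =
      ∑ x, S.G.real {x} * ∑ a, p x a * ((u ⬝ᵥ S.φ a x) * (S.φ a x ⬝ᵥ v)) := by
  unfold Setting.covariance
  rw [sum_mulVec, dotProduct_sum]
  refine Finset.sum_congr rfl fun x _ => ?_
  rw [smul_mulVec, dotProduct_smul, sum_mulVec, dotProduct_sum, smul_eq_mul]
  congr 1
  refine Finset.sum_congr rfl fun a _ => ?_
  rw [smul_mulVec, dotProduct_smul, vecMulVec_mulVec, smul_eq_mul]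
  congr 1
  simp [mul_comm]

theorem Setting.covariance_isSymm (S : Setting 𝒳 K d) (p : 𝒳 → Fin K → ℝ) :
    (S.covariance p)ᵀ = S.covariance p := by
  unfold Setting.covariance
  simp only [transpose_sum, transpose_smul, transpose_vecMulVec]

theorem Setting.covariance_form_self (S : Setting 𝒳 K d) (p : 𝒳 → Fin K → ℝ) (v : Fin d → ℝ) :
    v ⬝ᵥ (S.covariance p *ᵥ v) = ∑ x, S.G.real {x} * ∑ a, p x a * (v ⬝ᵥ S.φ a x) ^ 2 := by
  rw [S.covariance_form]
  simp only [dotProduct_comm _ v, sq]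

theorem Setting.covariance_form_mono (S : Setting 𝒳 K d) {p p' : 𝒳 → Fin K → ℝ}
    (h : ∀ x a, p x a ≤ p' x a) (v : Fin d → ℝ) :
    v ⬝ᵥ (S.covariance p *ᵥ v) ≤ v ⬝ᵥ (S.covariance p' *ᵥ v) := by
  simp only [S.covariance_form_self]
  gcongr with x _ a _
  exact h x a

theorem Setting.covariance_posSemidef (S : Setting 𝒳 K d) {p : 𝒳 → Fin K → ℝ}
    (h : ∀ x a, 0 ≤ p x a) : (S.covariance p).PosSemidef := by
  refine PosSemidef.of_dotProduct_mulVec_nonneg ?_ fun v => ?_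
  · rw [IsHermitian, conjTranspose_eq_transpose_of_trivial, S.covariance_isSymm]
  · rw [star_trivial, S.covariance_form_self]
    refine Finset.sum_nonneg fun x _ => mul_nonneg measureReal_nonneg
      (Finset.sum_nonneg fun a _ => mul_nonneg (h x a) (sq_nonneg _))

theorem Setting.covariance_smul (S : Setting 𝒳 K d) (p : 𝒳 → Fin K → ℝ) (c : ℝ) :
    S.covariance (fun x a => c * p x a) = c • S.covariance p := by
  unfold Setting.covariance
  simp only [Finset.smul_sum, smul_smul]
  refine Finset.sum_congr rfl fun x _ => Finset.sum_congr rfl fun a _ => ?_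
  congr 1
  ring

/-- A policy that mixes in at least a fraction `g` of the exploration policy. -/
structure Setting.Explores (S : Setting 𝒳 K d) (g : ℝ) (p : 𝒳 → Fin K → ℝ) : Prop where
  pos : 0 < g
  le : ∀ x a, g * S.e x a ≤ p x a

/-- The bilinear form of the inverse covariance. -/
def Setting.invForm (S : Setting 𝒳 K d) (p : 𝒳 → Fin K → ℝ) (z z' : Fin d → ℝ) : ℝ :=
  z ⬝ᵥ ((S.covariance p)⁻¹ *ᵥ z')

variable {S : Setting 𝒳 K d} {g : ℝ} {p : 𝒳 → Fin K → ℝ}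

theorem Setting.Explores.nonneg (hp : S.Explores g p) (hS : S.Assumptions) (x : 𝒳) (a : Fin K) :
    0 ≤ p x a :=
  (mul_nonneg hp.pos.le ((hS.e_mem x).1 a)).trans (hp.le x a)

theorem Setting.Explores.posDef (hp : S.Explores g p) (hS : S.Assumptions) :
    (S.covariance p).PosDef := by
  have he : (S.covariance S.e).PosDef :=
    ((S.covariance_posSemidef fun x a => (hS.e_mem x).1 a).posDef_iff_isUnit).2 hS.e_isUnit
  refine PosDef.of_dotProduct_mulVec_pos (S.covariance_posSemidef (hp.nonneg hS)).1 fun v hv => ?_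
  have h1 := he.dotProduct_mulVec_pos hv
  have h2 := S.covariance_form_mono hp.le v
  rw [S.covariance_smul, smul_mulVec, dotProduct_smul, smul_eq_mul] at h2
  rw [star_trivial] at h1 ⊢
  have := mul_pos hp.pos h1
  linarith

theorem Setting.Explores.covariance_mulVec_inv (hp : S.Explores g p) (hS : S.Assumptions) (z : Fin d → ℝ) :
    S.covariance p *ᵥ ((S.covariance p)⁻¹ *ᵥ z) = z := by
  have h := (hp.posDef hS).isUnit
  rw [mulVec_mulVec, mul_nonsing_inv _ ((isUnit_iff_isUnit_det _).1 h), one_mulVec]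

theorem Setting.invForm_comm (S : Setting 𝒳 K d) (p : 𝒳 → Fin K → ℝ) (z z' : Fin d → ℝ) :
    S.invForm p z z' = S.invForm p z' z := by
  unfold Setting.invForm
  rw [dotProduct_mulVec, ← mulVec_transpose, transpose_nonsing_inv, S.covariance_isSymm,
    dotProduct_comm]

theorem Setting.Explores.invForm_nonneg (hp : S.Explores g p) (hS : S.Assumptions)
    (z : Fin d → ℝ) : 0 ≤ S.invForm p z z := by
  have := (hp.posDef hS).inv.posSemidef.dotProduct_mulVec_nonneg z
  rwa [star_trivial] at this

/-- Averaging a product of inverse forms over the features of the policy. -/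
theorem Setting.Explores.sum_invForm_mul (hp : S.Explores g p) (hS : S.Assumptions)
    (z θ : Fin d → ℝ) :
    ∑ x, S.G.real {x} * ∑ a, p x a * (S.invForm p z (S.φ a x) * (S.φ a x ⬝ᵥ θ)) = z ⬝ᵥ θ := by
  have h := S.covariance_form p ((S.covariance p)⁻¹ *ᵥ z) θ
  rw [dotProduct_mulVec, ← mulVec_transpose, S.covariance_isSymm, hp.covariance_mulVec_inv hS] at h
  rw [h]
  refine Finset.sum_congr rfl fun x _ => ?_
  congr 1
  refine Finset.sum_congr rfl fun a _ => ?_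
  rw [S.invForm_comm p z, Setting.invForm, dotProduct_comm (S.φ a x)]

/-- This is Σ⁻¹ΣΣ⁻¹ = Σ⁻¹, the source of the second moment of the loss estimator. -/
theorem Setting.Explores.sum_invForm_sq (hp : S.Explores g p) (hS : S.Assumptions)
    (z : Fin d → ℝ) :
    ∑ x, S.G.real {x} * ∑ a, p x a * S.invForm p z (S.φ a x) ^ 2 = S.invForm p z z := by
  have h := hp.sum_invForm_mul hS z ((S.covariance p)⁻¹ *ᵥ z)
  rw [Setting.invForm, ← h]
  refine Finset.sum_congr rfl fun x _ => ?_
  congr 1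
  refine Finset.sum_congr rfl fun a _ => ?_
  rw [sq]
  congr 2
  exact S.invForm_comm p _ _

/-- The trace of Σ⁻¹Σ, expanded over the rank-one terms of Σ. The dimension enters the regret here.
-/
theorem Setting.Explores.sum_invForm_self (hp : S.Explores g p) (hS : S.Assumptions) :
    ∑ x, S.G.real {x} * ∑ a, p x a * S.invForm p (S.φ a x) (S.φ a x) = d := by
  have h := mul_nonsing_inv _ ((isUnit_iff_isUnit_det _).1 (hp.posDef hS).isUnit)
  have h2 := congrArg trace h
  rw [trace_one, Fintype.card_fin, trace_mul_comm] at h2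
  rw [← h2]
  simp only [Setting.invForm]
  generalize (S.covariance p)⁻¹ = N
  simp only [Setting.covariance, Finset.mul_sum, mul_smul_comm, trace_sum, trace_smul, smul_eq_mul, mul_vecMulVec, trace_vecMulVec]
  refine Finset.sum_congr rfl fun x _ => Finset.sum_congr rfl fun a _ => ?_
  rw [dotProduct_comm]

/-- Inversion reverses the Loewner order. With N = gΣ(e) ≤ M = Σ(p), u = N⁻¹z and v = M⁻¹z,
expanding (u - v)ᵀN(u - v) ≥ 0 and using vᵀNv ≤ vᵀMv = zᵀv gives zᵀv ≤ zᵀu. -/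
theorem Setting.Explores.invForm_le (hp : S.Explores g p) (hS : S.Assumptions)
    {z : Fin d → ℝ} (hz : z ∈ S.Z) : S.invForm p z z ≤ 1 / (g * S.lam) := by
  set u := (g • S.covariance S.e)⁻¹ *ᵥ z with hu
  set v := (S.covariance p)⁻¹ *ᵥ z with hv
  have hge : S.Explores g (fun x a => g * S.e x a) := ⟨hp.pos, fun _ _ => le_rfl⟩
  have hN := S.covariance_smul S.e g
  have hNu : (g • S.covariance S.e) *ᵥ u = z := by
    have := hge.covariance_mulVec_inv hS z
    rwa [hN] at this
  have hMv : S.covariance p *ᵥ v = z := hp.covariance_mulVec_inv hS z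
  have h1 : 0 ≤ (u - v) ⬝ᵥ ((g • S.covariance S.e) *ᵥ (u - v)) := by
    rw [← hN, S.covariance_form_self]
    exact Finset.sum_nonneg fun x _ => mul_nonneg measureReal_nonneg (Finset.sum_nonneg fun a _ =>
      mul_nonneg (mul_nonneg hp.pos.le ((hS.e_mem x).1 a)) (sq_nonneg _))
  have h2 : v ⬝ᵥ ((g • S.covariance S.e) *ᵥ v) ≤ z ⬝ᵥ v := by
    have := S.covariance_form_mono hp.le v
    rwa [hN, hMv, dotProduct_comm v z] at this
  have h3 : u ⬝ᵥ ((g • S.covariance S.e) *ᵥ v) = z ⬝ᵥ v := by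
    rw [dotProduct_mulVec, ← mulVec_transpose, ← hN, S.covariance_isSymm, hN, hNu]
  rw [mulVec_sub, hNu, dotProduct_sub, sub_dotProduct, sub_dotProduct, h3, dotProduct_comm u,
    dotProduct_comm v z] at h1
  have h4 : z ⬝ᵥ u = g⁻¹ * (z ⬝ᵥ ((S.covariance S.e)⁻¹ *ᵥ z)) := by
    have hdet := (isUnit_iff_isUnit_det _).1 hS.e_isUnit
    let _ := invertibleOfNonzero hp.pos.ne'
    rw [hu, inv_smul (S.covariance S.e) g hdet, smul_mulVec, dotProduct_smul, smul_eq_mul,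
      invOf_eq_inv]
  have h5 := hS.e_bound z hz
  have h6 : z ⬝ᵥ u ≤ 1 / (g * S.lam) := by
    rw [h4, one_div, mul_inv, ← one_div S.lam]
    have := hp.pos
    gcongr
  have : S.invForm p z z = z ⬝ᵥ v := rfl
  linarith

/-- Leverage scores are at most one: keeping only the term (x, a) in `sum_invForm_sq` for z = φ(a,
x) gives w·I² ≤ I, where w = G{x}·p(x, a) and I is the form at z. -/
theorem Setting.Explores.mass_mul_invForm_le (hp : S.Explores g p) (hS : S.Assumptions)
    (x : 𝒳) (a : Fin K) :
    S.G.real {x} * p x a * S.invForm p (S.φ a x) (S.φ a x) ≤ 1 := by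
  have h0 := hp.invForm_nonneg hS (S.φ a x)
  have h1 := hp.sum_invForm_sq hS (S.φ a x)
  have hnn : ∀ y b, 0 ≤ p y b * S.invForm p (S.φ a x) (S.φ b y) ^ 2 := fun y b =>
    mul_nonneg (hp.nonneg hS y b) (sq_nonneg _)
  have h2 : S.G.real {x} * (p x a * S.invForm p (S.φ a x) (S.φ a x) ^ 2) ≤
      S.invForm p (S.φ a x) (S.φ a x) := by
    conv_rhs => rw [← h1]
    refine le_trans ?_ (Finset.single_le_sum (f := fun y => S.G.real {y} *
      ∑ b, p y b * S.invForm p (S.φ a x) (S.φ b y) ^ 2) (fun y _ => mul_nonneg measureReal_nonneg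
        (Finset.sum_nonneg fun b _ => hnn y b)) (Finset.mem_univ x))
    gcongr
    exact Finset.single_le_sum (fun b _ => hnn x b) (Finset.mem_univ a)
  rcases h0.eq_or_lt with h | h
  · rw [← h]; simp
  · refine le_of_mul_le_mul_right ?_ h
    linarith

/-- Cauchy–Schwarz, from the discriminant of the form along z + s z'. -/
theorem Setting.Explores.invForm_sq_le (hp : S.Explores g p) (hS : S.Assumptions)
    (z z' : Fin d → ℝ) : S.invForm p z z' ^ 2 ≤ S.invForm p z z * S.invForm p z' z' := by
  have h : ∀ s : ℝ, 0 ≤ S.invForm p z' z' * (s * s) + 2 * S.invForm p z z' * s +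
      S.invForm p z z := by
    intro s
    have h1 := hp.invForm_nonneg hS (z + s • z')
    have h2 := S.invForm_comm p z z'
    simp only [Setting.invForm, mulVec_add, mulVec_smul, dotProduct_add, add_dotProduct,
      dotProduct_smul, smul_dotProduct, smul_eq_mul] at h1 h2 ⊢
    rw [← h2] at h1
    linarith
  have := discrim_le_zero h
  rw [discrim] at this
  linarith

theorem Setting.Assumptions.nonempty (hS : S.Assumptions) : Nonempty 𝒳 := by
  have := hS.prob
  by_contra h
  rw [not_nonempty_iff] at h
  exact IsProbabilityMeasure.ne_zero S.G (Measure.eq_zero_of_isEmpty S.G)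

theorem Setting.Assumptions.one_le_L (hS : S.Assumptions) : 1 ≤ S.L := by
  have := hS.nonempty
  have h : (1 : ℝ) ≤ Fintype.card 𝒳 := by exact_mod_cast Fintype.card_pos
  exact h.trans hS.card_le

theorem Setting.Assumptions.one_le_K (hS : S.Assumptions) : 1 ≤ K := by
  obtain ⟨x⟩ := hS.nonempty
  by_contra h
  obtain rfl : K = 0 := by omega
  have := (hS.e_mem x).2
  simp at this

theorem Setting.Assumptions.sum_mass [MeasurableSingletonClass 𝒳] (hS : S.Assumptions) :
    ∑ x, S.G.real {x} = 1 := by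
  have := hS.prob
  have h := sum_measureReal_singleton (μ := S.G) Finset.univ
  rw [h]
  simp

/-- The trace identity for the exploration policy itself. It allows √d to be compared with √(L/λ),
so that the initial weight is absorbed in κ. -/
theorem Setting.Assumptions.dim_le [MeasurableSingletonClass 𝒳] (hS : S.Assumptions) :
    (d : ℝ) ≤ 1 / S.lam := by
  have he : S.Explores 1 S.e := ⟨one_pos, fun x a => by rw [one_mul]⟩
  rw [← he.sum_invForm_self hS]
  calc ∑ x, S.G.real {x} * ∑ a, S.e x a * S.invForm S.e (S.φ a x) (S.φ a x)
      ≤ ∑ x, S.G.real {x} * ∑ a, S.e x a * (1 / S.lam) := by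
        gcongr with x _ a _
        · exact (hS.e_mem x).1 a
        · exact hS.e_bound _ (hS.φ_mem a x)
    _ = 1 / S.lam := by
        simp only [← Finset.sum_mul, (hS.e_mem _).2, one_mul, hS.sum_mass]

end Covariance

/-! ### Averaging over contexts, noise and arms -/

section Probability

variable {Ω 𝒳 : Type*} {m : MeasurableSpace Ω} [mΩ : MeasurableSpace Ω] [MeasurableSpace 𝒳] [Fintype 𝒳]
  [MeasurableSingletonClass 𝒳] {K d : ℕ}

theorem measurable_eval_context {X : Ω → 𝒳} (hX : Measurable[m] X)
    {f : Ω → 𝒳 → ℝ} (hf : ∀ x, Measurable[m] fun ω => f ω x) :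
    Measurable[m] fun ω => f ω (X ω) :=
  measurable_at_context (mΩ := m) hX hf

theorem eval_eq_sum_ite {ι : Type*} [Fintype ι] [DecidableEq ι] (f : ι → ℝ) (i : ι) :
    f i = ∑ j, (if i = j then (1 : ℝ) else 0) * f j := by
  simp

/-- Averaging over a fresh context. -/
theorem integral_fresh_context {μ : Measure Ω} [IsProbabilityMeasure μ]
    (hm : m ≤ mΩ) {G : Measure 𝒳} {X : Ω → 𝒳} (hX : Measurable X) (hlaw : μ.map X = G)
    (hind : Indep (MeasurableSpace.comap X inferInstance) m μ) {h : Ω → 𝒳 → ℝ}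
    (hh : ∀ x, Measurable[m] fun ω => h ω x) {c : ℝ} (hc : ∀ ω x, |h ω x| ≤ c) :
    ∫ ω, h ω (X ω) ∂μ = ∫ ω, ∑ x, G.real {x} * h ω x ∂μ := by
  classical
  have hint : ∀ x, Integrable (fun ω => h ω x) μ := fun x =>
    Integrable.of_bound (((hh x).mono hm le_rfl).aestronglyMeasurable) c
      (Filter.Eventually.of_forall fun ω => hc ω x)
  have hset : ∀ x, MeasurableSet[MeasurableSpace.comap X inferInstance] {ω | X ω = x} := fun x =>
    ⟨{x}, MeasurableSet.singleton x, rfl⟩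
  have hind1 : ∀ x, Measurable[MeasurableSpace.comap X inferInstance]
      (fun ω => if X ω = x then (1 : ℝ) else 0) := fun x =>
    Measurable.ite (hset x) measurable_const measurable_const
  have hXm : MeasurableSpace.comap X inferInstance ≤ mΩ := hX.comap_le
  have hbd : ∀ x, Integrable (fun ω => (if X ω = x then (1 : ℝ) else 0) * h ω x) μ := fun x => by
    refine (hint x).bdd_mul (c := 1) (((hind1 x).mono hXm le_rfl).aestronglyMeasurable)
      (Filter.Eventually.of_forall fun ω => ?_)
    split_ifs <;> simp
  -- Splitting by the value of X leaves, for each fixed x, a product of an event of the fresh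
  -- context and a function of the past, which are independent.
  have e1 : ∀ ω, h ω (X ω) = ∑ x, (if X ω = x then (1 : ℝ) else 0) * h ω x := fun ω =>
    eval_eq_sum_ite (fun x => h ω x) (X ω)
  simp_rw [e1]
  rw [integral_finsetSum _ fun x _ => hbd x,
    integral_finsetSum _ fun x _ => (hint x).const_mul _]
  refine Finset.sum_congr rfl fun x _ => ?_
  have hI : IndepFun (fun ω => if X ω = x then (1 : ℝ) else 0) (fun ω => h ω x) μ := by
    rw [IndepFun_iff_Indep]
    exact indep_of_indep_of_le_left (indep_of_indep_of_le_right hind (hh x).comap_le)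
      (hind1 x).comap_le
  rw [hI.integral_fun_mul_eq_mul_integral
    (((hind1 x).mono hXm le_rfl).aestronglyMeasurable) (hint x).aestronglyMeasurable,
    integral_const_mul]
  congr 1
  have : (fun ω => if X ω = x then (1 : ℝ) else 0) = Set.indicator {ω | X ω = x} 1 := by
    ext ω
    simp [Set.indicator_apply]
  rw [this, integral_indicator_one (hXm _ (hset x)), ← hlaw, map_measureReal_apply hX
    (MeasurableSet.singleton x)]
  rfl

/-- Pull the measurable factor out of the conditional expectation, then integrate. -/
theorem integral_mul_of_condExp {μ : Measure Ω} [IsProbabilityMeasure μ]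
    (hm : m ≤ mΩ) {f g k : Ω → ℝ} (hf : Integrable f μ) (hcond : μ[f | m] =ᵐ[μ] k)
    (hg : Measurable[m] g) {c : ℝ} (hgc : ∀ᵐ ω ∂μ, |g ω| ≤ c) :
    ∫ ω, f ω * g ω ∂μ = ∫ ω, k ω * g ω ∂μ := by
  have hfg : Integrable (f * g) μ :=
    hf.mul_bdd (c := c) ((hg.mono hm le_rfl).aestronglyMeasurable) hgc
  have h1 := condExp_mul_of_aestronglyMeasurable_right (μ := μ) (m := m) (f := f) (g := g)
    hg.stronglyMeasurable.aestronglyMeasurable hfg hf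
  have h2 : ∫ ω, f ω * g ω ∂μ = ∫ ω, (μ[f * g | m]) ω ∂μ := (integral_condExp hm).symm
  rw [h2]
  refine integral_congr_ae ?_
  filter_upwards [h1, hcond] with ω e1 e2
  rw [e1, Pi.mul_apply, e2]

variable {P : Play Ω 𝒳 K d} {S : Setting 𝒳 K d} {μ : Measure Ω} [IsProbabilityMeasure μ]
  {ℱ : Filtration ℕ mΩ} {T t : ℕ}

theorem Play.IsTsallisINF.policy_measurable (hA : P.IsTsallisINF S ℱ T) (h1 : 1 ≤ t) (h2 : t ≤ T)
    (x : 𝒳) (a : Fin K) : Measurable[ℱ (t - 1)] fun ω => P.policy S t ω x a :=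
  ((hA.q_measurable t h1 h2 x a).const_mul _).add_const _

theorem Play.IsTsallisINF.policy_nonneg (hA : P.IsTsallisINF S ℱ T) (hS : S.Assumptions)
    (h1 : 1 ≤ t) (h2 : t ≤ T) (ω : Ω) (x : 𝒳) (a : Fin K) : 0 ≤ P.policy S t ω x a := by
  obtain ⟨g0, g1⟩ := S.gamma_mem hS t
  exact add_nonneg (mul_nonneg (by linarith) ((hA.q_mem t h1 h2 ω x).1 a))
    (mul_nonneg g0 ((hS.e_mem x).1 a))

theorem Play.IsTsallisINF.sum_policy (hA : P.IsTsallisINF S ℱ T) (hS : S.Assumptions)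
    (h1 : 1 ≤ t) (h2 : t ≤ T) (ω : Ω) (x : 𝒳) : ∑ a, P.policy S t ω x a = 1 := by
  simp only [Play.policy, Finset.sum_add_distrib, ← Finset.mul_sum, (hA.q_mem t h1 h2 ω x).2,
    (hS.e_mem x).2]
  ring

theorem Play.IsTsallisINF.policy_mem (hA : P.IsTsallisINF S ℱ T) (hS : S.Assumptions)
    (h1 : 1 ≤ t) (h2 : t ≤ T) (ω : Ω) (x : 𝒳) : P.policy S t ω x ∈ stdSimplex ℝ (Fin K) :=
  ⟨hA.policy_nonneg hS h1 h2 ω x, hA.sum_policy hS h1 h2 ω x⟩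

theorem abs_sum_mul_le_of_mem_stdSimplex {p f : Fin K → ℝ} (hp : p ∈ stdSimplex ℝ (Fin K)) {c : ℝ}
    (hf : ∀ a, |f a| ≤ c) : |∑ a, p a * f a| ≤ c := by
  calc |∑ a, p a * f a| ≤ ∑ a, |p a * f a| := Finset.abs_sum_le_sum_abs _ _
    _ ≤ ∑ a, p a * c := by
        gcongr with a
        rw [abs_mul, abs_of_nonneg (hp.1 a)]
        exact mul_le_mul_of_nonneg_left (hf a) (hp.1 a)
    _ = c := by rw [← Finset.sum_mul, hp.2, one_mul]

/-- The past together with the current context. -/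
abbrev Play.pastAndContext (P : Play Ω 𝒳 K d) (ℱ : Filtration ℕ mΩ) (t : ℕ) : MeasurableSpace Ω :=
  ℱ (t - 1) ⊔ MeasurableSpace.comap (P.X t) inferInstance

/-- The information before the arm is drawn. -/
abbrev Play.infoBeforeArm (P : Play Ω 𝒳 K d) (ℱ : Filtration ℕ mΩ) (t : ℕ) : MeasurableSpace Ω :=
  P.pastAndContext ℱ t ⊔ MeasurableSpace.comap (P.ε t) inferInstance

theorem Play.IsInteraction.measurable_X (hP : P.IsInteraction S μ ℱ T) (h1 : 1 ≤ t) (h2 : t ≤ T) :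
    Measurable (P.X t) := (hP.X_measurable t h1 h2).mono (ℱ.le _) le_rfl

theorem Play.IsInteraction.infoBeforeArm_le (hP : P.IsInteraction S μ ℱ T)
    (h1 : 1 ≤ t) (h2 : t ≤ T) : P.infoBeforeArm ℱ t ≤ mΩ :=
  sup_le (sup_le (ℱ.le _) (hP.measurable_X h1 h2).comap_le) (hP.ε_measurable t h1 h2).comap_le

theorem Play.IsInteraction.integral_context (hP : P.IsInteraction S μ ℱ T)
    (h1 : 1 ≤ t) (h2 : t ≤ T) {h : Ω → 𝒳 → ℝ} (hh : ∀ x, Measurable[ℱ (t - 1)] fun ω => h ω x)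
    {c : ℝ} (hc : ∀ ω x, |h ω x| ≤ c) :
    ∫ ω, h ω (P.X t ω) ∂μ = ∫ ω, ∑ x, S.G.real {x} * h ω x ∂μ :=
  integral_fresh_context (ℱ.le _) (hP.measurable_X h1 h2) (hP.X_law t h1 h2) (hP.X_indep t h1 h2)
    hh hc

theorem Play.IsInteraction.measurable_mean (hP : P.IsInteraction S μ ℱ T)
    (h1 : 1 ≤ t) (h2 : t ≤ T) (z : Fin d → ℝ) : Measurable[ℱ (t - 1)] fun ω => z ⬝ᵥ P.θ t ω := by
  have hθ := hP.θ_measurable t h1 h2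
  unfold dotProduct
  exact Finset.measurable_fun_sum _ fun i _ => ((measurable_pi_apply i).comp hθ).const_mul _

theorem Play.IsInteraction.abs_mean_le (hP : P.IsInteraction S μ ℱ T) (hS : S.Assumptions)
    (h1 : 1 ≤ t) (h2 : t ≤ T) (ω : Ω) (a : Fin K) (x : 𝒳) : |S.φ a x ⬝ᵥ P.θ t ω| ≤ 1 :=
  hS.bounded _ (hS.φ_mem a x) _ (hP.θ_mem t h1 h2 ω)

theorem Play.IsInteraction.ae_abs_noise_le (hP : P.IsInteraction S μ ℱ T) (hS : S.Assumptions)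
    (h1 : 1 ≤ t) (h2 : t ≤ T) : ∀ᵐ ω ∂μ, ∀ a, |P.ε t ω a| ≤ 2 := by
  obtain ⟨x⟩ := hS.nonempty
  filter_upwards [hP.loss_bounded t h1 h2] with ω hω a
  have e1 := abs_le.1 (hω a x)
  have e2 := abs_le.1 (hP.abs_mean_le hS h1 h2 ω a x)
  unfold Play.loss at e1
  exact abs_le.2 ⟨by linarith, by linarith⟩

/-- The noise integrates to zero against past information and the context. -/
theorem Play.IsInteraction.integral_noise (hP : P.IsInteraction S μ ℱ T) (hS : S.Assumptions)
    (h1 : 1 ≤ t) (h2 : t ≤ T) (a : Fin K) {h : Ω → 𝒳 → ℝ}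
    (hh : ∀ x, Measurable[ℱ (t - 1)] fun ω => h ω x) {c : ℝ} (hc : ∀ ω x, |h ω x| ≤ c) :
    Integrable (fun ω => P.ε t ω a * h ω (P.X t ω)) μ ∧
      ∫ ω, P.ε t ω a * h ω (P.X t ω) ∂μ = 0 := by
  have hmle : P.pastAndContext ℱ t ≤ mΩ := sup_le (ℱ.le _) (hP.measurable_X h1 h2).comap_le
  have hε : Integrable (fun ω => P.ε t ω a) μ :=
    Integrable.of_bound ((measurable_pi_apply a).comp (hP.ε_measurable t h1 h2)).aestronglyMeasurable
      2 ((hP.ae_abs_noise_le hS h1 h2).mono fun ω hω => hω a)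
  have hg : Measurable[P.pastAndContext ℱ t] fun ω => h ω (P.X t ω) := by
    refine measurable_eval_context ?_ fun x => (hh x).mono le_sup_left le_rfl
    exact (comap_measurable (P.X t)).mono le_sup_right le_rfl
  refine ⟨hε.mul_bdd (c := c) ((hg.mono hmle le_rfl).aestronglyMeasurable)
    (Filter.Eventually.of_forall fun ω => hc ω _), ?_⟩
  rw [integral_mul_of_condExp hmle hε (hP.ε_centered t h1 h2 a) hg
    (Filter.Eventually.of_forall fun ω => hc ω _)]
  simp

/-- Averaging over the draw of the arm. -/
theorem Play.IsInteraction.integral_arm (hP : P.IsInteraction S μ ℱ T)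
    (h1 : 1 ≤ t) (h2 : t ≤ T) {f : Ω → Fin K → ℝ}
    (hf : ∀ a, Measurable[P.infoBeforeArm ℱ t] fun ω => f ω a) {c : ℝ}
    (hc : ∀ᵐ ω ∂μ, ∀ a, |f ω a| ≤ c) :
    ∫ ω, f ω (P.A t ω) ∂μ = ∑ a, ∫ ω, P.policy S t ω (P.X t ω) a * f ω a ∂μ := by
  have hle := hP.infoBeforeArm_le h1 h2
  have hAm : Measurable (P.A t) := (hP.A_measurable t h1 h2).mono (ℱ.le _) le_rfl
  have hI : ∀ a, Integrable (fun ω => if P.A t ω = a then (1 : ℝ) else 0) μ := fun a =>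
    Integrable.of_bound (Measurable.ite (hAm (MeasurableSet.singleton a)) measurable_const
      measurable_const).aestronglyMeasurable 1
      (Filter.Eventually.of_forall fun ω => by split_ifs <;> simp)
  simp_rw [fun ω => eval_eq_sum_ite (f ω) (P.A t ω)]
  rw [integral_finsetSum _ fun a _ => (hI a).mul_bdd (c := c)
    (((hf a).mono hle le_rfl).aestronglyMeasurable) (hc.mono fun ω h => h a)]
  refine Finset.sum_congr rfl fun a _ => ?_
  exact integral_mul_of_condExp hle (hI a) (hP.A_law t h1 h2 a) (hf a) (hc.mono fun ω h => h a)

variable {H : Ω → 𝒳 → Fin K → ℝ} {c : ℝ}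

theorem Play.measurable_at_X (P : Play Ω 𝒳 K d) {h : Ω → 𝒳 → ℝ} (hh : ∀ x, Measurable[ℱ (t - 1)] fun ω => h ω x) :
    Measurable[P.infoBeforeArm ℱ t] fun ω => h ω (P.X t ω) := by
  refine measurable_eval_context ?_ fun x => (hh x).mono (le_sup_of_le_left le_sup_left) le_rfl
  exact (comap_measurable (P.X t)).mono (le_sup_of_le_left le_sup_right) le_rfl

theorem Play.IsInteraction.integral_context_arm (hP : P.IsInteraction S μ ℱ T)
    (hA : P.IsTsallisINF S ℱ T) (hS : S.Assumptions) (h1 : 1 ≤ t) (h2 : t ≤ T)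
    (hH : ∀ x a, Measurable[ℱ (t - 1)] fun ω => H ω x a) (hc : ∀ ω x a, |H ω x a| ≤ c) :
    ∫ ω, H ω (P.X t ω) (P.A t ω) ∂μ =
      ∫ ω, ∑ x, S.G.real {x} * ∑ a, P.policy S t ω x a * H ω x a ∂μ := by
  have hle := hP.infoBeforeArm_le h1 h2
  have hHm := fun a => P.measurable_at_X (h := fun ω x => H ω x a) (fun x => hH x a)
  rw [hP.integral_arm h1 h2 (f := fun ω a => H ω (P.X t ω) a) hHm
    (Filter.Eventually.of_forall fun ω a => hc ω _ a)]
  rw [← integral_finsetSum]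
  · refine hP.integral_context h1 h2 (h := fun ω x => ∑ a, P.policy S t ω x a * H ω x a)
      (fun x => Finset.measurable_fun_sum _ fun a _ =>
        (hA.policy_measurable h1 h2 x a).mul (hH x a)) (c := c) fun ω x => ?_
    exact abs_sum_mul_le_of_mem_stdSimplex (hA.policy_mem hS h1 h2 ω x) (hc ω x)
  · intro a _
    refine Integrable.of_bound (C := c) (((P.measurable_at_X (h := fun ω x => P.policy S t ω x a)
      (fun x => hA.policy_measurable h1 h2 x a)).mul (hHm a)).mono hle le_rfl).aestronglyMeasurable
      (Filter.Eventually.of_forall fun ω => ?_)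
    have e1 := hA.policy_mem hS h1 h2 ω (P.X t ω)
    rw [Real.norm_eq_abs, abs_mul, abs_of_nonneg (e1.1 a)]
    calc _ ≤ 1 * |H ω (P.X t ω) a| := by
          gcongr; exact le_one_of_mem_stdSimplex e1 a
      _ ≤ c := by rw [one_mul]; exact hc _ _ _

/-- The order of averaging matters. The arm is averaged first, given past, context and noise, which
turns its indicator into the policy. The noise then stands against a function of past and context
only, and integrates to zero. -/
theorem Play.IsInteraction.integral_context_arm_loss (hP : P.IsInteraction S μ ℱ T)
    (hA : P.IsTsallisINF S ℱ T) (hS : S.Assumptions) (h1 : 1 ≤ t) (h2 : t ≤ T)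
    (hH : ∀ x a, Measurable[ℱ (t - 1)] fun ω => H ω x a) (hc : ∀ ω x a, |H ω x a| ≤ c) :
    ∫ ω, H ω (P.X t ω) (P.A t ω) * P.loss S t ω (P.A t ω) (P.X t ω) ∂μ =
      ∫ ω, ∑ x, S.G.real {x} * ∑ a, P.policy S t ω x a * (H ω x a * (S.φ a x ⬝ᵥ P.θ t ω)) ∂μ := by
  have hle := hP.infoBeforeArm_le h1 h2
  have hHm := fun a => P.measurable_at_X (h := fun ω x => H ω x a) (fun x => hH x a)
  have hmean : ∀ a, Measurable[P.infoBeforeArm ℱ t] fun ω => S.φ a (P.X t ω) ⬝ᵥ P.θ t ω :=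
    fun a => P.measurable_at_X (h := fun ω x => S.φ a x ⬝ᵥ P.θ t ω)
      (fun x => hP.measurable_mean h1 h2 _)
  have hloss : ∀ a, Measurable[P.infoBeforeArm ℱ t] fun ω => P.loss S t ω a (P.X t ω) := fun a => by
    refine (hmean a).add ?_
    exact ((measurable_pi_apply a).comp (comap_measurable (P.ε t))).mono le_sup_right le_rfl
  have hbd : ∀ ω x a, |H ω x a * (S.φ a x ⬝ᵥ P.θ t ω)| ≤ c := fun ω x a => by
    rw [abs_mul]
    calc _ ≤ |H ω x a| * 1 := by gcongr; exact hP.abs_mean_le hS h1 h2 ω a x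
      _ ≤ c := by rw [mul_one]; exact hc _ _ _
  have hHθ : ∀ x a, Measurable[ℱ (t - 1)] fun ω => H ω x a * (S.φ a x ⬝ᵥ P.θ t ω) := fun x a =>
    (hH x a).mul (hP.measurable_mean h1 h2 _)
  rw [← hP.integral_context_arm hA hS h1 h2 hHθ hbd]
  rw [hP.integral_arm h1 h2 (f := fun ω a => H ω (P.X t ω) a * P.loss S t ω a (P.X t ω))
    (fun a => (hHm a).mul (hloss a)) (c := c) ?_,
    hP.integral_arm h1 h2 (f := fun ω a => H ω (P.X t ω) a * (S.φ a (P.X t ω) ⬝ᵥ P.θ t ω))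
    (fun a => (hHm a).mul (hmean a)) (c := c) (Filter.Eventually.of_forall fun ω a => hbd _ _ _)]
  · refine Finset.sum_congr rfl fun a _ => ?_
    have hpm := fun x => hA.policy_measurable h1 h2 x a
    have hpc : ∀ ω x, |P.policy S t ω x a * H ω x a| ≤ c := fun ω x => by
      have e1 := hA.policy_mem hS h1 h2 ω x
      rw [abs_mul, abs_of_nonneg (e1.1 a)]
      calc _ ≤ 1 * |H ω x a| := by gcongr; exact le_one_of_mem_stdSimplex e1 a
        _ ≤ c := by rw [one_mul]; exact hc _ _ _
    obtain ⟨i1, i2⟩ := hP.integral_noise hS h1 h2 a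
      (h := fun ω x => P.policy S t ω x a * H ω x a) (fun x => (hpm x).mul (hH x a)) hpc
    have e : ∀ ω, P.policy S t ω (P.X t ω) a * (H ω (P.X t ω) a * P.loss S t ω a (P.X t ω)) =
        P.policy S t ω (P.X t ω) a * (H ω (P.X t ω) a * (S.φ a (P.X t ω) ⬝ᵥ P.θ t ω)) +
        P.ε t ω a * (P.policy S t ω (P.X t ω) a * H ω (P.X t ω) a) := fun ω => by
      unfold Play.loss; ring
    simp_rw [e]
    rw [integral_add _ i1, i2, add_zero]
    refine Integrable.of_bound (C := c) (((P.measurable_at_X (fun x => hpm x)).mul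
      ((hHm a).mul (hmean a))).mono hle le_rfl).aestronglyMeasurable
      (Filter.Eventually.of_forall fun ω => ?_)
    rw [Real.norm_eq_abs, ← mul_assoc, abs_mul]
    calc _ ≤ |P.policy S t ω (P.X t ω) a * H ω (P.X t ω) a| * 1 := by
          gcongr; exact hP.abs_mean_le hS h1 h2 ω a _
      _ ≤ c := by rw [mul_one]; exact hpc _ _
  · filter_upwards [hP.loss_bounded t h1 h2] with ω hω a
    rw [abs_mul]
    calc _ ≤ |H ω (P.X t ω) a| * 1 := by gcongr; exact hω _ _
      _ ≤ c := by rw [mul_one]; exact hc _ _ _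

/-- The average loss of a fixed policy. -/
theorem Play.IsInteraction.integral_loss_policy (hP : P.IsInteraction S μ ℱ T)
    (hS : S.Assumptions) (h1 : 1 ≤ t) (h2 : t ≤ T) (ρ : 𝒳 → Fin K) :
    ∫ ω, P.loss S t ω (ρ (P.X t ω)) (P.X t ω) ∂μ =
      ∫ ω, S.φ (ρ (P.X t ω)) (P.X t ω) ⬝ᵥ P.θ t ω ∂μ := by
  classical
  have hle := hP.infoBeforeArm_le h1 h2
  have hm : Measurable fun ω => S.φ (ρ (P.X t ω)) (P.X t ω) ⬝ᵥ P.θ t ω :=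
    (P.measurable_at_X (h := fun ω x => S.φ (ρ x) x ⬝ᵥ P.θ t ω)
      (fun x => hP.measurable_mean h1 h2 _)).mono hle le_rfl
  have hz : ∀ a, Integrable (fun ω => P.ε t ω a * (if ρ (P.X t ω) = a then (1 : ℝ) else 0)) μ ∧
      ∫ ω, P.ε t ω a * (if ρ (P.X t ω) = a then (1 : ℝ) else 0) ∂μ = 0 := fun a =>
    hP.integral_noise hS h1 h2 a (h := fun _ x => if ρ x = a then (1 : ℝ) else 0)
      (fun x => measurable_const) (c := 1) (fun ω x => by split_ifs <;> simp)
  have e : ∀ ω, P.loss S t ω (ρ (P.X t ω)) (P.X t ω) = S.φ (ρ (P.X t ω)) (P.X t ω) ⬝ᵥ P.θ t ω +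
      ∑ a, P.ε t ω a * (if ρ (P.X t ω) = a then (1 : ℝ) else 0) := fun ω => by
    simp [Play.loss]
  simp_rw [e]
  rw [integral_add, integral_finsetSum _ fun a _ => (hz a).1]
  · simp only [(hz _).2, Finset.sum_const_zero, add_zero]
  · exact Integrable.of_bound hm.aestronglyMeasurable 1
      (Filter.Eventually.of_forall fun ω => hP.abs_mean_le hS h1 h2 ω _ _)
  · exact integrable_finsetSum _ fun a _ => (hz a).1

end Probability

/-! ### Learning rates, exploration rates and κ -/

section Rates

variable {𝒳 : Type*} [MeasurableSpace 𝒳] [Fintype 𝒳] {K d : ℕ} {S : Setting 𝒳 K d} {t : ℕ}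

theorem sqrt_div_rpow_quarter {K : ℕ} (hK : 1 ≤ K) :
    0 < (K : ℝ) ^ (1 / 4 : ℝ) ∧ ((K : ℝ) ^ (1 / 4 : ℝ)) ^ 2 = √K ∧
      √(√(K : ℝ)) = (K : ℝ) ^ (1 / 4 : ℝ) := by
  have hK0 : (0 : ℝ) < K := by exact_mod_cast hK
  have h1 : 0 < (K : ℝ) ^ (1 / 4 : ℝ) := Real.rpow_pos_of_pos hK0 _
  have h2 : ((K : ℝ) ^ (1 / 4 : ℝ)) ^ 2 = √K := by
    rw [← Real.rpow_natCast, ← Real.rpow_mul hK0.le, Real.sqrt_eq_rpow]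
    norm_num
  refine ⟨h1, h2, ?_⟩
  rw [← h2, Real.sqrt_sq h1.le]

theorem Setting.Assumptions.eta_pos (hS : S.Assumptions) (hd : 1 ≤ d) (ht : 1 ≤ t) :
    0 < S.eta t := by
  have h1 := (sqrt_div_rpow_quarter hS.one_le_K).1
  have h2 := hS.one_le_L
  have h3 := hS.lam_pos
  have hd0 : (0 : ℝ) < d := by exact_mod_cast hd
  have ht0 : (0 : ℝ) < t := by exact_mod_cast ht
  exact lt_min (by positivity) (by positivity)

theorem Setting.invEta_eq (S : Setting 𝒳 K d) (ht : 1 ≤ t) : S.invEta t = 1 / S.eta t := by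
  rw [Setting.invEta, if_neg (by omega)]

theorem Setting.Assumptions.invEta_pos (hS : S.Assumptions) (hd : 1 ≤ d) (ht : 1 ≤ t) :
    0 < S.invEta t := by
  rw [S.invEta_eq ht]
  exact one_div_pos.2 (hS.eta_pos hd ht)

theorem Setting.Assumptions.invEta_eq_max (hS : S.Assumptions) (hd : 1 ≤ d) (ht : 1 ≤ t) :
    S.invEta t = max (√d * √t / (K : ℝ) ^ (1 / 4 : ℝ)) (16 * √(S.L / S.lam)) := by
  have h1 := (sqrt_div_rpow_quarter hS.one_le_K).1
  have h2 := hS.one_le_L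
  have h3 := hS.lam_pos
  have hd0 : (0 : ℝ) < d := by exact_mod_cast hd
  have ht0 : (0 : ℝ) < t := by exact_mod_cast ht
  have e1 : √d * √t / (K : ℝ) ^ (1 / 4 : ℝ) = ((K : ℝ) ^ (1 / 4 : ℝ) / √((d : ℝ) * t))⁻¹ := by
    rw [inv_div, Real.sqrt_mul hd0.le]
  have e2 : 16 * √(S.L / S.lam) = (1 / 16 * √(S.lam / S.L))⁻¹ := by
    rw [mul_inv, ← Real.sqrt_inv, inv_div]
    norm_num
  rw [S.invEta_eq ht, e1, e2, Setting.eta, one_div]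
  have p1 : 0 < (K : ℝ) ^ (1 / 4 : ℝ) / √((d : ℝ) * t) := by positivity
  have p2 : 0 < 1 / 16 * √(S.lam / S.L) := by positivity
  rcases le_total ((K : ℝ) ^ (1 / 4 : ℝ) / √((d : ℝ) * t)) (1 / 16 * √(S.lam / S.L)) with h | h
  · rw [min_eq_left h, max_eq_left (inv_anti₀ p1 h)]
  · rw [min_eq_right h, max_eq_right (inv_anti₀ p2 h)]

theorem sqrt_natCast_le_sqrt_two_mul (ht : 2 ≤ t) : √(t : ℝ) ≤ √2 * √((t - 1 : ℕ) : ℝ) := by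
  rw [← Real.sqrt_mul (by norm_num)]
  refine Real.sqrt_le_sqrt ?_
  exact_mod_cast (by omega : t ≤ 2 * (t - 1))

/-- The size of the round-t estimator is governed by γ_t, hence by η_t, while q_t is regularized
with η_{t-1}. This comparison bridges the mismatch. -/
theorem Setting.Assumptions.invEta_le_prev (hS : S.Assumptions) (hd : 1 ≤ d) (ht : 2 ≤ t) :
    S.invEta t ≤ √2 * S.invEta (t - 1) := by
  have h1 := (sqrt_div_rpow_quarter hS.one_le_K).1
  rw [hS.invEta_eq_max hd (by omega), hS.invEta_eq_max hd (by omega)]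
  have h2 : (1 : ℝ) ≤ √2 := Real.one_le_sqrt.2 (by norm_num)
  refine max_le ?_ ?_
  · refine le_trans ?_ (mul_le_mul_of_nonneg_left (le_max_left _ _) (by positivity))
    rw [← mul_div_assoc]
    gcongr ?_ / _
    have := sqrt_natCast_le_sqrt_two_mul ht
    nlinarith [Real.sqrt_nonneg (d : ℝ)]
  · refine le_trans ?_ (mul_le_mul_of_nonneg_left (le_max_right _ _) (by positivity))
    have : 0 ≤ 16 * √(S.L / S.lam) := by positivity
    nlinarith

theorem sqrt_dim_div (hK : 1 ≤ K) (c : ℝ) :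
    √(d * √K / c) = √d * (K : ℝ) ^ (1 / 4 : ℝ) / √c := by
  rw [Real.sqrt_div (by positivity), Real.sqrt_mul (Nat.cast_nonneg d),
    (sqrt_div_rpow_quarter hK).2.2]

/-- Growth of the regularization weights. -/
theorem Setting.Assumptions.invEta_sub_le (hS : S.Assumptions) (hd : 1 ≤ d) (ht : 3 ≤ t) :
    0 ≤ S.invEta (t - 1) - S.invEta (t - 2) ∧
      (S.invEta (t - 1) - S.invEta (t - 2)) * √K ≤ 2 * √(d * √K / t) := by
  obtain ⟨h1, h2, -⟩ := sqrt_div_rpow_quarter hS.one_le_K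
  set k := (K : ℝ) ^ (1 / 4 : ℝ) with hk
  rw [hS.invEta_eq_max hd (by omega), hS.invEta_eq_max hd (by omega), ← hk]
  have hmono : √((t - 2 : ℕ) : ℝ) ≤ √((t - 1 : ℕ) : ℝ) :=
    Real.sqrt_le_sqrt (by exact_mod_cast (by omega))
  have hd0 : (0 : ℝ) < d := by exact_mod_cast hd
  have hle : √d * √((t - 2 : ℕ) : ℝ) / k ≤ √d * √((t - 1 : ℕ) : ℝ) / k := by gcongr
  refine ⟨sub_nonneg.2 (max_le_max hle le_rfl), ?_⟩
  -- Taking the maximum with a constant does not enlarge increments.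
  have hsub : max (√d * √((t - 1 : ℕ) : ℝ) / k) (16 * √(S.L / S.lam)) -
      max (√d * √((t - 2 : ℕ) : ℝ) / k) (16 * √(S.L / S.lam)) ≤
      √d * √((t - 1 : ℕ) : ℝ) / k - √d * √((t - 2 : ℕ) : ℝ) / k := by
    rw [sub_le_iff_le_add]
    refine max_le ?_ ?_
    · linarith [le_max_left (√d * √((t - 2 : ℕ) : ℝ) / k) (16 * √(S.L / S.lam))]
    · linarith [le_max_right (√d * √((t - 2 : ℕ) : ℝ) / k) (16 * √(S.L / S.lam))]
  have ht0 : (0 : ℝ) < t := by exact_mod_cast (by omega)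
  have hdiff : √((t - 1 : ℕ) : ℝ) - √((t - 2 : ℕ) : ℝ) ≤ 2 / √t := by
    rw [le_div_iff₀ (by positivity)]
    have e1 : √((t - 1 : ℕ) : ℝ) ^ 2 = t - 1 := by
      rw [Real.sq_sqrt (by positivity), Nat.cast_sub (by omega)]; simp
    have e2 : √((t - 2 : ℕ) : ℝ) ^ 2 = t - 2 := by
      rw [Real.sq_sqrt (by positivity), Nat.cast_sub (by omega)]; simp
    have e3 := sqrt_natCast_le_sqrt_two_mul (t := t) (by omega)
    have e4 : √2 ≤ 2 := by rw [Real.sqrt_le_left (by norm_num)]; norm_num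
    have e5 : √(t : ℝ) ≤ 2 * √((t - 1 : ℕ) : ℝ) := e3.trans (by gcongr)
    -- Replacing √t by 2√(t-1) and adding √(t-2) completes the difference of squares 2((t-1) -
    -- (t-2)) = 2.
    calc (√((t - 1 : ℕ) : ℝ) - √((t - 2 : ℕ) : ℝ)) * √t
        ≤ (√((t - 1 : ℕ) : ℝ) - √((t - 2 : ℕ) : ℝ)) * (2 * √((t - 1 : ℕ) : ℝ)) := by
          gcongr
      _ ≤ (√((t - 1 : ℕ) : ℝ) - √((t - 2 : ℕ) : ℝ)) *
          (2 * (√((t - 1 : ℕ) : ℝ) + √((t - 2 : ℕ) : ℝ))) := by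
          gcongr
          exact le_add_of_nonneg_right (Real.sqrt_nonneg _)
      _ = 2 := by linear_combination 2 * e1 - 2 * e2
  calc _ ≤ (√d * √((t - 1 : ℕ) : ℝ) / k - √d * √((t - 2 : ℕ) : ℝ) / k) * √K := by gcongr
    _ = √d * (√((t - 1 : ℕ) : ℝ) - √((t - 2 : ℕ) : ℝ)) * k := by
        rw [← h2]; field_simp
    _ ≤ √d * (2 / √t) * k := by gcongr
    _ = 2 * √(d * √K / t) := by rw [sqrt_dim_div hS.one_le_K, ← hk]; ring

theorem Setting.Assumptions.dim_div_invEta_le (hS : S.Assumptions) (hd : 1 ≤ d) (ht : 2 ≤ t) :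
    d / S.invEta (t - 1) ≤ 2 * √(d * √K / t) := by
  have h1 := (sqrt_div_rpow_quarter hS.one_le_K).1
  set k := (K : ℝ) ^ (1 / 4 : ℝ) with hk
  have hd0 : (0 : ℝ) < d := by exact_mod_cast hd
  have ht0 : (0 : ℝ) < t := by exact_mod_cast (by omega)
  have e3 := sqrt_natCast_le_sqrt_two_mul ht
  have e4 : √2 ≤ 2 := by rw [Real.sqrt_le_left (by norm_num)]; norm_num
  have e5 : √(t : ℝ) ≤ 2 * √((t - 1 : ℕ) : ℝ) := e3.trans (by gcongr)
  have hge : √d * (√t / 2) / k ≤ S.invEta (t - 1) := by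
    rw [hS.invEta_eq_max hd (by omega)]
    refine le_trans ?_ (le_max_left _ _)
    rw [← hk]
    gcongr
    linarith
  calc (d : ℝ) / S.invEta (t - 1) ≤ d / (√d * (√t / 2) / k) := by gcongr
    _ = 2 * √(d * √K / t) := by
        rw [sqrt_dim_div hS.one_le_K, ← hk]
        nth_rewrite 1 [← Real.mul_self_sqrt hd0.le]
        field_simp

theorem Setting.Assumptions.gamma_pos (hS : S.Assumptions) (hd : 1 ≤ d) (ht : 1 ≤ t) :
    0 < S.gamma t := by
  have h1 := hS.eta_pos hd ht
  have h2 := hS.one_le_L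
  have h3 := hS.lam_pos
  unfold Setting.gamma
  positivity

/-- Exploration at rate γ_t bounds the inverse form by 1/(γ_t λ); here that bound is expressed on
the scale of the regularization weight. -/
theorem Setting.Assumptions.inv_gamma_mul_lam (hS : S.Assumptions) (hd : 1 ≤ d) (ht : 1 ≤ t) :
    1 / (S.gamma t * S.lam) = S.invEta t ^ 2 / (128 * S.L) := by
  have h1 := hS.eta_pos hd ht
  have h2 := hS.one_le_L
  have h3 := hS.lam_pos
  rw [S.invEta_eq ht]
  unfold Setting.gamma
  field_simp

theorem Setting.Assumptions.gamma_le (hS : S.Assumptions) (hd : 1 ≤ d) (ht : 1 ≤ t) :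
    S.gamma t ≤ 128 * (√K * S.L / (S.lam * d)) * (1 / t) := by
  obtain ⟨k0, h2, -⟩ := sqrt_div_rpow_quarter hS.one_le_K
  have h1 := hS.eta_pos hd ht
  have hL := hS.one_le_L
  have h3 := hS.lam_pos
  have hd0 : (0 : ℝ) < d := by exact_mod_cast hd
  have ht0 : (0 : ℝ) < t := by exact_mod_cast ht
  have h4 : S.eta t ^ 2 ≤ √K / (d * t) := by
    calc S.eta t ^ 2 ≤ ((K : ℝ) ^ (1 / 4 : ℝ) / √((d : ℝ) * t)) ^ 2 := by
          gcongr; exact min_le_left _ _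
      _ = √K / (d * t) := by rw [div_pow, h2, Real.sq_sqrt (by positivity)]
  unfold Setting.gamma
  calc _ ≤ 128 * S.L * (√K / (d * t)) / S.lam := by gcongr
    _ = _ := by field_simp

/-- The additive 1 in the harmonic bound is at most (3/2) log T because T ≥ 2. -/
theorem sum_inv_le_log {T : ℕ} (hT : 2 ≤ T) :
    ∑ t ∈ Finset.Icc 1 T, 1 / (t : ℝ) ≤ 5 / 2 * Real.log T := by
  have h1 := harmonic_le_one_add_log T
  rw [harmonic_eq_sum_Icc] at h1
  push_cast at h1
  simp_rw [one_div]
  have h2 : Real.log 2 ≤ Real.log T := Real.log_le_log (by norm_num) (by exact_mod_cast hT)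
  have := Real.log_two_gt_d9
  linarith

theorem Setting.Assumptions.sum_gamma_le (hS : S.Assumptions) (hd : 1 ≤ d) {T : ℕ} (hT : 2 ≤ T) :
    ∑ t ∈ Finset.Icc 1 T, S.gamma t ≤ 320 * (√K * S.L / (S.lam * d) * Real.log T) := by
  have hL := hS.one_le_L
  have h3 := hS.lam_pos
  calc _ ≤ ∑ t ∈ Finset.Icc 1 T, 128 * (√K * S.L / (S.lam * d)) * (1 / (t : ℝ)) :=
        Finset.sum_le_sum fun t ht => hS.gamma_le hd (Finset.mem_Icc.1 ht).1
    _ ≤ 128 * (√K * S.L / (S.lam * d)) * (5 / 2 * Real.log T) := by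
        rw [← Finset.mul_sum]
        gcongr
        exact sum_inv_le_log hT
    _ = _ := by ring

section Kappa

variable [MeasurableSingletonClass 𝒳]

theorem Setting.Assumptions.lam_le_one (hS : S.Assumptions) (hd : 1 ≤ d) : S.lam ≤ 1 := by
  have h1 := hS.dim_le
  have h2 : (1 : ℝ) ≤ 1 / S.lam := le_trans (by exact_mod_cast hd) h1
  rwa [le_div_iff₀ hS.lam_pos, one_mul] at h2

theorem Setting.Assumptions.one_le_sqrt (hS : S.Assumptions) (hd : 1 ≤ d) :
    1 ≤ √(K * S.L / S.lam) := by
  have hK : (1 : ℝ) ≤ K := by exact_mod_cast hS.one_le_K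
  rw [Real.one_le_sqrt, le_div_iff₀ hS.lam_pos]
  nlinarith [hS.one_le_L, hS.lam_le_one hd]

theorem Setting.Assumptions.sqrt_le (hS : S.Assumptions) :
    √(K / S.lam) ≤ √(K * S.L / S.lam) := by
  refine Real.sqrt_le_sqrt ?_
  have := hS.lam_pos
  gcongr
  exact le_mul_of_one_le_right (Nat.cast_nonneg K) hS.one_le_L

theorem Setting.Assumptions.sqrt_le_kappa (hS : S.Assumptions) {T : ℕ} (hT : 1 ≤ T) :
    √(K * S.L / S.lam) ≤ S.kappa T := by
  have hL := hS.one_le_L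
  have h3 := hS.lam_pos
  have := Real.log_nonneg (x := T) (by exact_mod_cast hT)
  unfold Setting.kappa
  have : 0 ≤ √K * S.L / (S.lam * d) * Real.log T := by positivity
  linarith

theorem Setting.Assumptions.invEta_one_mul_le (hS : S.Assumptions) (hd : 1 ≤ d) :
    S.invEta 1 * √K ≤ 17 * √(K * S.L / S.lam) := by
  obtain ⟨k0, h2, -⟩ := sqrt_div_rpow_quarter hS.one_le_K
  set k := (K : ℝ) ^ (1 / 4 : ℝ) with hk
  have hL := hS.one_le_L
  have h3 := hS.lam_pos
  have e1 : √(K * S.L / S.lam) = √K * √(S.L / S.lam) := by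
    rw [mul_div_assoc, Real.sqrt_mul (Nat.cast_nonneg K)]
  have hK : (1 : ℝ) ≤ K := by exact_mod_cast hS.one_le_K
  have hk1 : 1 ≤ k := Real.one_le_rpow hK (by norm_num)
  have h4 : √d ≤ √(S.L / S.lam) := Real.sqrt_le_sqrt (hS.dim_le.trans (by gcongr))
  rw [hS.invEta_eq_max hd le_rfl, ← hk, e1]
  have h5 : max (√d * √((1 : ℕ) : ℝ) / k) (16 * √(S.L / S.lam)) ≤ 17 * √(S.L / S.lam) := by
    refine max_le ?_ ?_
    · rw [div_le_iff₀ k0]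
      simp only [Nat.cast_one, Real.sqrt_one, mul_one]
      nlinarith [Real.sqrt_nonneg (S.L / S.lam)]
    · linarith [Real.sqrt_nonneg (S.L / S.lam)]
  nlinarith [Real.sqrt_nonneg (K : ℝ)]

/-- As √d ≤ √(L/λ), the first weight is at most 16√(L/λ), and 16²/128 = 2. -/
theorem Setting.Assumptions.inv_gamma_one_le (hS : S.Assumptions) (hd : 1 ≤ d) :
    1 / (S.gamma 1 * S.lam) ≤ 3 / S.lam := by
  obtain ⟨k0, h2, -⟩ := sqrt_div_rpow_quarter hS.one_le_K
  have hL := hS.one_le_L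
  have h3 := hS.lam_pos
  have hK : (1 : ℝ) ≤ K := by exact_mod_cast hS.one_le_K
  have hk1 : 1 ≤ (K : ℝ) ^ (1 / 4 : ℝ) := Real.one_le_rpow hK (by norm_num)
  have h4 : √d ≤ √(S.L / S.lam) := Real.sqrt_le_sqrt (hS.dim_le.trans (by gcongr))
  rw [hS.inv_gamma_mul_lam hd le_rfl, hS.invEta_eq_max hd le_rfl]
  have h5 : max (√d * √((1 : ℕ) : ℝ) / (K : ℝ) ^ (1 / 4 : ℝ)) (16 * √(S.L / S.lam)) ≤
      16 * √(S.L / S.lam) := by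
    refine max_le ?_ le_rfl
    rw [div_le_iff₀ k0]
    simp only [Nat.cast_one, Real.sqrt_one, mul_one]
    nlinarith [Real.sqrt_nonneg (S.L / S.lam)]
  calc _ ≤ (16 * √(S.L / S.lam)) ^ 2 / (128 * S.L) := by
        gcongr
    _ = 2 / S.lam := by
        rw [mul_pow, Real.sq_sqrt (by positivity)]; field_simp; norm_num
    _ ≤ 3 / S.lam := by gcongr; norm_num

end Kappa

end Rates

/-! ### The importance-weighted loss estimator -/

section Estimator

variable {Ω 𝒳 : Type*} [mΩ : MeasurableSpace Ω] [MeasurableSpace 𝒳] [Fintype 𝒳]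
  [MeasurableSingletonClass 𝒳] {K d : ℕ}

/-- By Cramer's rule the form is the inverse of the determinant times a continuous function of the
policy. -/
theorem Setting.measurable_invForm (S : Setting 𝒳 K d) (z z' : Fin d → ℝ) :
    Measurable fun p : 𝒳 → Fin K → ℝ => S.invForm p z z' := by
  have hcov : Continuous fun p : 𝒳 → Fin K → ℝ => S.covariance p := by
    unfold Setting.covariance
    fun_prop
  have hdet : Measurable fun p : 𝒳 → Fin K → ℝ => ((S.covariance p).det)⁻¹ :=
    hcov.matrix_det.measurable.inv
  have hadj : Measurable fun p : 𝒳 → Fin K → ℝ => z ⬝ᵥ ((S.covariance p).adjugate *ᵥ z') :=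
    (continuous_const.dotProduct (hcov.matrix_adjugate.matrix_mulVec continuous_const)).measurable
  have : (fun p : 𝒳 → Fin K → ℝ => S.invForm p z z') = fun p =>
      ((S.covariance p).det)⁻¹ * (z ⬝ᵥ ((S.covariance p).adjugate *ᵥ z')) := by
    ext p
    rw [Setting.invForm, Matrix.inv_def, Ring.inverse_eq_inv', smul_mulVec, dotProduct_smul,
      smul_eq_mul]
  rw [this]
  exact hdet.mul hadj

variable {P : Play Ω 𝒳 K d} {S : Setting 𝒳 K d} {μ : Measure Ω} [IsProbabilityMeasure μ]
  {ℱ : Filtration ℕ mΩ} {T t : ℕ}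

theorem Play.IsTsallisINF.explores (hA : P.IsTsallisINF S ℱ T) (hS : S.Assumptions) (hd : 1 ≤ d)
    (h1 : 1 ≤ t) (h2 : t ≤ T) (ω : Ω) : S.Explores (S.gamma t) (P.policy S t ω) := by
  refine ⟨hS.gamma_pos hd h1, fun x a => ?_⟩
  have := S.gamma_mem hS t
  exact le_add_of_nonneg_left (mul_nonneg (by linarith) ((hA.q_mem t h1 h2 ω x).1 a))

theorem Play.IsTsallisINF.q_le_policy (hA : P.IsTsallisINF S ℱ T) (hS : S.Assumptions)
    (h1 : 1 ≤ t) (h2 : t ≤ T) (ω : Ω) (x : 𝒳) (a : Fin K) :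
    P.q t ω x a ≤ 2 * P.policy S t ω x a := by
  obtain ⟨g0, g1⟩ := S.gamma_mem hS t
  have e1 := (hA.q_mem t h1 h2 ω x).1 a
  have e2 := mul_nonneg g0 ((hS.e_mem x).1 a)
  unfold Play.policy
  nlinarith

theorem Play.lossHat_eq (P : Play Ω 𝒳 K d) (S : Setting 𝒳 K d) (t : ℕ) (ω : Ω) (x : 𝒳)
    (a : Fin K) : P.lossHat S t ω x a =
      S.invForm (P.policy S t ω) (S.φ a x) (S.φ (P.A t ω) (P.X t ω)) *
        P.loss S t ω (P.A t ω) (P.X t ω) := by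
  rw [Play.lossHat, Play.thetaHat, smul_dotProduct, smul_eq_mul, mul_comm, dotProduct_comm]
  rfl

theorem Play.IsTsallisINF.measurable_invForm (hA : P.IsTsallisINF S ℱ T)
    (h1 : 1 ≤ t) (h2 : t ≤ T) (z z' : Fin d → ℝ) :
    Measurable[ℱ (t - 1)] fun ω => S.invForm (P.policy S t ω) z z' :=
  (S.measurable_invForm z z').comp (@measurable_pi_lambda _ _ _ (ℱ (t - 1)) _ _ fun x =>
    @measurable_pi_lambda _ _ _ (ℱ (t - 1)) _ _ fun a => hA.policy_measurable h1 h2 x a)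

theorem Setting.Explores.abs_invForm_le {g : ℝ} {p : 𝒳 → Fin K → ℝ} (hp : S.Explores g p)
    (hS : S.Assumptions) {z z' : Fin d → ℝ} (hz : z ∈ S.Z) (hz' : z' ∈ S.Z) :
    |S.invForm p z z'| ≤ 1 / (g * S.lam) := by
  have := hp.pos
  have := hS.lam_pos
  refine abs_le_of_sq_le_sq ?_ (by positivity)
  calc _ ≤ S.invForm p z z * S.invForm p z' z' := hp.invForm_sq_le hS z z'
    _ ≤ 1 / (g * S.lam) * (1 / (g * S.lam)) :=
        mul_le_mul (hp.invForm_le hS hz) (hp.invForm_le hS hz') (hp.invForm_nonneg hS z')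
          (by positivity)
    _ = _ := by ring

theorem Play.IsInteraction.measurable_eval (hP : P.IsInteraction S μ ℱ T)
    (h1 : 1 ≤ t) (h2 : t ≤ T) {H : Ω → 𝒳 → Fin K → ℝ}
    (hH : ∀ x a, Measurable fun ω => H ω x a) : Measurable fun ω => H ω (P.X t ω) (P.A t ω) :=
  measurable_at_context (f := fun ω a => H ω (P.X t ω) a)
    ((hP.A_measurable t h1 h2).mono (ℱ.le _) le_rfl) fun a =>
    measurable_at_context (f := fun ω x => H ω x a) (hP.measurable_X h1 h2) fun x => hH x a

theorem Play.IsInteraction.measurable_lossHat (hP : P.IsInteraction S μ ℱ T)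
    (hA : P.IsTsallisINF S ℱ T) (h1 : 1 ≤ t) (h2 : t ≤ T) (x : 𝒳) (a : Fin K) :
    Measurable fun ω => P.lossHat S t ω x a := by
  simp_rw [P.lossHat_eq]
  refine (hP.measurable_eval h1 h2
    (H := fun ω y b => S.invForm (P.policy S t ω) (S.φ a x) (S.φ b y)) fun y b => ?_).mul
    ((hP.loss_measurable t h1 h2).mono (ℱ.le _) le_rfl)
  exact (hA.measurable_invForm h1 h2 _ _).mono (ℱ.le _) le_rfl

theorem Play.IsInteraction.abs_lossHat_le (hP : P.IsInteraction S μ ℱ T)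
    (hA : P.IsTsallisINF S ℱ T) (hS : S.Assumptions) (hd : 1 ≤ d) (h1 : 1 ≤ t) (h2 : t ≤ T) :
    ∀ᵐ ω ∂μ, ∀ x a, |P.lossHat S t ω x a| ≤ 1 / (S.gamma t * S.lam) := by
  filter_upwards [hP.loss_bounded t h1 h2] with ω hω x a
  rw [P.lossHat_eq, abs_mul]
  calc _ ≤ |S.invForm (P.policy S t ω) (S.φ a x) (S.φ (P.A t ω) (P.X t ω))| * 1 := by
        gcongr; exact hω _ _
    _ ≤ _ := by
        rw [mul_one]
        exact (hA.explores hS hd h1 h2 ω).abs_invForm_le hS (hS.φ_mem _ _) (hS.φ_mem _ _)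

/-- The loss estimator is conditionally unbiased. -/
theorem Play.IsInteraction.integral_mul_lossHat (hP : P.IsInteraction S μ ℱ T)
    (hA : P.IsTsallisINF S ℱ T) (hS : S.Assumptions) (hd : 1 ≤ d) (h1 : 1 ≤ t) (h2 : t ≤ T)
    {f : Ω → ℝ} (hf : Measurable[ℱ (t - 1)] f) {c : ℝ} (hc : ∀ ω, |f ω| ≤ c) (x : 𝒳)
    (a : Fin K) : Integrable (fun ω => f ω * P.lossHat S t ω x a) μ ∧
      ∫ ω, f ω * P.lossHat S t ω x a ∂μ = ∫ ω, f ω * (S.φ a x ⬝ᵥ P.θ t ω) ∂μ := by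
  have hc0 : ∀ ω : Ω, 0 ≤ c := fun ω => (abs_nonneg _).trans (hc ω)
  have hmeas : Measurable fun ω => f ω * P.lossHat S t ω x a :=
    (hf.mono (ℱ.le _) le_rfl).mul (hP.measurable_lossHat hA h1 h2 x a)
  constructor
  · refine Integrable.of_bound (C := c * (1 / (S.gamma t * S.lam))) hmeas.aestronglyMeasurable ?_
    filter_upwards [hP.abs_lossHat_le hA hS hd h1 h2] with ω hω
    rw [Real.norm_eq_abs, abs_mul]
    exact mul_le_mul (hc ω) (hω x a) (abs_nonneg _) (hc0 ω)
  · have h := hP.integral_context_arm_loss hA hS h1 h2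
      (H := fun ω y b => f ω * S.invForm (P.policy S t ω) (S.φ a x) (S.φ b y))
      (c := c * (1 / (S.gamma t * S.lam)))
      (fun y b => hf.mul (hA.measurable_invForm h1 h2 _ _)) (fun ω y b => by
        rw [abs_mul]
        exact mul_le_mul (hc ω) ((hA.explores hS hd h1 h2 ω).abs_invForm_le hS (hS.φ_mem _ _)
          (hS.φ_mem _ _)) (abs_nonneg _) (hc0 ω))
    simp_rw [P.lossHat_eq, ← mul_assoc]
    rw [h]
    refine integral_congr_ae (Filter.Eventually.of_forall fun ω => ?_)
    simp only
    rw [← (hA.explores hS hd h1 h2 ω).sum_invForm_mul hS (S.φ a x) (P.θ t ω), Finset.mul_sum]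
    refine Finset.sum_congr rfl fun y _ => ?_
    rw [mul_left_comm]
    congr 1
    rw [Finset.mul_sum]
    exact Finset.sum_congr rfl fun b _ => by ring

/-- Conditional second moment of the loss estimator. -/
theorem Play.IsInteraction.integral_mul_lossHat_sq (hP : P.IsInteraction S μ ℱ T)
    (hA : P.IsTsallisINF S ℱ T) (hS : S.Assumptions) (hd : 1 ≤ d) (h1 : 1 ≤ t) (h2 : t ≤ T)
    {f : Ω → ℝ} (hf : Measurable[ℱ (t - 1)] f) (hf0 : ∀ ω, 0 ≤ f ω) {c : ℝ} (hc : ∀ ω, f ω ≤ c)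
    (x : 𝒳) (a : Fin K) : Integrable (fun ω => f ω * P.lossHat S t ω x a ^ 2) μ ∧
      ∫ ω, f ω * P.lossHat S t ω x a ^ 2 ∂μ ≤
        ∫ ω, f ω * S.invForm (P.policy S t ω) (S.φ a x) (S.φ a x) ∂μ := by
  have hc0 : ∀ ω : Ω, 0 ≤ c := fun ω => (hf0 ω).trans (hc ω)
  have hlam := hS.lam_pos
  have hg := hS.gamma_pos hd h1
  set B := 1 / (S.gamma t * S.lam) with hB
  have hB0 : 0 ≤ B := by positivity
  have hmeas : Measurable fun ω => f ω * P.lossHat S t ω x a ^ 2 :=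
    (hf.mono (ℱ.le _) le_rfl).mul ((hP.measurable_lossHat hA h1 h2 x a).pow_const 2)
  have hint : Integrable (fun ω => f ω * P.lossHat S t ω x a ^ 2) μ := by
    refine Integrable.of_bound (C := c * B ^ 2) hmeas.aestronglyMeasurable ?_
    filter_upwards [hP.abs_lossHat_le hA hS hd h1 h2] with ω hω
    rw [Real.norm_eq_abs, abs_mul, abs_of_nonneg (hf0 ω), abs_of_nonneg (sq_nonneg _)]
    exact mul_le_mul (hc ω) (sq_le_sq.2 ((hω x a).trans (le_abs_self _))) (sq_nonneg _) (hc0 ω)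
  refine ⟨hint, ?_⟩
  have hHm : ∀ y b, Measurable[ℱ (t - 1)] fun ω =>
      f ω * S.invForm (P.policy S t ω) (S.φ a x) (S.φ b y) ^ 2 := fun y b =>
    hf.mul ((hA.measurable_invForm h1 h2 _ _).pow_const 2)
  have hHc : ∀ ω y b, |f ω * S.invForm (P.policy S t ω) (S.φ a x) (S.φ b y) ^ 2| ≤ c * B ^ 2 := by
    intro ω y b
    rw [abs_mul, abs_of_nonneg (hf0 ω), abs_of_nonneg (sq_nonneg _)]
    exact mul_le_mul (hc ω) (sq_le_sq.2 (((hA.explores hS hd h1 h2 ω).abs_invForm_le hS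
      (hS.φ_mem _ _) (hS.φ_mem _ _)).trans (le_abs_self _))) (sq_nonneg _) (hc0 ω)
  have h := hP.integral_context_arm hA hS h1 h2 hHm hHc
  calc ∫ ω, f ω * P.lossHat S t ω x a ^ 2 ∂μ
      ≤ ∫ ω, f ω * S.invForm (P.policy S t ω) (S.φ a x)
          (S.φ (P.A t ω) (P.X t ω)) ^ 2 ∂μ := by
        refine integral_mono_ae hint ?_ ?_
        · refine Integrable.of_bound (C := c * B ^ 2) (hP.measurable_eval h1 h2
            (H := fun ω y b => f ω * S.invForm (P.policy S t ω) (S.φ a x) (S.φ b y) ^ 2)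
            fun y b => (hHm y b).mono (ℱ.le _) le_rfl).aestronglyMeasurable
            (Filter.Eventually.of_forall fun ω => hHc ω _ _)
        · filter_upwards [hP.loss_bounded t h1 h2] with ω hω
          rw [P.lossHat_eq, mul_pow]
          have e1 : P.loss S t ω (P.A t ω) (P.X t ω) ^ 2 ≤ 1 := by
            rw [sq_le_one_iff_abs_le_one]; exact hω _ _
          exact mul_le_mul_of_nonneg_left (mul_le_of_le_one_right (sq_nonneg _) e1) (hf0 ω)
    _ = _ := by
        rw [h]
        refine integral_congr_ae (Filter.Eventually.of_forall fun ω => ?_)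
        simp only
        rw [← (hA.explores hS hd h1 h2 ω).sum_invForm_sq hS (S.φ a x), Finset.mul_sum]
        refine Finset.sum_congr rfl fun y _ => ?_
        rw [mul_left_comm]
        congr 1
        rw [Finset.mul_sum]
        exact Finset.sum_congr rfl fun b _ => by ring

/-- The loss estimator is small on the scale at which the regularizer is stable. -/
theorem Play.IsInteraction.sqrt_mul_abs_lossHat_le (hP : P.IsInteraction S μ ℱ T)
    (hA : P.IsTsallisINF S ℱ T) (hS : S.Assumptions) (hd : 1 ≤ d) (h1 : 2 ≤ t) (h2 : t ≤ T) :
    ∀ᵐ ω ∂μ, ∀ x a, √(P.q t ω x a) * |P.lossHat S t ω x a| ≤ S.invEta (t - 1) / 4 := by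
  filter_upwards [hP.loss_bounded t (by omega) h2] with ω hω x a
  have hE := hA.explores hS hd (by omega) h2 ω
  have hL := hS.one_le_L
  have hη := hS.invEta_pos hd (t := t) (by omega)
  have hη' := hS.invEta_pos hd (t := t - 1) (by omega)
  set z := S.φ a x
  set z' := S.φ (P.A t ω) (P.X t ω) with hz'
  set I := S.invForm (P.policy S t ω) with hI
  have e1 : |P.lossHat S t ω x a| ≤ |I z z'| := by
    rw [P.lossHat_eq, abs_mul]
    exact mul_le_of_le_one_right (abs_nonneg _) (hω _ _)
  have e2 : P.policy S t ω x a * I z z ≤ S.L := by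
    have h3 := hE.mass_mul_invForm_le hS x a
    have h4 := hS.mass_ge x
    have h5 : 0 ≤ P.policy S t ω x a * I z z :=
      mul_nonneg (hE.nonneg hS x a) (hE.invForm_nonneg hS z)
    have h6 : 1 / S.L * (P.policy S t ω x a * I z z) ≤ 1 := by
      refine le_trans (mul_le_mul_of_nonneg_right h4 h5) ?_
      rw [← mul_assoc]; exact h3
    rw [one_div, inv_mul_le_iff₀ (by linarith)] at h6
    linarith
  have e3 : I z' z' ≤ S.invEta t ^ 2 / (128 * S.L) := by
    rw [← hS.inv_gamma_mul_lam hd (by omega)]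
    exact hE.invForm_le hS (hS.φ_mem _ _)
  -- Cauchy–Schwarz separates the queried feature z, controlled by its own probability, from the
  -- observed one z', controlled by exploration. The factors 2, L and 1/(128L) multiply to 1/64.
  have e4 : P.q t ω x a * (I z z') ^ 2 ≤ (S.invEta t / 8) ^ 2 := by
    have hzz := hE.invForm_nonneg hS z
    have hzz' := hE.invForm_nonneg hS z'
    have hp := hE.nonneg hS x a
    calc P.q t ω x a * (I z z') ^ 2 ≤ (2 * P.policy S t ω x a) * (I z z * I z' z') :=
          mul_le_mul (hA.q_le_policy hS (by omega) h2 ω x a) (hE.invForm_sq_le hS z z')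
            (sq_nonneg _) (by positivity)
      _ = 2 * ((P.policy S t ω x a * I z z) * I z' z') := by ring
      _ ≤ 2 * (S.L * (S.invEta t ^ 2 / (128 * S.L))) := by
          gcongr
      _ = _ := by field_simp; norm_num
  have e5 : √(P.q t ω x a) * |I z z'| ≤ S.invEta t / 8 := by
    refine (le_abs_self _).trans (abs_le_of_sq_le_sq ?_ (by positivity))
    rw [mul_pow, Real.sq_sqrt ((hA.q_mem t (by omega) h2 ω x).1 a), sq_abs]
    exact e4
  have e6 := hS.invEta_le_prev hd h1
  have e7 : √2 ≤ 2 := by rw [Real.sqrt_le_left (by norm_num)]; norm_num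
  calc _ ≤ √(P.q t ω x a) * |I z z'| := by gcongr
    _ ≤ S.invEta t / 8 := e5
    _ ≤ (2 * S.invEta (t - 1)) / 8 := by
        gcongr
        exact e6.trans (by gcongr)
    _ = _ := by ring

end Estimator

/-! ### Pathwise regret, averaged over contexts -/

section Regret

variable {Ω 𝒳 : Type*} [mΩ : MeasurableSpace Ω] [MeasurableSpace 𝒳] [Fintype 𝒳]
  [MeasurableSingletonClass 𝒳] {K d : ℕ}

/-- The average probability, before exploration, of not following the policy `ρ`. -/
def Play.miss (P : Play Ω 𝒳 K d) (S : Setting 𝒳 K d) (ρ : 𝒳 → Fin K) (t : ℕ) (ω : Ω) : ℝ :=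
  ∑ x, S.G.real {x} * (1 - P.q t ω x (ρ x))

/-- A bound, uniform over contexts, on the root of the probability of not following `ρ`. -/
def Play.missRoot (P : Play Ω 𝒳 K d) (S : Setting 𝒳 K d) (ρ : 𝒳 → Fin K) (t : ℕ) (ω : Ω) : ℝ :=
  min 1 √(S.L * P.miss S ρ t ω)

variable {P : Play Ω 𝒳 K d} {S : Setting 𝒳 K d} {μ : Measure Ω} [IsProbabilityMeasure μ]
  {ℱ : Filtration ℕ mΩ} {T t : ℕ} {ρ : 𝒳 → Fin K}

theorem Play.IsTsallisINF.measurable_miss (hA : P.IsTsallisINF S ℱ T) (h1 : 1 ≤ t) (h2 : t ≤ T) :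
    Measurable[ℱ (t - 1)] fun ω => P.miss S ρ t ω :=
  Finset.measurable_fun_sum _ fun x _ => ((hA.q_measurable t h1 h2 x (ρ x)).const_sub 1).const_mul _

theorem Play.IsTsallisINF.measurable_missRoot (hA : P.IsTsallisINF S ℱ T)
    (h1 : 1 ≤ t) (h2 : t ≤ T) : Measurable[ℱ (t - 1)] fun ω => P.missRoot S ρ t ω :=
  measurable_const.min (((hA.measurable_miss h1 h2).const_mul _).sqrt)

theorem Play.IsTsallisINF.miss_mem (hA : P.IsTsallisINF S ℱ T) (hS : S.Assumptions)
    (h1 : 1 ≤ t) (h2 : t ≤ T) (ω : Ω) : 0 ≤ P.miss S ρ t ω ∧ P.miss S ρ t ω ≤ 1 := by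
  have h := fun x => hA.q_mem t h1 h2 ω x
  constructor
  · exact Finset.sum_nonneg fun x _ => mul_nonneg measureReal_nonneg
      (sub_nonneg.2 (le_one_of_mem_stdSimplex (h x) _))
  · rw [← hS.sum_mass]
    refine Finset.sum_le_sum fun x _ => mul_le_of_le_one_right measureReal_nonneg ?_
    linarith [(h x).1 (ρ x)]

theorem Play.missRoot_nonneg (P : Play Ω 𝒳 K d) (S : Setting 𝒳 K d) (ρ : 𝒳 → Fin K) (t : ℕ)
    (ω : Ω) : 0 ≤ P.missRoot S ρ t ω := le_min zero_le_one (Real.sqrt_nonneg _)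

theorem Play.missRoot_le_one (P : Play Ω 𝒳 K d) (S : Setting 𝒳 K d) (ρ : 𝒳 → Fin K) (t : ℕ)
    (ω : Ω) : P.missRoot S ρ t ω ≤ 1 := min_le_left _ _

/-- Each context has weight at least 1/L in the average `Play.miss`, so its own term is at most L
times that average. -/
theorem Play.IsTsallisINF.sqrt_one_sub_le (hA : P.IsTsallisINF S ℱ T) (hS : S.Assumptions)
    (h1 : 1 ≤ t) (h2 : t ≤ T) (ω : Ω) (x : 𝒳) :
    √(1 - P.q t ω x (ρ x)) ≤ P.missRoot S ρ t ω := by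
  have h := fun x => hA.q_mem t h1 h2 ω x
  have h0 := fun x => sub_nonneg.2 (le_one_of_mem_stdSimplex (h x) (ρ x))
  refine le_min (Real.sqrt_le_one.2 ?_) (Real.sqrt_le_sqrt ?_)
  · linarith [(h x).1 (ρ x)]
  · have hL := hS.one_le_L
    have e1 : S.G.real {x} * (1 - P.q t ω x (ρ x)) ≤ P.miss S ρ t ω :=
      Finset.single_le_sum (f := fun x => S.G.real {x} * (1 - P.q t ω x (ρ x)))
        (fun y _ => mul_nonneg measureReal_nonneg (h0 y)) (Finset.mem_univ x)
    have e2 : 1 / S.L * (1 - P.q t ω x (ρ x)) ≤ P.miss S ρ t ω :=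
      le_trans (mul_le_mul_of_nonneg_right (hS.mass_ge x) (h0 x)) e1
    rwa [one_div, inv_mul_le_iff₀ (by linarith)] at e2

theorem Play.IsInteraction.integral_sum_mul_lossHat (hP : P.IsInteraction S μ ℱ T)
    (hA : P.IsTsallisINF S ℱ T) (hS : S.Assumptions) (hd : 1 ≤ d) (h1 : 1 ≤ t) (h2 : t ≤ T)
    {f : Ω → 𝒳 → Fin K → ℝ} (hf : ∀ x a, Measurable[ℱ (t - 1)] fun ω => f ω x a) {c : ℝ}
    (hc : ∀ ω x a, |f ω x a| ≤ c) :
    Integrable (fun ω => ∑ x, ∑ a, f ω x a * P.lossHat S t ω x a) μ ∧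
      ∫ ω, ∑ x, ∑ a, f ω x a * P.lossHat S t ω x a ∂μ =
        ∫ ω, ∑ x, ∑ a, f ω x a * (S.φ a x ⬝ᵥ P.θ t ω) ∂μ := by
  have h := fun x a => hP.integral_mul_lossHat hA hS hd h1 h2 (hf x a) (fun ω => hc ω x a) x a
  have hi : ∀ x a, Integrable (fun ω => f ω x a * (S.φ a x ⬝ᵥ P.θ t ω)) μ := fun x a => by
    refine Integrable.of_bound (C := c * 1) (((hf x a).mul (hP.measurable_mean h1 h2 _)).mono
      (ℱ.le _) le_rfl).aestronglyMeasurable (Filter.Eventually.of_forall fun ω => ?_)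
    rw [Real.norm_eq_abs, abs_mul]
    exact mul_le_mul (hc ω x a) (hP.abs_mean_le hS h1 h2 ω a x) (abs_nonneg _)
      ((abs_nonneg _).trans (hc ω x a))
  refine ⟨integrable_finsetSum _ fun x _ => integrable_finsetSum _ fun a _ => (h x a).1, ?_⟩
  rw [integral_finsetSum _ fun x _ => integrable_finsetSum _ fun a _ => (h x a).1,
    integral_finsetSum _ fun x _ => integrable_finsetSum _ fun a _ => hi x a]
  refine Finset.sum_congr rfl fun x _ => ?_
  rw [integral_finsetSum _ fun a _ => (h x a).1, integral_finsetSum _ fun a _ => hi x a]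
  exact Finset.sum_congr rfl fun a _ => (h x a).2

theorem Play.IsInteraction.integral_sum_mul_lossHat_sq (hP : P.IsInteraction S μ ℱ T)
    (hA : P.IsTsallisINF S ℱ T) (hS : S.Assumptions) (hd : 1 ≤ d) (h1 : 1 ≤ t) (h2 : t ≤ T)
    {f : Ω → 𝒳 → Fin K → ℝ} (hf : ∀ x a, Measurable[ℱ (t - 1)] fun ω => f ω x a)
    (hf0 : ∀ ω x a, 0 ≤ f ω x a) {c : ℝ} (hc : ∀ ω x a, f ω x a ≤ c) :
    Integrable (fun ω => ∑ x, ∑ a, f ω x a * P.lossHat S t ω x a ^ 2) μ ∧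
      ∫ ω, ∑ x, ∑ a, f ω x a * P.lossHat S t ω x a ^ 2 ∂μ ≤
        ∫ ω, ∑ x, ∑ a, f ω x a * S.invForm (P.policy S t ω) (S.φ a x) (S.φ a x) ∂μ := by
  have h := fun x a => hP.integral_mul_lossHat_sq hA hS hd h1 h2 (hf x a) (fun ω => hf0 ω x a)
    (fun ω => hc ω x a) x a
  have hi : ∀ x a, Integrable
      (fun ω => f ω x a * S.invForm (P.policy S t ω) (S.φ a x) (S.φ a x)) μ := fun x a => by
    refine Integrable.of_bound (C := c * (1 / (S.gamma t * S.lam)))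
      (((hf x a).mul (hA.measurable_invForm h1 h2 _ _)).mono
      (ℱ.le _) le_rfl).aestronglyMeasurable (Filter.Eventually.of_forall fun ω => ?_)
    rw [Real.norm_eq_abs, abs_mul, abs_of_nonneg (hf0 ω x a)]
    exact mul_le_mul (hc ω x a) ((hA.explores hS hd h1 h2 ω).abs_invForm_le hS (hS.φ_mem _ _)
      (hS.φ_mem _ _)) (abs_nonneg _) ((hf0 ω x a).trans (hc ω x a))
  refine ⟨integrable_finsetSum _ fun x _ => integrable_finsetSum _ fun a _ => (h x a).1, ?_⟩
  rw [integral_finsetSum _ fun x _ => integrable_finsetSum _ fun a _ => (h x a).1,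
    integral_finsetSum _ fun x _ => integrable_finsetSum _ fun a _ => hi x a]
  refine Finset.sum_le_sum fun x _ => ?_
  rw [integral_finsetSum _ fun a _ => (h x a).1, integral_finsetSum _ fun a _ => hi x a]
  exact Finset.sum_le_sum fun a _ => (h x a).2

/-- The coefficients of the regret of `q_t` against `ρ`. -/
def Play.regretCoeff (P : Play Ω 𝒳 K d) (S : Setting 𝒳 K d) (ρ : 𝒳 → Fin K) (t : ℕ) (ω : Ω)
    (x : 𝒳) (a : Fin K) : ℝ :=
  S.G.real {x} * (P.q t ω x a - (Pi.single (ρ x) 1 : Fin K → ℝ) a)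

theorem Play.sum_regretCoeff_mul (P : Play Ω 𝒳 K d) (S : Setting 𝒳 K d) (ρ : 𝒳 → Fin K) (t : ℕ)
    (ω : Ω) (f : 𝒳 → Fin K → ℝ) :
    ∑ x, ∑ a, P.regretCoeff S ρ t ω x a * f x a =
      ∑ x, S.G.real {x} * (f x ⬝ᵥ P.q t ω x - f x (ρ x)) := by
  refine Finset.sum_congr rfl fun x _ => ?_
  have : f x (ρ x) = f x ⬝ᵥ (Pi.single (ρ x) 1 : Fin K → ℝ) := by simp
  rw [this, ← dotProduct_sub, dotProduct, Finset.mul_sum]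
  refine Finset.sum_congr rfl fun a _ => ?_
  simp only [Play.regretCoeff, Pi.sub_apply]
  ring

theorem Setting.Assumptions.mass_le_one (hS : S.Assumptions) (x : 𝒳) : S.G.real {x} ≤ 1 := by
  have := hS.prob
  exact measureReal_le_one

theorem Play.IsTsallisINF.abs_regretCoeff_le (hA : P.IsTsallisINF S ℱ T) (hS : S.Assumptions)
    (h1 : 1 ≤ t) (h2 : t ≤ T) (ω : Ω) (x : 𝒳) (a : Fin K) : |P.regretCoeff S ρ t ω x a| ≤ 1 := by
  have e1 := (hA.q_mem t h1 h2 ω x).1 a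
  have e2 := le_one_of_mem_stdSimplex (hA.q_mem t h1 h2 ω x) a
  have e3 : 0 ≤ (Pi.single (ρ x) 1 : Fin K → ℝ) a ∧ (Pi.single (ρ x) 1 : Fin K → ℝ) a ≤ 1 := by
    rw [Pi.single_apply]; split_ifs <;> simp
  rw [Play.regretCoeff, abs_mul, abs_of_nonneg measureReal_nonneg]
  refine mul_le_one₀ (hS.mass_le_one x) (abs_nonneg _) (abs_le.2 ⟨?_, ?_⟩) <;> linarith

theorem Play.IsTsallisINF.measurable_regretCoeff (hA : P.IsTsallisINF S ℱ T)
    (h1 : 1 ≤ t) (h2 : t ≤ T) (x : 𝒳) (a : Fin K) :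
    Measurable[ℱ (t - 1)] fun ω => P.regretCoeff S ρ t ω x a :=
  ((hA.q_measurable t h1 h2 x a).sub_const _).const_mul _

/-- The regret of the distributions `q_t` along a realization of the interaction. -/
theorem Play.IsInteraction.sum_regretCoeff_mul_lossHat_le (hP : P.IsInteraction S μ ℱ T)
    (hA : P.IsTsallisINF S ℱ T) (hS : S.Assumptions) (hd : 1 ≤ d) (hT : 2 ≤ T) {s : ℝ}
    (hs : 0 < s) : ∀ᵐ ω ∂μ,
    ∑ t ∈ Finset.Icc 1 T, ∑ x, ∑ a, P.regretCoeff S ρ t ω x a * P.lossHat S t ω x a ≤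
      (∑ x, ∑ a, S.G.real {x} * P.q 1 ω x a * P.lossHat S 1 ω x a) +
      (s / 2 + ∑ x, ∑ a, S.G.real {x} / (2 * s) * P.lossHat S 1 ω x a ^ 2) +
      2 * (S.invEta 1 * √K) +
      ∑ t ∈ Finset.Icc 2 T, ∑ x, ∑ a, 4 / S.invEta (t - 1) * P.missRoot S ρ t ω *
        (S.G.real {x} * P.q t ω x a) * P.lossHat S t ω x a ^ 2 +
      ∑ t ∈ Finset.Icc 3 T, 4 * √(d * √K / t) * P.missRoot S ρ t ω := by
  have hsm : ∀ᵐ ω ∂μ, ∀ t, 2 ≤ t → t ≤ T → ∀ x a,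
      √(P.q t ω x a) * |P.lossHat S t ω x a| ≤ S.invEta (t - 1) / 4 := by
    rw [ae_all_iff]
    intro t
    by_cases h : 2 ≤ t ∧ t ≤ T
    · filter_upwards [hP.sqrt_mul_abs_lossHat_le hA hS hd h.1 h.2] with ω hω _ _ using hω
    · exact Filter.Eventually.of_forall fun ω h1 h2 => absurd ⟨h1, h2⟩ h
  filter_upwards [hsm] with ω hω
  have hη := fun t (ht : 1 ≤ t) => hS.invEta_pos hd ht
  have hper : ∀ x, ∑ t ∈ Finset.Icc 1 T,
      (P.lossHat S t ω x ⬝ᵥ P.q t ω x - P.lossHat S t ω x (ρ x)) ≤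
      P.lossHat S 1 ω x ⬝ᵥ P.q 1 ω x + (s / 2 + ∑ a, 1 / (2 * s) * P.lossHat S 1 ω x a ^ 2) +
      2 * (S.invEta 1 * √K) +
      ∑ t ∈ Finset.Icc 2 T, 4 / S.invEta (t - 1) * P.missRoot S ρ t ω *
        ∑ a, P.q t ω x a * P.lossHat S t ω x a ^ 2 +
      ∑ t ∈ Finset.Icc 3 T, 4 * √(d * √K / t) * P.missRoot S ρ t ω := by
    intro x
    have h := ftrl_regret hT (β := S.invEta) hη (l := fun t => P.lossHat S t ω x)
      (q := fun t => P.q t ω x) (fun t h1 h2 => hA.q_mem t h1 h2 ω x)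
      (fun t h1 h2 => hA.q_min t h1 h2 ω x) (fun t h1 h2 => hω t h1 h2 x) (ρ x)
    refine h.trans ?_
    have hq2 := hA.q_mem 2 (by omega) hT ω x
    -- The distribution q 2 depends on the first loss estimate, so unbiasedness does not apply.
    -- Young's inequality with parameter s leaves a second moment over all arms, free of q 2.
    have g1 : -(P.lossHat S 1 ω x ⬝ᵥ P.q 2 ω x) ≤
        s / 2 + ∑ a, 1 / (2 * s) * P.lossHat S 1 ω x a ^ 2 := by
      have e : s / 2 = ∑ a, P.q 2 ω x a * (s / 2) := by
        rw [← Finset.sum_mul, hq2.2, one_mul]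
      rw [e, ← Finset.sum_add_distrib, dotProduct, ← Finset.sum_neg_distrib]
      refine Finset.sum_le_sum fun a _ => ?_
      set l := P.lossHat S 1 ω x a
      have q0 := hq2.1 a
      have q1 := le_one_of_mem_stdSimplex hq2 a
      have e1 : -l ≤ s / 2 + 1 / (2 * s) * l ^ 2 := by
        have : 0 ≤ 1 / (2 * s) * (s + l) ^ 2 := by positivity
        have e2 : 1 / (2 * s) * (s + l) ^ 2 = s / 2 + 1 / (2 * s) * l ^ 2 + l := by
          field_simp; ring
        linarith
      have e3 : 0 ≤ 1 / (2 * s) * l ^ 2 := by positivity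
      nlinarith
    have g2 : S.invEta 1 * -tsallis (1 / 2) (P.q 2 ω x) ≤ 2 * (S.invEta 1 * √K) := by
      have e1 := neg_tsallis_half_le hq2 (ρ x)
      have e2 : √(1 - P.q 2 ω x (ρ x)) ≤ 1 := by
        rw [Real.sqrt_le_one]
        linarith [hq2.1 (ρ x)]
      have e3 : -tsallis (1 / 2) (P.q 2 ω x) ≤ 2 * √K := by
        refine e1.trans (mul_le_of_le_one_right (by positivity) e2)
      have := mul_le_mul_of_nonneg_left e3 (hη 1 le_rfl).le
      linarith
    have g3 : ∑ t ∈ Finset.Icc 2 T, 4 / S.invEta (t - 1) * √(1 - P.q t ω x (ρ x)) *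
        ∑ a, P.q t ω x a * P.lossHat S t ω x a ^ 2 ≤
        ∑ t ∈ Finset.Icc 2 T, 4 / S.invEta (t - 1) * P.missRoot S ρ t ω *
        ∑ a, P.q t ω x a * P.lossHat S t ω x a ^ 2 := by
      refine Finset.sum_le_sum fun t ht => ?_
      obtain ⟨h1, h2⟩ := Finset.mem_Icc.1 ht
      have := hη (t - 1) (by omega)
      have hqt := hA.q_mem t (by omega) h2 ω x
      have := hA.sqrt_one_sub_le hS (by omega) h2 ω x (ρ := ρ)
      have h3 : 0 ≤ ∑ a, P.q t ω x a * P.lossHat S t ω x a ^ 2 :=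
        Finset.sum_nonneg fun a _ => mul_nonneg (hqt.1 a) (sq_nonneg _)
      gcongr
    have g4 : ∑ t ∈ Finset.Icc 3 T, (S.invEta (t - 1) - S.invEta (t - 2)) *
        -tsallis (1 / 2) (P.q t ω x) ≤
        ∑ t ∈ Finset.Icc 3 T, 4 * √(d * √K / t) * P.missRoot S ρ t ω := by
      refine Finset.sum_le_sum fun t ht => ?_
      obtain ⟨h1, h2⟩ := Finset.mem_Icc.1 ht
      obtain ⟨d0, d1⟩ := hS.invEta_sub_le hd h1
      have e1 := neg_tsallis_half_le (hA.q_mem t (by omega) h2 ω x) (ρ x)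
      have e2 := hA.sqrt_one_sub_le hS (by omega) h2 ω x (ρ := ρ)
      have e3 := P.missRoot_nonneg S ρ t ω
      calc _ ≤ (S.invEta (t - 1) - S.invEta (t - 2)) * (2 * √K * P.missRoot S ρ t ω) := by
            refine mul_le_mul_of_nonneg_left (e1.trans ?_) d0
            gcongr
        _ = 2 * ((S.invEta (t - 1) - S.invEta (t - 2)) * √K) * P.missRoot S ρ t ω := by ring
        _ ≤ 2 * (2 * √(d * √K / t)) * P.missRoot S ρ t ω := by gcongr
        _ = _ := by ring
    linarith
  -- Average the per-context bounds under G. As `Play.missRoot` is the same for all x, it survives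
  -- as a common factor.
  have hsum := Finset.sum_le_sum fun x (_ : x ∈ Finset.univ) =>
    mul_le_mul_of_nonneg_left (hper x) (measureReal_nonneg (μ := S.G) (s := {x}))
  have el : ∑ t ∈ Finset.Icc 1 T, ∑ x, ∑ a, P.regretCoeff S ρ t ω x a * P.lossHat S t ω x a =
      ∑ x, S.G.real {x} * ∑ t ∈ Finset.Icc 1 T,
      (P.lossHat S t ω x ⬝ᵥ P.q t ω x - P.lossHat S t ω x (ρ x)) := by
    simp_rw [P.sum_regretCoeff_mul S ρ _ ω (fun x a => P.lossHat S _ ω x a)]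
    rw [Finset.sum_comm]
    simp_rw [Finset.mul_sum]
  rw [el]
  refine hsum.trans_eq ?_
  simp only [mul_add, Finset.sum_add_distrib, ← Finset.sum_mul, hS.sum_mass, one_mul]
  congr 1
  congr 1
  · congr 1
    congr 1
    · refine Finset.sum_congr rfl fun x _ => ?_
      rw [dotProduct, Finset.mul_sum]
      exact Finset.sum_congr rfl fun a _ => by ring
    · congr 1
      refine Finset.sum_congr rfl fun x _ => ?_
      rw [Finset.mul_sum]
      exact Finset.sum_congr rfl fun a _ => by ring
  · simp_rw [Finset.mul_sum]
    rw [Finset.sum_comm]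
    refine Finset.sum_congr rfl fun t _ => Finset.sum_congr rfl fun x _ =>
      Finset.sum_congr rfl fun a _ => by ring

end Regret

/-! ### Expected regret and the self-bounding constraint -/

section Expectation

variable {Ω 𝒳 : Type*} [mΩ : MeasurableSpace Ω] [MeasurableSpace 𝒳] [Fintype 𝒳]
  [MeasurableSingletonClass 𝒳] {K d : ℕ}
  {P : Play Ω 𝒳 K d} {S : Setting 𝒳 K d} {μ : Measure Ω} [IsProbabilityMeasure μ]
  {ℱ : Filtration ℕ mΩ} {T t : ℕ} {ρ : 𝒳 → Fin K}

theorem Play.IsTsallisINF.integrable_missRoot (hA : P.IsTsallisINF S ℱ T)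
    (h1 : 1 ≤ t) (h2 : t ≤ T) : Integrable (fun ω => P.missRoot S ρ t ω) μ :=
  Integrable.of_bound ((hA.measurable_missRoot h1 h2).mono (ℱ.le _) le_rfl).aestronglyMeasurable 1
    (Filter.Eventually.of_forall fun ω => by
      rw [Real.norm_eq_abs, abs_of_nonneg (P.missRoot_nonneg S ρ t ω)]
      exact P.missRoot_le_one S ρ t ω)

theorem Play.IsTsallisINF.integrable_miss (hA : P.IsTsallisINF S ℱ T) (hS : S.Assumptions)
    (h1 : 1 ≤ t) (h2 : t ≤ T) : Integrable (fun ω => P.miss S ρ t ω) μ :=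
  Integrable.of_bound ((hA.measurable_miss h1 h2).mono (ℱ.le _) le_rfl).aestronglyMeasurable 1
    (Filter.Eventually.of_forall fun ω => by
      have := hA.miss_mem hS h1 h2 ω (ρ := ρ)
      rw [Real.norm_eq_abs, abs_of_nonneg this.1]
      exact this.2)

theorem Play.IsInteraction.integrable_mean_sum (hP : P.IsInteraction S μ ℱ T)
    (hS : S.Assumptions) (h1 : 1 ≤ t) (h2 : t ≤ T)
    {f : Ω → 𝒳 → Fin K → ℝ} (hf : ∀ x a, Measurable[ℱ (t - 1)] fun ω => f ω x a) {c : ℝ}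
    (hc : ∀ ω x a, |f ω x a| ≤ c) :
    Integrable (fun ω => ∑ x, ∑ a, f ω x a * (S.φ a x ⬝ᵥ P.θ t ω)) μ := by
  refine integrable_finsetSum _ fun x _ => integrable_finsetSum _ fun a _ => ?_
  refine Integrable.of_bound (C := c * 1) (((hf x a).mul (hP.measurable_mean h1 h2 _)).mono
    (ℱ.le _) le_rfl).aestronglyMeasurable (Filter.Eventually.of_forall fun ω => ?_)
  rw [Real.norm_eq_abs, abs_mul]
  exact mul_le_mul (hc ω x a) (hP.abs_mean_le hS h1 h2 ω a x) (abs_nonneg _)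
    ((abs_nonneg _).trans (hc ω x a))

theorem Setting.Assumptions.mass_mul_mem {p : Fin K → ℝ} (hS : S.Assumptions)
    (hp : p ∈ stdSimplex ℝ (Fin K)) (x : 𝒳) (a : Fin K) :
    0 ≤ S.G.real {x} * p a ∧ S.G.real {x} * p a ≤ 1 :=
  ⟨mul_nonneg measureReal_nonneg (hp.1 a),
    mul_le_one₀ (hS.mass_le_one x) (hp.1 a) (le_one_of_mem_stdSimplex hp a)⟩

/-- `missRoot` is determined before round t and is uniform in x, so it factors out of the second
moment. What remains is at most 2d by q ≤ 2π and the trace identity. -/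
theorem Play.IsInteraction.integral_stability_le (hP : P.IsInteraction S μ ℱ T)
    (hA : P.IsTsallisINF S ℱ T) (hS : S.Assumptions) (hd : 1 ≤ d) (h1 : 2 ≤ t) (h2 : t ≤ T) :
    Integrable (fun ω => ∑ x, ∑ a, 4 / S.invEta (t - 1) * P.missRoot S ρ t ω *
      (S.G.real {x} * P.q t ω x a) * P.lossHat S t ω x a ^ 2) μ ∧
    ∫ ω, ∑ x, ∑ a, 4 / S.invEta (t - 1) * P.missRoot S ρ t ω *
      (S.G.real {x} * P.q t ω x a) * P.lossHat S t ω x a ^ 2 ∂μ ≤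
      16 * √(d * √K / t) * ∫ ω, P.missRoot S ρ t ω ∂μ := by
  have hη := hS.invEta_pos hd (t := t - 1) (by omega)
  have hmem := fun ω x a =>
    hS.mass_mul_mem (hA.q_mem t (by omega) h2 ω x) x a
  have hr0 := fun ω => P.missRoot_nonneg S ρ t ω
  have hr1 := fun ω => P.missRoot_le_one S ρ t ω
  have h := hP.integral_sum_mul_lossHat_sq hA hS hd (by omega) h2
    (f := fun ω x a => 4 / S.invEta (t - 1) * P.missRoot S ρ t ω *
      (S.G.real {x} * P.q t ω x a)) (c := 4 / S.invEta (t - 1))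
    (fun x a => ((hA.measurable_missRoot (by omega) h2).const_mul _).mul
      ((hA.q_measurable t (by omega) h2 x a).const_mul _))
    (fun ω x a => mul_nonneg (mul_nonneg (by positivity) (hr0 ω)) (hmem ω x a).1)
    (fun ω x a => by
      rw [mul_assoc]
      exact mul_le_of_le_one_right (by positivity)
        (mul_le_one₀ (hr1 ω) (hmem ω x a).1 (hmem ω x a).2))
  refine ⟨h.1, h.2.trans ?_⟩
  rw [← integral_const_mul]
  have hd' := hS.dim_div_invEta_le hd h1
  refine integral_mono_of_nonneg (Filter.Eventually.of_forall fun ω => ?_)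
    ((hA.integrable_missRoot (by omega) h2).const_mul _) (Filter.Eventually.of_forall fun ω => ?_)
  · have hE := hA.explores hS hd (by omega) h2 ω
    exact Finset.sum_nonneg fun x _ => Finset.sum_nonneg fun a _ => mul_nonneg
      (mul_nonneg (mul_nonneg (by positivity) (hr0 ω)) (hmem ω x a).1) (hE.invForm_nonneg hS _)
  · have hE := hA.explores hS hd (by omega) h2 ω
    have htr := hE.sum_invForm_self hS
    have h0 := hr0 ω
    calc ∑ x, ∑ a, 4 / S.invEta (t - 1) * P.missRoot S ρ t ω *
          (S.G.real {x} * P.q t ω x a) * S.invForm (P.policy S t ω) (S.φ a x) (S.φ a x)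
        ≤ ∑ x, ∑ a, 4 / S.invEta (t - 1) * P.missRoot S ρ t ω *
          (S.G.real {x} * (2 * P.policy S t ω x a)) *
            S.invForm (P.policy S t ω) (S.φ a x) (S.φ a x) := by
          gcongr with x _ a _
          · exact hE.invForm_nonneg hS _
          · exact hA.q_le_policy hS (by omega) h2 ω x a
      _ = 8 / S.invEta (t - 1) * P.missRoot S ρ t ω * ∑ x, S.G.real {x} *
          ∑ a, P.policy S t ω x a * S.invForm (P.policy S t ω) (S.φ a x) (S.φ a x) := by
          simp only [Finset.mul_sum]
          exact Finset.sum_congr rfl fun x _ => Finset.sum_congr rfl fun a _ => by ring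
      _ = 8 * (d / S.invEta (t - 1)) * P.missRoot S ρ t ω := by rw [htr]; ring
      _ ≤ 8 * (2 * √(d * √K / t)) * P.missRoot S ρ t ω := by gcongr
      _ = _ := by ring

/-- Expected regret of the distributions `q_t`. -/
theorem Play.IsInteraction.sum_integral_regretCoeff_le (hP : P.IsInteraction S μ ℱ T)
    (hA : P.IsTsallisINF S ℱ T) (hS : S.Assumptions) (hd : 1 ≤ d) (hT : 2 ≤ T) :
    ∑ t ∈ Finset.Icc 1 T, ∫ ω, ∑ x, ∑ a, P.regretCoeff S ρ t ω x a * (S.φ a x ⬝ᵥ P.θ t ω) ∂μ ≤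
      37 * √(K * S.L / S.lam) +
        20 * ∑ t ∈ Finset.Icc 2 T, √(d * √K / t) * ∫ ω, P.missRoot S ρ t ω ∂μ := by
  have hlam := hS.lam_pos
  have hK : (1 : ℝ) ≤ K := by exact_mod_cast hS.one_le_K
  -- Up to constants this balances s/2 against the first-round second moment K·(3/λ)/(2s).
  set s := √(K / S.lam) with hs
  have hs0 : 0 < s := Real.sqrt_pos.2 (by positivity)
  have hs2 : s ^ 2 = K / S.lam := Real.sq_sqrt (by positivity)
  have hmain := hP.sum_regretCoeff_mul_lossHat_le hA hS hd hT hs0 (ρ := ρ)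
  have hL := fun t (ht : t ∈ Finset.Icc 1 T) =>
    have h := Finset.mem_Icc.1 ht
    hP.integral_sum_mul_lossHat hA hS hd h.1 h.2
      (f := P.regretCoeff S ρ t) (hA.measurable_regretCoeff h.1 h.2)
      (hA.abs_regretCoeff_le hS h.1 h.2)
  have hT1 : 1 ≤ T := by omega
  have hmem := fun ω x a => hS.mass_mul_mem (hA.q_mem 1 le_rfl hT1 ω x) x a
  have hqm : ∀ x a, Measurable[ℱ (1 - 1)] fun ω => S.G.real {x} * P.q 1 ω x a := fun x a =>
    (hA.q_measurable 1 le_rfl hT1 x a).const_mul _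
  have hqc : ∀ ω x a, |S.G.real {x} * P.q 1 ω x a| ≤ 1 := fun ω x a => by
    rw [abs_of_nonneg (hmem ω x a).1]; exact (hmem ω x a).2
  have h1 := hP.integral_sum_mul_lossHat hA hS hd le_rfl hT1
    (f := fun ω x a => S.G.real {x} * P.q 1 ω x a) hqm hqc
  have h1' : ∫ ω, ∑ x, ∑ a, S.G.real {x} * P.q 1 ω x a * P.lossHat S 1 ω x a ∂μ ≤ 1 := by
    rw [h1.2]
    have e : ∫ ω, (1 : ℝ) ∂μ = 1 := by simp
    rw [← e]
    refine integral_mono (hP.integrable_mean_sum hS le_rfl hT1 hqm hqc) (integrable_const _)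
      fun ω => ?_
    calc _ ≤ ∑ x, ∑ a, S.G.real {x} * P.q 1 ω x a * 1 := by
          gcongr with x _ a _
          · exact (hmem ω x a).1
          · exact (le_abs_self _).trans (hP.abs_mean_le hS le_rfl hT1 ω a x)
      _ = 1 := by
          simp only [mul_one, ← Finset.mul_sum, (hA.q_mem 1 le_rfl hT1 ω _).2, hS.sum_mass]
  have h2 := hP.integral_sum_mul_lossHat_sq hA hS hd le_rfl hT1
    (f := fun _ x _ => S.G.real {x} / (2 * s)) (c := 1 / (2 * s)) (fun x a => measurable_const)
    (fun _ x _ => by have := measureReal_nonneg (μ := S.G) (s := {x}); positivity)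
    (fun ω x a => by gcongr; exact hS.mass_le_one x)
  have h2' : ∫ ω, ∑ x, ∑ a, S.G.real {x} / (2 * s) * P.lossHat S 1 ω x a ^ 2 ∂μ ≤ 3 / 2 * s := by
    refine h2.2.trans ?_
    have e : ∫ ω, 3 / 2 * s ∂μ = 3 / 2 * s := by simp
    rw [← e]
    refine integral_mono_of_nonneg (Filter.Eventually.of_forall fun ω => ?_) (integrable_const _)
      (Filter.Eventually.of_forall fun ω => ?_)
    · exact Finset.sum_nonneg fun x _ => Finset.sum_nonneg fun a _ => mul_nonneg (by positivity)
        ((hA.explores hS hd le_rfl hT1 ω).invForm_nonneg hS _)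
    · calc _ ≤ ∑ x, ∑ _a : Fin K, S.G.real {x} / (2 * s) * (3 / S.lam) := by
            refine Finset.sum_le_sum fun x _ => Finset.sum_le_sum fun a _ =>
              mul_le_mul_of_nonneg_left ?_ (by positivity)
            exact ((hA.explores hS hd le_rfl hT1 ω).invForm_le hS (hS.φ_mem a x)).trans
              (hS.inv_gamma_one_le hd)
        _ = K * (1 / (2 * s) * (3 / S.lam)) := by
            simp only [Finset.sum_const, Finset.card_univ, Fintype.card_fin, nsmul_eq_mul]
            rw [← Finset.mul_sum, ← Finset.sum_mul, ← Finset.sum_div, hS.sum_mass]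
        _ = 3 / 2 * s := by
            have : (K : ℝ) = s ^ 2 * S.lam := by rw [hs2]; field_simp
            rw [this]; field_simp
  have h3 := fun t (ht : t ∈ Finset.Icc 2 T) =>
    have h := Finset.mem_Icc.1 ht
    hP.integral_stability_le hA hS hd h.1 h.2 (ρ := ρ)
  have h4 := fun t (ht : t ∈ Finset.Icc 3 T) =>
    have h := Finset.mem_Icc.1 ht
    (hA.integrable_missRoot (μ := μ) (ρ := ρ) (t := t) (by omega) h.2).const_mul
      (4 * √(d * √K / t))
  have i1 := integrable_finsetSum _ fun t ht => (hL t ht).1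
  have i3 := integrable_finsetSum _ fun t ht => (h3 t ht).1
  have i4 := integrable_finsetSum _ h4
  have i2 := (integrable_const (μ := μ) (s / 2)).add h2.1
  have i5 := ((h1.1.add i2).add (integrable_const (μ := μ) (2 * (S.invEta 1 * √K))))
  have hint := integral_mono_ae i1 ((i5.add i3).add i4) hmain
  rw [integral_finsetSum _ fun t ht => (hL t ht).1, integral_add' (i5.add i3) i4,
    integral_add' i5 i3, integral_add' (h1.1.add i2) (integrable_const _), integral_add' h1.1 i2,
    integral_add' (integrable_const _) h2.1, integral_finsetSum _ fun t ht => (h3 t ht).1,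
    integral_finsetSum _ h4, Finset.sum_congr rfl fun t ht => (hL t ht).2] at hint
  simp only [integral_const, probReal_univ, smul_eq_mul, one_mul, integral_const_mul] at hint
  have h3' := (Finset.sum_le_sum fun t ht => (h3 t ht).2).trans_eq (show _ =
      16 * ∑ t ∈ Finset.Icc 2 T, √(d * √K / t) * ∫ ω, P.missRoot S ρ t ω ∂μ by
    simp only [mul_assoc, ← Finset.mul_sum])
  have h4' : ∑ t ∈ Finset.Icc 3 T, 4 * √(d * √K / t) * ∫ ω, P.missRoot S ρ t ω ∂μ ≤
      4 * ∑ t ∈ Finset.Icc 2 T, √(d * √K / t) * ∫ ω, P.missRoot S ρ t ω ∂μ := by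
    rw [Finset.mul_sum]
    simp only [← mul_assoc]
    refine Finset.sum_le_sum_of_subset_of_nonneg (Finset.Icc_subset_Icc_left (by norm_num))
      fun t _ _ => mul_nonneg (by positivity) (integral_nonneg fun ω => P.missRoot_nonneg S ρ t ω)
  have b1 := hS.one_le_sqrt hd
  have b2 : s ≤ √(K * S.L / S.lam) := hS.sqrt_le
  have b3 := hS.invEta_one_mul_le hd
  -- The constants are 37 = 1 + (1/2 + 3/2) + 2·17 and 20 = 16 + 4, from stability and penalty.
  linarith

theorem Play.IsInteraction.integrable_loss_arm (hP : P.IsInteraction S μ ℱ T)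
    (h1 : 1 ≤ t) (h2 : t ≤ T) :
    Integrable (fun ω => P.loss S t ω (P.A t ω) (P.X t ω)) μ :=
  Integrable.of_bound ((hP.loss_measurable t h1 h2).mono (ℱ.le _) le_rfl).aestronglyMeasurable 1
    ((hP.loss_bounded t h1 h2).mono fun _ h => h _ _)

theorem Play.IsInteraction.integrable_loss_policy (hP : P.IsInteraction S μ ℱ T)
    (h1 : 1 ≤ t) (h2 : t ≤ T) (ρ : 𝒳 → Fin K) :
    Integrable (fun ω => P.loss S t ω (ρ (P.X t ω)) (P.X t ω)) μ := by
  refine Integrable.of_bound (measurable_at_context (f := fun ω x => P.loss S t ω (ρ x) x)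
    (hP.measurable_X h1 h2) fun x => ?_).aestronglyMeasurable 1
    ((hP.loss_bounded t h1 h2).mono fun _ h => h _ _)
  exact ((hP.measurable_mean h1 h2 _).mono (ℱ.le _) le_rfl).add
    ((measurable_pi_apply _).comp (hP.ε_measurable t h1 h2))

theorem Play.IsInteraction.integrable_mean_policy (hP : P.IsInteraction S μ ℱ T)
    (hS : S.Assumptions) (h1 : 1 ≤ t) (h2 : t ≤ T) (ρ : 𝒳 → Fin K) :
    Integrable (fun ω => S.φ (ρ (P.X t ω)) (P.X t ω) ⬝ᵥ P.θ t ω) μ :=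
  Integrable.of_bound (measurable_at_context (f := fun ω x => S.φ (ρ x) x ⬝ᵥ P.θ t ω)
    (hP.measurable_X h1 h2) fun _ =>
      (hP.measurable_mean h1 h2 _).mono (ℱ.le _) le_rfl).aestronglyMeasurable 1
    (Filter.Eventually.of_forall fun ω => hP.abs_mean_le hS h1 h2 ω _ _)

/-- The regret is attained at an optimal policy. -/
theorem Play.IsInteraction.regret_le_sum (hP : P.IsInteraction S μ ℱ T) (hS : S.Assumptions)
    (hρ : P.IsOptimalPolicy S μ T ρ) : P.regret S μ T ≤ ∑ t ∈ Finset.Icc 1 T,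
      (∫ ω, P.loss S t ω (P.A t ω) (P.X t ω) ∂μ -
        ∫ ω, S.φ (ρ (P.X t ω)) (P.X t ω) ⬝ᵥ P.θ t ω ∂μ) := by
  have : Nonempty (𝒳 → Fin K) := ⟨ρ⟩
  refine ciSup_le fun ρ' => ?_
  have h := hρ ρ'
  have hi := fun (σ : 𝒳 → Fin K) t (ht : t ∈ Finset.Icc 1 T) =>
    hP.integrable_mean_policy hS (Finset.mem_Icc.1 ht).1 (Finset.mem_Icc.1 ht).2 σ
  rw [integral_finsetSum _ (hi ρ), integral_finsetSum _ (hi ρ')] at h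
  have ha := fun t (ht : t ∈ Finset.Icc 1 T) =>
    hP.integrable_loss_arm (Finset.mem_Icc.1 ht).1 (Finset.mem_Icc.1 ht).2
  have hl := fun t (ht : t ∈ Finset.Icc 1 T) =>
    hP.integrable_loss_policy (Finset.mem_Icc.1 ht).1 (Finset.mem_Icc.1 ht).2 ρ'
  have hal : ∀ t ∈ Finset.Icc 1 T, Integrable (fun ω => P.loss S t ω (P.A t ω) (P.X t ω) -
      P.loss S t ω (ρ' (P.X t ω)) (P.X t ω)) μ := fun t ht => (ha t ht).sub (hl t ht)
  rw [integral_finsetSum _ hal]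
  -- Optimality of ρ concerns mean losses, so the competitor's noise is averaged out before
  -- comparing.
  have e : ∀ t ∈ Finset.Icc 1 T, ∫ ω, (P.loss S t ω (P.A t ω) (P.X t ω) -
      P.loss S t ω (ρ' (P.X t ω)) (P.X t ω)) ∂μ = ∫ ω, P.loss S t ω (P.A t ω) (P.X t ω) ∂μ -
        ∫ ω, S.φ (ρ' (P.X t ω)) (P.X t ω) ⬝ᵥ P.θ t ω ∂μ := fun t ht => by
    rw [integral_sub (ha t ht) (hl t ht), hP.integral_loss_policy hS (Finset.mem_Icc.1 ht).1
      (Finset.mem_Icc.1 ht).2]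
  rw [Finset.sum_congr rfl e, Finset.sum_sub_distrib, Finset.sum_sub_distrib]
  linarith

theorem Play.IsInteraction.regret_le_two_mul (hP : P.IsInteraction S μ ℱ T) (hS : S.Assumptions)
    (hρ : P.IsOptimalPolicy S μ T ρ) : P.regret S μ T ≤ 2 * T := by
  refine (hP.regret_le_sum hS hρ).trans ?_
  have : ∀ t ∈ Finset.Icc 1 T, ∫ ω, P.loss S t ω (P.A t ω) (P.X t ω) ∂μ -
        ∫ ω, S.φ (ρ (P.X t ω)) (P.X t ω) ⬝ᵥ P.θ t ω ∂μ ≤ 2 := fun t ht => by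
    obtain ⟨h1, h2⟩ := Finset.mem_Icc.1 ht
    have e1 : ‖∫ ω, P.loss S t ω (P.A t ω) (P.X t ω) ∂μ‖ ≤ 1 * μ.real Set.univ :=
      norm_integral_le_of_norm_le_const ((hP.loss_bounded t h1 h2).mono fun _ h => h _ _)
    have e2 : ‖∫ ω, S.φ (ρ (P.X t ω)) (P.X t ω) ⬝ᵥ P.θ t ω ∂μ‖ ≤ 1 * μ.real Set.univ :=
      norm_integral_le_of_norm_le_const
        (Filter.Eventually.of_forall fun ω => hP.abs_mean_le hS h1 h2 ω _ _)
    rw [probReal_univ, Real.norm_eq_abs] at e1 e2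
    linarith [le_abs_self (∫ ω, P.loss S t ω (P.A t ω) (P.X t ω) ∂μ),
      neg_abs_le (∫ ω, S.φ (ρ (P.X t ω)) (P.X t ω) ⬝ᵥ P.θ t ω ∂μ)]
  refine (Finset.sum_le_sum this).trans ?_
  simp [mul_comm]

/-- Exploration costs at most twice its rate in each round. -/
theorem Play.IsInteraction.integral_loss_sub_le (hP : P.IsInteraction S μ ℱ T)
    (hA : P.IsTsallisINF S ℱ T) (hS : S.Assumptions) (h1 : 1 ≤ t) (h2 : t ≤ T) :
    ∫ ω, P.loss S t ω (P.A t ω) (P.X t ω) ∂μ -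
        ∫ ω, S.φ (ρ (P.X t ω)) (P.X t ω) ⬝ᵥ P.θ t ω ∂μ ≤
      ∫ ω, ∑ x, ∑ a, P.regretCoeff S ρ t ω x a * (S.φ a x ⬝ᵥ P.θ t ω) ∂μ + 2 * S.gamma t := by
  have e1 := hP.integral_context_arm_loss hA hS h1 h2 (H := fun _ _ _ => 1) (c := 1)
    (fun _ _ => measurable_const) (fun _ _ _ => by simp)
  simp only [one_mul] at e1
  have e2 := hP.integral_context h1 h2 (h := fun ω x => S.φ (ρ x) x ⬝ᵥ P.θ t ω) (c := 1)
    (fun x => hP.measurable_mean h1 h2 _) (fun ω x => hP.abs_mean_le hS h1 h2 ω _ _)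
  have hm1 : ∀ x a, Measurable[ℱ (t - 1)] fun ω => S.G.real {x} * P.policy S t ω x a := fun x a =>
    (hA.policy_measurable h1 h2 x a).const_mul _
  have i1 := hP.integrable_mean_sum hS h1 h2 hm1 (c := 1) (fun ω x a => by
    have := hS.mass_mul_mem (hA.policy_mem hS h1 h2 ω x) x a
    rw [abs_of_nonneg this.1]; exact this.2)
  have i2 : Integrable (fun ω => ∑ x, S.G.real {x} * (S.φ (ρ x) x ⬝ᵥ P.θ t ω)) μ :=
    integrable_finsetSum _ fun x _ => Integrable.const_mul (Integrable.of_bound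
      ((hP.measurable_mean h1 h2 _).mono (ℱ.le _) le_rfl).aestronglyMeasurable 1
      (Filter.Eventually.of_forall fun ω => hP.abs_mean_le hS h1 h2 ω _ _)) _
  have i3 := hP.integrable_mean_sum hS h1 h2 (hA.measurable_regretCoeff h1 h2 (ρ := ρ)) (c := 1)
    (hA.abs_regretCoeff_le hS h1 h2)
  have hcongr : ∀ ω, ∑ x, S.G.real {x} * ∑ a, P.policy S t ω x a * (S.φ a x ⬝ᵥ P.θ t ω) =
      ∑ x, ∑ a, S.G.real {x} * P.policy S t ω x a * (S.φ a x ⬝ᵥ P.θ t ω) := fun ω => by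
    simp only [Finset.mul_sum, mul_assoc]
  rw [e1, e2]
  simp_rw [hcongr]
  rw [← integral_sub i1 i2]
  have e3 : ∫ ω, 2 * S.gamma t ∂μ = 2 * S.gamma t := by simp
  rw [← e3, ← integral_add i3 (integrable_const _)]
  refine integral_mono (i1.sub i2) (i3.add (integrable_const _)) fun ω => ?_
  simp only
  rw [← hcongr, P.sum_regretCoeff_mul S ρ t ω fun x a => S.φ a x ⬝ᵥ P.θ t ω]
  have hx : ∀ x, ∑ a, P.policy S t ω x a * (S.φ a x ⬝ᵥ P.θ t ω) - S.φ (ρ x) x ⬝ᵥ P.θ t ω ≤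
      ((fun a => S.φ a x ⬝ᵥ P.θ t ω) ⬝ᵥ P.q t ω x - S.φ (ρ x) x ⬝ᵥ P.θ t ω) + 2 * S.gamma t := by
    intro x
    have b1 := abs_le.1 (abs_sum_mul_le_of_mem_stdSimplex (hA.q_mem t h1 h2 ω x)
      (f := fun a => S.φ a x ⬝ᵥ P.θ t ω) fun a => hP.abs_mean_le hS h1 h2 ω a x)
    have b2 := abs_le.1 (abs_sum_mul_le_of_mem_stdSimplex (hS.e_mem x)
      (f := fun a => S.φ a x ⬝ᵥ P.θ t ω) fun a => hP.abs_mean_le hS h1 h2 ω a x)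
    have e : ∑ a, P.policy S t ω x a * (S.φ a x ⬝ᵥ P.θ t ω) =
        (1 - S.gamma t) * ∑ a, P.q t ω x a * (S.φ a x ⬝ᵥ P.θ t ω) +
          S.gamma t * ∑ a, S.e x a * (S.φ a x ⬝ᵥ P.θ t ω) := by
      simp only [Finset.mul_sum, ← Finset.sum_add_distrib]
      exact Finset.sum_congr rfl fun a _ => by rw [Play.policy]; ring
    have e' : (fun a => S.φ a x ⬝ᵥ P.θ t ω) ⬝ᵥ P.q t ω x =
        ∑ a, P.q t ω x a * (S.φ a x ⬝ᵥ P.θ t ω) := by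
      simp only [dotProduct, mul_comm]
    rw [e, e']
    -- The policy differs from q by γ(e - q), and both mean losses lie in [-1, 1].
    have g0 := (S.gamma_mem hS t).1
    nlinarith
  calc _ = ∑ x, S.G.real {x} * (∑ a, P.policy S t ω x a * (S.φ a x ⬝ᵥ P.θ t ω) -
        S.φ (ρ x) x ⬝ᵥ P.θ t ω) := by
        rw [← Finset.sum_sub_distrib]
        exact Finset.sum_congr rfl fun x _ => by ring
    _ ≤ ∑ x, S.G.real {x} * (((fun a => S.φ a x ⬝ᵥ P.θ t ω) ⬝ᵥ P.q t ω x -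
        S.φ (ρ x) x ⬝ᵥ P.θ t ω) + 2 * S.gamma t) :=
        Finset.sum_le_sum fun x _ => mul_le_mul_of_nonneg_left (hx x) measureReal_nonneg
    _ = _ := by
        simp only [mul_add, Finset.sum_add_distrib, ← Finset.sum_mul, hS.sum_mass, one_mul]

/-- Regret in terms of the probabilities of deviating from an optimal policy. -/
theorem Play.IsInteraction.regret_le (hP : P.IsInteraction S μ ℱ T)
    (hA : P.IsTsallisINF S ℱ T) (hS : S.Assumptions) (hd : 1 ≤ d) (hT : 2 ≤ T)
    (hρ : P.IsOptimalPolicy S μ T ρ) : P.regret S μ T ≤ 640 * S.kappa T +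
      20 * ∑ t ∈ Finset.Icc 2 T, √(d * √K / t) * ∫ ω, P.missRoot S ρ t ω ∂μ := by
  have h1 := hP.regret_le_sum hS hρ
  have h2 : ∑ t ∈ Finset.Icc 1 T, (∫ ω, P.loss S t ω (P.A t ω) (P.X t ω) ∂μ -
        ∫ ω, S.φ (ρ (P.X t ω)) (P.X t ω) ⬝ᵥ P.θ t ω ∂μ) ≤ ∑ t ∈ Finset.Icc 1 T,
        (∫ ω, ∑ x, ∑ a, P.regretCoeff S ρ t ω x a * (S.φ a x ⬝ᵥ P.θ t ω) ∂μ + 2 * S.gamma t) :=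
    Finset.sum_le_sum fun t ht =>
      hP.integral_loss_sub_le hA hS (Finset.mem_Icc.1 ht).1 (Finset.mem_Icc.1 ht).2
  rw [Finset.sum_add_distrib, ← Finset.mul_sum] at h2
  have h3 := hP.sum_integral_regretCoeff_le hA hS hd hT (ρ := ρ)
  have h4 := hS.sum_gamma_le hd hT
  have h5 : 0 ≤ √(K * S.L / S.lam) := Real.sqrt_nonneg _
  unfold Setting.kappa
  linarith

/-- The self-bounding constraint controls the probabilities of deviating. -/
theorem Play.SelfBounding.sum_miss_le {Δ C : ℝ} (hsb : P.SelfBounding S μ T ρ Δ C) (hΔ : 0 < Δ)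
    (hP : P.IsInteraction S μ ℱ T) (hA : P.IsTsallisINF S ℱ T) (hS : S.Assumptions) :
    Δ * ∑ t ∈ Finset.Icc 1 T, ∫ ω, P.miss S ρ t ω ∂μ ≤ 2 * (P.regret S μ T + C) := by
  have hdev : ∀ t ω x, t ∈ Finset.Icc 1 T →
      ∑ a ∈ Finset.univ.filter (fun a => a ≠ ρ x), P.policy S t ω x a =
        1 - P.policy S t ω x (ρ x) := by
    intro t ω x ht
    have h := hA.sum_policy hS (Finset.mem_Icc.1 ht).1 (Finset.mem_Icc.1 ht).2 ω x
    rw [Finset.filter_ne', ← h, ← Finset.add_sum_erase _ _ (Finset.mem_univ (ρ x))]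
    ring
  have hm : ∀ t ∈ Finset.Icc 1 T, ∀ x, Measurable[ℱ (t - 1)] fun ω =>
      1 - P.policy S t ω x (ρ x) := fun t ht x =>
    (hA.policy_measurable (Finset.mem_Icc.1 ht).1 (Finset.mem_Icc.1 ht).2 x (ρ x)).const_sub 1
  have hb : ∀ t ∈ Finset.Icc 1 T, ∀ ω x, |1 - P.policy S t ω x (ρ x)| ≤ 1 := fun t ht ω x => by
    have h := hA.policy_mem hS (Finset.mem_Icc.1 ht).1 (Finset.mem_Icc.1 ht).2 ω x
    rw [abs_of_nonneg (sub_nonneg.2 (le_one_of_mem_stdSimplex h _))]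
    linarith [h.1 (ρ x)]
  have hi : ∀ t ∈ Finset.Icc 1 T, Integrable
      (fun ω => 1 - P.policy S t ω (P.X t ω) (ρ (P.X t ω))) μ := fun t ht =>
    Integrable.of_bound (measurable_at_context (f := fun ω x => 1 - P.policy S t ω x (ρ x))
      (hP.measurable_X (Finset.mem_Icc.1 ht).1 (Finset.mem_Icc.1 ht).2) fun x =>
        (hm t ht x).mono (ℱ.le _) le_rfl).aestronglyMeasurable 1
      (Filter.Eventually.of_forall fun ω => hb t ht ω _)
  have hround : ∀ t ∈ Finset.Icc 1 T, ∫ ω, P.miss S ρ t ω ∂μ ≤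
      2 * ∫ ω, (1 - P.policy S t ω (P.X t ω) (ρ (P.X t ω))) ∂μ := by
    intro t ht
    obtain ⟨h1, h2⟩ := Finset.mem_Icc.1 ht
    rw [hP.integral_context h1 h2 (h := fun ω x => 1 - P.policy S t ω x (ρ x)) (hm t ht)
      (hb t ht), ← integral_const_mul]
    refine integral_mono (hA.integrable_miss hS h1 h2) (Integrable.const_mul
      (integrable_finsetSum _ fun x _ => Integrable.const_mul (Integrable.of_bound
      ((hm t ht x).mono (ℱ.le _) le_rfl).aestronglyMeasurable 1
      (Filter.Eventually.of_forall fun ω => hb t ht ω x)) _) _) fun ω => ?_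
    simp only [Play.miss]
    rw [Finset.mul_sum]
    refine Finset.sum_le_sum fun x _ => ?_
    rw [mul_left_comm]
    refine mul_le_mul_of_nonneg_left ?_ measureReal_nonneg
    -- The constraint speaks of π while `Play.miss` uses q. Here 1 - π ≥ (1 - γ)(1 - q) ≥ (1 - q)/2,
    -- because γ ≤ 1/2.
    obtain ⟨g0, g1⟩ := S.gamma_mem hS t
    have q1 := le_one_of_mem_stdSimplex (hA.q_mem t h1 h2 ω x) (ρ x)
    have e1 := le_one_of_mem_stdSimplex (hS.e_mem x) (ρ x)
    unfold Play.policy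
    nlinarith
  unfold Play.SelfBounding at hsb
  have e : ∫ ω, ∑ t ∈ Finset.Icc 1 T,
      ∑ a ∈ Finset.univ.filter (fun a => a ≠ ρ (P.X t ω)), P.policy S t ω (P.X t ω) a ∂μ =
      ∑ t ∈ Finset.Icc 1 T, ∫ ω, (1 - P.policy S t ω (P.X t ω) (ρ (P.X t ω))) ∂μ := by
    rw [← integral_finsetSum _ hi]
    refine integral_congr_ae (Filter.Eventually.of_forall fun ω => ?_)
    exact Finset.sum_congr rfl fun t ht => hdev t ω _ ht
  rw [e] at hsb
  have h := Finset.sum_le_sum hround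
  rw [← Finset.mul_sum] at h
  have := mul_le_mul_of_nonneg_left h hΔ.le
  linarith

end Expectation

/-! ### Solving the self-bounding inequality -/

theorem sum_Ioc_inv_le_log {n : ℕ} (hn : 1 ≤ n) {T : ℕ} (hT : n ≤ T) :
    ∑ t ∈ Finset.Ioc n T, 1 / (t : ℝ) ≤ Real.log (T / n) := by
  have hn0 : (0 : ℝ) < n := by exact_mod_cast hn
  induction T, hT using Nat.le_induction with
  | base => simp [hn0.ne']
  | succ T hT ih =>
    rw [← Finset.insert_Ioc_right_eq_Ioc_add_one (by omega), Finset.sum_insert (by simp)]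
    have hT0 : (0 : ℝ) < T := by exact_mod_cast (by omega)
    have h := Real.one_sub_inv_le_log_of_pos (x := ((T + 1 : ℕ) : ℝ) / T) (by positivity)
    have e : Real.log (((T + 1 : ℕ) : ℝ) / n) =
        Real.log (((T + 1 : ℕ) : ℝ) / T) + Real.log (T / n) := by
      rw [← Real.log_mul (by positivity) (by positivity)]
      congr 1
      field_simp
    have e2 : 1 - (((T + 1 : ℕ) : ℝ) / T)⁻¹ = 1 / ((T + 1 : ℕ) : ℝ) := by
      push_cast
      field_simp
      ring
    rw [e]
    linarith

theorem sum_Ioc_inv_sqrt_le {n : ℕ} (hn : 1 ≤ n) :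
    ∑ t ∈ Finset.Ioc 1 n, 1 / √(t : ℝ) ≤ 2 * (√n - 1) := by
  induction n, hn using Nat.le_induction with
  | base => simp
  | succ n hn ih =>
    rw [← Finset.insert_Ioc_right_eq_Ioc_add_one (by omega), Finset.sum_insert (by simp)]
    have h1 : √(n : ℝ) ^ 2 = n := Real.sq_sqrt (by positivity)
    have h2 : √((n + 1 : ℕ) : ℝ) ^ 2 = n + 1 := by
      rw [Real.sq_sqrt (by positivity)]; push_cast; rfl
    have h3 : 0 < √((n + 1 : ℕ) : ℝ) := by positivity
    have h4 : 1 / √((n + 1 : ℕ) : ℝ) ≤ 2 * (√((n + 1 : ℕ) : ℝ) - √n) := by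
      rw [div_le_iff₀ h3]
      nlinarith [sq_nonneg (√((n + 1 : ℕ) : ℝ) - √n)]
    linarith

theorem Icc_two_eq_Ioc (T : ℕ) : Finset.Icc 2 T = Finset.Ioc 1 T := by
  ext t
  simp [Nat.succ_le_iff]

section SelfBoundingArgument

variable {T : ℕ} {D L R C κ Δ : ℝ} {m w : ℕ → ℝ}

/-- In the application D = d√K, while w t and m t are the expectations of `miss` and `missRoot`. The
free parameter b of Young's inequality trades the self-bounding part against the harmonic sum over
the rounds in s. -/
theorem sum_le_of_self_bounding {s : Finset ℕ} (hs : s ⊆ Finset.Icc 2 T) (hΔ : 0 < Δ)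
    (hL : 0 < L) (hw : ∀ t ∈ Finset.Icc 1 T, 0 ≤ w t)
    (hamgm : ∀ t ∈ Finset.Icc 2 T, ∀ b, 0 < b → √(D / t) * m t ≤ (b * L * w t + D / (t * b)) / 2)
    (hsb : Δ * ∑ t ∈ Finset.Icc 1 T, w t ≤ 2 * (R + C)) {b : ℝ} (hb : 0 < b) :
    ∑ t ∈ s, √(D / t) * m t ≤ b * L / Δ * (R + C) + D / (2 * b) * ∑ t ∈ s, 1 / (t : ℝ) := by
  have h1 : ∑ t ∈ s, √(D / t) * m t ≤ ∑ t ∈ s, (b * L / 2 * w t + D / (2 * b) * (1 / (t : ℝ))) :=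
    Finset.sum_le_sum fun t ht => (hamgm t (hs ht) b hb).trans_eq (by
      have : (t : ℝ) ≠ 0 := by
        have := (Finset.mem_Icc.1 (hs ht)).1
        exact_mod_cast (by omega : t ≠ 0)
      field_simp)
  rw [Finset.sum_add_distrib, ← Finset.mul_sum, ← Finset.mul_sum] at h1
  have h2 : ∑ t ∈ s, w t ≤ ∑ t ∈ Finset.Icc 1 T, w t :=
    Finset.sum_le_sum_of_subset_of_nonneg
      (hs.trans (Finset.Icc_subset_Icc_left (by norm_num))) fun t ht _ => hw t ht
  have h3 : ∑ t ∈ s, w t ≤ 2 * (R + C) / Δ := by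
    rw [le_div_iff₀ hΔ]
    nlinarith
  have h4 : b * L / 2 * ∑ t ∈ s, w t ≤ b * L / 2 * (2 * (R + C) / Δ) := by gcongr
  have h5 : b * L / 2 * (2 * (R + C) / Δ) = b * L / Δ * (R + C) := by field_simp
  linarith

/-- With b = Δ/(40L) the prefactor 20·bL/Δ is 1/2, so half of R moves to the left; doubling then
gives 1280, 800 = 2·20·20 and C. -/
theorem le_of_self_bounding (hT : 1 ≤ T) (hΔ : 0 < Δ) (hD : 0 < D) (hL : 0 < L)
    (hw : ∀ t ∈ Finset.Icc 1 T, 0 ≤ w t)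
    (hamgm : ∀ t ∈ Finset.Icc 2 T, ∀ b, 0 < b → √(D / t) * m t ≤ (b * L * w t + D / (t * b)) / 2)
    (hsb : Δ * ∑ t ∈ Finset.Icc 1 T, w t ≤ 2 * (R + C))
    (hR : R ≤ 640 * κ + 20 * ∑ t ∈ Finset.Icc 2 T, √(D / t) * m t) :
    R ≤ 1280 * κ + 800 * (L * D / Δ * Real.log T) + C := by
  have h1 := sum_le_of_self_bounding (s := Finset.Icc 2 T) subset_rfl hΔ hL hw hamgm hsb
    (b := Δ / (40 * L)) (by positivity)
  have h2 := sum_Ioc_inv_le_log le_rfl hT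
  rw [← Icc_two_eq_Ioc, Nat.cast_one, div_one] at h2
  have h3 : D / (2 * (Δ / (40 * L))) * ∑ t ∈ Finset.Icc 2 T, 1 / (t : ℝ) ≤
      D / (2 * (Δ / (40 * L))) * Real.log T := by gcongr
  have e1 : Δ / (40 * L) * L / Δ = 1 / 40 := by field_simp
  have e2 : D / (2 * (Δ / (40 * L))) = 20 * (L * D / Δ) := by field_simp; norm_num
  rw [e2] at h1 h3
  rw [e1] at h1
  nlinarith

/-- The target is y = √(C·LD/Δ·log₊). Up to τ = CL/Δ the trivial bound m ≤ 1 already costs only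
O(√(Dτ)) ≤ O(y); after τ the harmonic sum is O(log₊(T/τ)). The lower bound on C enters only as y ≤
C. -/
theorem le_of_self_bounding_of_corruption (hT : 1 ≤ T) (hΔ : 0 < Δ) (hC : 0 < C) (hD : 0 < D)
    (hL : 0 < L) (hκ : 0 ≤ κ) (hw : ∀ t ∈ Finset.Icc 1 T, 0 ≤ w t)
    (hm : ∀ t ∈ Finset.Icc 2 T, m t ≤ 1)
    (hamgm : ∀ t ∈ Finset.Icc 2 T, ∀ b, 0 < b → √(D / t) * m t ≤ (b * L * w t + D / (t * b)) / 2)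
    (hsb : Δ * ∑ t ∈ Finset.Icc 1 T, w t ≤ 2 * (R + C))
    (hR : R ≤ 640 * κ + 20 * ∑ t ∈ Finset.Icc 2 T, √(D / t) * m t)
    (hC1 : L * D / Δ * logPlus (Δ * T / (C * L)) ≤ C) (hC2 : C ≤ Δ * T / L) :
    R ≤ 1280 * κ + 1700 * √(C * (L * D) / Δ * logPlus (Δ * T / (C * L))) := by
  set lp := logPlus (Δ * T / (C * L)) with hlp
  have hlp1 : 1 ≤ lp := le_max_left _ _
  have hlp2 : Real.log (Δ * T / (C * L)) ≤ lp := le_max_right _ _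
  set y := √(C * (L * D) / Δ * lp) with hy
  have hy2 : y ^ 2 = C * (L * D) / Δ * lp := Real.sq_sqrt (by positivity)
  have hy0 : 0 < y := Real.sqrt_pos.2 (by positivity)
  have hyC : y ≤ C := by
    refine (le_abs_self _).trans (abs_le_of_sq_le_sq ?_ hC.le)
    rw [hy2, sq]
    calc C * (L * D) / Δ * lp = C * (L * D / Δ * lp) := by ring
      _ ≤ C * C := by gcongr
  -- A negative R is trivial; its sign is needed for (y/C)·R ≤ R.
  rcases lt_or_ge R 0 with hneg | hR0
  · have : 0 ≤ 1280 * κ + 1700 * y := by positivity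
    linarith
  have hT0 : (0 : ℝ) < T := by exact_mod_cast hT
  set τ := C * L / Δ with hτ
  have hτ0 : 0 < τ := by positivity
  have hτT : τ ≤ T := by
    rw [hτ, div_le_iff₀ hΔ]
    rw [le_div_iff₀ hL] at hC2
    linarith
  -- τ may be below 1, and n ≥ 1 keeps T/n meaningful.
  set n := max 1 ⌊τ⌋₊ with hn
  have hn1 : 1 ≤ n := le_max_left _ _
  have hn0 : (0 : ℝ) < n := by exact_mod_cast hn1
  have hnT : n ≤ T := max_le hT (Nat.floor_le_of_le hτT)
  have hnτ : τ ≤ 2 * n := by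
    have h1 := Nat.lt_floor_add_one τ
    have h2 : (⌊τ⌋₊ : ℝ) ≤ n := by exact_mod_cast le_max_right _ _
    have h3 : (1 : ℝ) ≤ n := by exact_mod_cast hn1
    linarith
  have hsplit : ∑ t ∈ Finset.Icc 2 T, √(D / t) * m t =
      ∑ t ∈ Finset.Ioc 1 n, √(D / t) * m t + ∑ t ∈ Finset.Ioc n T, √(D / t) * m t := by
    rw [Icc_two_eq_Ioc, Finset.sum_Ioc_consecutive _ hn1 hnT]
  have hearly : ∑ t ∈ Finset.Ioc 1 n, √(D / t) * m t ≤ 2 * y := by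
    have e1 : ∑ t ∈ Finset.Ioc 1 n, √(D / t) * m t ≤ √D * ∑ t ∈ Finset.Ioc 1 n, 1 / √(t : ℝ) := by
      rw [Finset.mul_sum]
      refine Finset.sum_le_sum fun t ht => ?_
      obtain ⟨a1, a2⟩ := Finset.mem_Ioc.1 ht
      rw [Real.sqrt_div hD.le, mul_one_div]
      exact mul_le_of_le_one_right (by positivity) (hm t (Finset.mem_Icc.2 ⟨a1, a2.trans hnT⟩))
    have e2 := sum_Ioc_inv_sqrt_le hn1
    -- When n = 1 the left side is 0, which covers τ < 1; this uses the -1 in `sum_Ioc_inv_sqrt_le`.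
    have e3 : 2 * (√(n : ℝ) - 1) ≤ 2 * √τ := by
      rcases le_total ⌊τ⌋₊ 1 with h | h
      · rw [hn, max_eq_left h]
        simp
      · rw [hn, max_eq_right h]
        have : √(⌊τ⌋₊ : ℝ) ≤ √τ := Real.sqrt_le_sqrt (Nat.floor_le hτ0.le)
        linarith
    have e4 : √D * √τ ≤ y := by
      rw [← Real.sqrt_mul hD.le]
      refine Real.sqrt_le_sqrt ?_
      have : D * τ = C * (L * D) / Δ * 1 := by rw [hτ]; ring
      rw [this]
      gcongr
    calc _ ≤ √D * ∑ t ∈ Finset.Ioc 1 n, 1 / √(t : ℝ) := e1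
      _ ≤ √D * (2 * √τ) := by gcongr; exact e2.trans e3
      _ ≤ 2 * y := by linarith
  have hsub : Finset.Ioc n T ⊆ Finset.Icc 2 T := by
    rw [Icc_two_eq_Ioc]
    exact Finset.Ioc_subset_Ioc_left hn1
  -- This b makes the C part equal to y/40 and the harmonic part at most 40y, while R gets the
  -- coefficient y/(40C) ≤ 1/40.
  have hlate := sum_le_of_self_bounding hsub hΔ hL hw hamgm hsb
    (b := y * Δ / (40 * L * C)) (by positivity)
  have hlog : ∑ t ∈ Finset.Ioc n T, 1 / (t : ℝ) ≤ 2 * lp := by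
    refine (sum_Ioc_inv_le_log hn1 hnT).trans ?_
    have h1 : (T : ℝ) / n ≤ 2 * (Δ * T / (C * L)) := by
      have : Δ * T / (C * L) = T / τ := by rw [hτ]; field_simp
      rw [this, ← mul_div_assoc, div_le_div_iff₀ hn0 hτ0]
      nlinarith
    have h2 : Real.log (T / n) ≤ Real.log (2 * (Δ * T / (C * L))) :=
      Real.log_le_log (by positivity) h1
    rw [Real.log_mul (by norm_num) (by positivity)] at h2
    linarith [Real.log_two_lt_d9]
  have hlate2 : D / (2 * (y * Δ / (40 * L * C))) * ∑ t ∈ Finset.Ioc n T, 1 / (t : ℝ) ≤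
      D / (2 * (y * Δ / (40 * L * C))) * (2 * lp) := by gcongr
  have e5 : D / (2 * (y * Δ / (40 * L * C))) * (2 * lp) = 40 * y := by
    have : D / (2 * (y * Δ / (40 * L * C))) * (2 * lp) = 40 * (C * (L * D) / Δ * lp) / y := by
      field_simp
    rw [this, ← hy2]
    field_simp
  have e6 : y * Δ / (40 * L * C) * L / Δ * (R + C) = 1 / 40 * (y / C * R + y) := by
    field_simp
  have e7 : y / C * R ≤ R := mul_le_of_le_one_left hR0 ((div_le_one hC).2 hyC)
  rw [hsplit] at hR
  rw [e6] at hlate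
  rw [e5] at hlate2
  -- Altogether R/2 ≤ 640κ + 40y + y/2 + 800y.
  linarith

end SelfBoundingArgument

/-! ### Young's inequality in expectation and the main theorem -/

section Final

variable {Ω 𝒳 : Type*} [mΩ : MeasurableSpace Ω] [MeasurableSpace 𝒳] [Fintype 𝒳]
  [MeasurableSingletonClass 𝒳] {K d : ℕ}
  {P : Play Ω 𝒳 K d} {S : Setting 𝒳 K d} {μ : Measure Ω} [IsProbabilityMeasure μ]
  {ℱ : Filtration ℕ mΩ} {T t : ℕ} {ρ : 𝒳 → Fin K}

theorem Play.IsTsallisINF.sqrt_mul_integral_missRoot_le (hA : P.IsTsallisINF S ℱ T)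
    (hS : S.Assumptions) (h1 : 1 ≤ t) (h2 : t ≤ T) {D b : ℝ} (hD : 0 ≤ D) (hb : 0 < b) :
    √(D / t) * ∫ ω, P.missRoot S ρ t ω ∂μ ≤
      (b * S.L * ∫ ω, P.miss S ρ t ω ∂μ + D / (t * b)) / 2 := by
  have ht0 : (0 : ℝ) < t := by exact_mod_cast h1
  have e : (b * S.L * ∫ ω, P.miss S ρ t ω ∂μ + D / (t * b)) / 2 =
      ∫ ω, (b * S.L / 2 * P.miss S ρ t ω + D / (t * b) / 2) ∂μ := by
    rw [integral_add ((hA.integrable_miss hS h1 h2).const_mul _) (integrable_const _),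
      integral_const_mul]
    simp only [integral_const, probReal_univ, smul_eq_mul, one_mul]
    ring
  rw [e, ← integral_const_mul]
  refine integral_mono ((hA.integrable_missRoot h1 h2).const_mul _)
    (((hA.integrable_miss hS h1 h2).const_mul _).add (integrable_const _)) fun ω => ?_
  have hL := hS.one_le_L
  have h0 := (hA.miss_mem hS h1 h2 ω (ρ := ρ)).1
  have hle : P.missRoot S ρ t ω ≤ √(S.L * P.miss S ρ t ω) := min_le_right _ _
  have s1 : √(S.L * P.miss S ρ t ω) ^ 2 = S.L * P.miss S ρ t ω := Real.sq_sqrt (by positivity)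
  have s2 : √(D / t) ^ 2 = D / t := Real.sq_sqrt (by positivity)
  have s3 : D / (t * b) = √(D / t) ^ 2 / b := by rw [s2]; field_simp
  simp only
  refine (mul_le_mul_of_nonneg_left hle (Real.sqrt_nonneg _)).trans ?_
  rw [s3]
  -- Young's inequality with weight b, pointwise in ω.
  have s4 : 0 ≤ (b * √(S.L * P.miss S ρ t ω) - √(D / t)) ^ 2 / (2 * b) := by positivity
  have s5 : (b * √(S.L * P.miss S ρ t ω) - √(D / t)) ^ 2 / (2 * b) =
      b / 2 * √(S.L * P.miss S ρ t ω) ^ 2 + √(D / t) ^ 2 / b / 2 -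
        √(D / t) * √(S.L * P.miss S ρ t ω) := by
    field_simp
    ring
  rw [s5, s1] at s4
  linarith

end Final

end LCTsallis

end

theorem theorem4p4 :
    ∃ c : ℝ, 0 < c ∧
      ∀ (Ω 𝒳 : Type*) [MeasurableSpace Ω] [MeasurableSpace 𝒳] [MeasurableSingletonClass 𝒳]
        [Fintype 𝒳] (μ : MeasureTheory.Measure Ω) [MeasureTheory.IsProbabilityMeasure μ]
        (K d T : ℕ) (_hd : 1 ≤ d) (_hT : 1 ≤ T)
        (S : LCTsallis.Setting 𝒳 K d) (_hS : S.Assumptions)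
        (ℱ : MeasureTheory.Filtration ℕ ‹MeasurableSpace Ω›)
        (P : LCTsallis.Play Ω 𝒳 K d) (_hP : P.IsInteraction S μ ℱ T)
        (_hAlg : P.IsTsallisINF S ℱ T)
        (ρ : 𝒳 → Fin K) (_hρ : P.IsOptimalPolicy S μ T ρ)
        (Δ C : ℝ) (_hΔ : 0 < Δ) (_hC : 0 < C) (_hsb : P.SelfBounding S μ T ρ Δ C),
        P.regret S μ T ≤ c * (S.L * d * √K / Δ * Real.log T + S.kappa T + C) ∧
        (S.L ^ 2 * d * √K / Δ ^ 2 ≤ T →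
          d * S.L * √K / Δ * (Real.log (T * Δ ^ 2 / (S.L ^ 2 * d * √K)) + 1) ≤ C →
          C ≤ Δ * T / S.L →
          P.regret S μ T ≤
            c * (√(C * S.L * √K * d / Δ * LCTsallis.logPlus (Δ * T / (C * S.L))) +
              S.kappa T)) := by
  -- Any constant above 1280 (for κ) and 1700 (for the square root) would serve.
  refine ⟨2000, by norm_num, ?_⟩
  intro Ω 𝒳 _ _ _ _ μ _ K d T hd hT S hS ℱ P hP hA ρ hρ Δ C hΔ hC hsb
  have hL := hS.one_le_L
  have hL0 : 0 < S.L := by linarith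
  have hd0 : (0 : ℝ) < d := by exact_mod_cast hd
  have hK0 : (0 : ℝ) < K := by exact_mod_cast hS.one_le_K
  have hκ : 1 ≤ S.kappa T := (hS.one_le_sqrt hd).trans (hS.sqrt_le_kappa hT)
  have hlog : 0 ≤ Real.log T := Real.log_nonneg (by exact_mod_cast hT)
  have hlogterm : 0 ≤ S.L * d * √K / Δ * Real.log T := by positivity
  -- For T = 1 the logarithm vanishes and the harmonic bound fails, but R ≤ 2 ≤ 2κ.
  rcases hT.eq_or_lt with rfl | hT2
  · have h2 := hP.regret_le_two_mul hS hρ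
    rw [Nat.cast_one, mul_one] at h2
    refine ⟨by linarith, fun _ _ _ => ?_⟩
    have := Real.sqrt_nonneg
      (C * S.L * √K * d / Δ * LCTsallis.logPlus (Δ * (1 : ℕ) / (C * S.L)))
    linarith
  · have hD : 0 < d * √K := by positivity
    have hw : ∀ t ∈ Finset.Icc 1 T, 0 ≤ ∫ ω, P.miss S ρ t ω ∂μ := fun t ht =>
      MeasureTheory.integral_nonneg fun ω =>
        (hA.miss_mem hS (Finset.mem_Icc.1 ht).1 (Finset.mem_Icc.1 ht).2 ω).1
    have hm : ∀ t ∈ Finset.Icc 2 T, ∫ ω, P.missRoot S ρ t ω ∂μ ≤ 1 := fun t ht => by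
      have h := MeasureTheory.integral_mono (hA.integrable_missRoot (μ := μ) (ρ := ρ)
        ((by norm_num : 1 ≤ 2).trans (Finset.mem_Icc.1 ht).1) (Finset.mem_Icc.1 ht).2)
        (MeasureTheory.integrable_const (1 : ℝ)) fun ω => P.missRoot_le_one S ρ t ω
      simpa using h
    have hamgm : ∀ t ∈ Finset.Icc 2 T, ∀ b, 0 < b →
        √(d * √K / t) * ∫ ω, P.missRoot S ρ t ω ∂μ ≤
          (b * S.L * ∫ ω, P.miss S ρ t ω ∂μ + d * √K / (t * b)) / 2 := fun t ht b hb =>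
      hA.sqrt_mul_integral_missRoot_le hS ((by norm_num : 1 ≤ 2).trans (Finset.mem_Icc.1 ht).1)
        (Finset.mem_Icc.1 ht).2 hD.le hb
    have hsum := hsb.sum_miss_le hΔ hP hA hS
    have hR := hP.regret_le hA hS hd hT2 hρ
    refine ⟨?_, fun hT' hC1 hC2 => ?_⟩
    · have h := LCTsallis.le_of_self_bounding hT hΔ hD hL0 hw hamgm hsum hR
      have e : S.L * (d * √K) / Δ = S.L * d * √K / Δ := by ring
      rw [e] at h
      linarith
    · have hB : 0 < d * S.L * √K / Δ := by positivity
      have hratio : 1 ≤ T * Δ ^ 2 / (S.L ^ 2 * d * √K) := by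
        rw [le_div_iff₀ (by positivity), one_mul]
        rwa [div_le_iff₀ (by positivity)] at hT'
      have hlog0 := Real.log_nonneg hratio
      -- The hypothesis T ≥ L²D/Δ² makes the logarithm nonnegative, so C dominates LD/Δ. Hence
      -- ΔT/(CL) is at most the argument of the logarithm in the hypothesis on C, which converts
      -- that hypothesis into one on log₊(ΔT/(CL)).
      have hBC : d * S.L * √K / Δ ≤ C := le_trans (le_mul_of_one_le_right hB.le (by linarith)) hC1
      have hT0 : (0 : ℝ) < T := by exact_mod_cast hT
      have hle : Δ * T / (C * S.L) ≤ T * Δ ^ 2 / (S.L ^ 2 * d * √K) := by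
        rw [div_le_iff₀ hΔ] at hBC
        rw [div_le_div_iff₀ (by positivity) (by positivity)]
        calc Δ * T * (S.L ^ 2 * d * √K) = Δ * T * S.L * (d * S.L * √K) := by ring
          _ ≤ Δ * T * S.L * (C * Δ) := by gcongr
          _ = _ := by ring
      have hlp : LCTsallis.logPlus (Δ * T / (C * S.L)) ≤
          Real.log (T * Δ ^ 2 / (S.L ^ 2 * d * √K)) + 1 :=
        max_le (by linarith) (by linarith [Real.log_le_log (by positivity) hle])
      have hC1' : S.L * (d * √K) / Δ * LCTsallis.logPlus (Δ * T / (C * S.L)) ≤ C := by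
        refine le_trans ?_ hC1
        rw [show S.L * (d * √K) / Δ = d * S.L * √K / Δ by ring]
        gcongr
      have h := LCTsallis.le_of_self_bounding_of_corruption hT hΔ hC hD hL0 (by linarith) hw hm
        hamgm hsum hR hC1' hC2
      rw [show C * (S.L * (d * √K)) / Δ = C * S.L * √K * d / Δ by ring] at h
      have := Real.sqrt_nonneg (C * S.L * √K * d / Δ * LCTsallis.logPlus (Δ * T / (C * S.L)))
      linarith
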